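/- Consider the Klein-Gordon-Schrödinger system in two space dimensions $$ i\partial_t u+\Delta u = nu,\qquad \partial_t^2 n+(1-\Delta)n=|u|^2,\qquad u(0)=u_0,\ n(0)=n_0,\ \partial_t n(0)=n_1, $$ where $u$ is complex-valued and $n$ is real-valued on $\mathbb R^2\times[0,T]$; a solution always means a solution of the corresponding system of integral equations. For $s,\sigma\in\mathbb R$ let $\mathcal X^{s,\sigma}:=H^s(\mathbb R^2;\mathbb C)\times H^{\sigma}(\mathbb R^2;\mathbb R)\times H^{\sigma-1}(\mathbb R^2;\mathbb R)$. A flow map on $[0,T]$ on an open set $U\subseteq\mathcal X^{s,\sigma}$ is a map $\Phi:U\to C([0,T];\mathcal X^{s,\sigma})$ such that, for all Schwartz data $(u_0,n_0,n_1)\in U$, $\Phi(u_0,n_0,n_1)$ coincides with $(u,n,\partial_t n)$ whenever $(u,n,\partial_tn)\in C([0,T];\mathcal X^{s,\sigma})\cap C([0,T];H^2\times H^2\times H^1)$ is a solution with these data. (On rougher data nothing is required of $\Phi$.) **Theorem.** Let $s,\sigma\in\mathbb R$ satisfy $$ \sigma-2s-\tfrac32>0\quad\text{or}\quad s<-\tfrac14\quad\text{or}\quad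 \sigma<-\tfrac12 . $$ Then for every $T>0$, every open neighbourhood $U$ of the origin in $\mathcal X^{s,\sigma}$ and every flow map $\Phi$ on $[0,T]$ on $U$, the map $(u_0,n_0,n_1)\mapsto (u,n,\partial_tn)=\Phi(u_0,n_0,n_1)$ from $U$ to $C([0,T];\mathcal X^{s,\sigma})$ is not of class $C^2$ (in the sense of Fréchet derivatives over $\mathbb R$); moreover, for each fixed $t\in(0,T]$ the map $(u_0,n_0,n_1)\mapsto (u(t),n(t),\partial_tn(t))=\Phi(u_0,n_0,n_1)(t)$ from $U$ to $\mathcal X^{s,\sigma}$ is not of class $C^2$. -/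

import Mathlib

open MeasureTheory TemperedDistribution
open scoped SchwartzMap

noncomputable section

namespace KGS

/-- The plane `ℝ²` with its Euclidean structure. -/
abbrev Plane : Type := EuclideanSpace ℝ (Fin 2)

/-- The complex vector space of tempered distributions on `ℝ²` of Sobolev regularity `s`
(based on `L²`). -/
def sobolevSubmodule (s : ℝ) : Submodule ℂ 𝓢'(Plane, ℂ) where
  carrier := {f | MemSobolev s 2 f}
  add_mem' hf hg := hf.add hg
  zero_mem' := memSobolev_fun_zero Plane ℂ s 2
  smul_mem' c _ hf := hf.smul c

/-- The inhomogeneous Sobolev space `H^s(ℝ²; ℂ)`. Its elements are tempered distributions; it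
carries the Sobolev norm defined below, not the topology of `𝓢'`. -/
def Sobolev (s : ℝ) : Type := ↥(sobolevSubmodule s)

namespace Sobolev

variable {s : ℝ}

instance : AddCommGroup (Sobolev s) := inferInstanceAs (AddCommGroup ↥(sobolevSubmodule s))

instance : Module ℂ (Sobolev s) := inferInstanceAs (Module ℂ ↥(sobolevSubmodule s))

/-- The tempered distribution underlying an element of `H^s`. -/
def dist : Sobolev s →ₗ[ℂ] 𝓢'(Plane, ℂ) := (sobolevSubmodule s).subtype

theorem memSobolev (f : Sobolev s) : MemSobolev s 2 (dist f) := Subtype.property f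

theorem dist_injective : Function.Injective (dist (s := s)) := Subtype.val_injective

/-- An `L²` function is determined by the tempered distribution it defines. -/
theorem lp_ext {f g : Lp ℂ 2 (volume : Measure Plane)}
    (h : (f : 𝓢'(Plane, ℂ)) = (g : 𝓢'(Plane, ℂ))) : f = g :=
  LinearMap.ker_eq_bot.mp
    (Lp.ker_toTemperedDistributionCLM_eq_bot (F := ℂ) (μ := (volume : Measure Plane)) (p := 2)) h

/-- The `L²` function representing the Bessel potential `𝓕⁻¹ ((1 + |ξ|²)^(s/2) 𝓕 f)`. -/
def besselFun (f : Sobolev s) : Lp ℂ 2 (volume : Measure Plane) :=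
  Classical.choose (memSobolev f)

theorem besselFun_spec (f : Sobolev s) :
    besselPotential Plane ℂ s (dist f) =
      Lp.toTemperedDistributionCLM ℂ (volume : Measure Plane) 2 (besselFun f) :=
  Classical.choose_spec (memSobolev f)

/-- The Bessel potential as a linear map from `H^s` to `L²`. -/
def bessel : Sobolev s →ₗ[ℂ] Lp ℂ 2 (volume : Measure Plane) where
  toFun f := besselFun f
  map_add' f g := lp_ext <| by
    rw [← Lp.toTemperedDistributionCLM_apply, ← Lp.toTemperedDistributionCLM_apply, map_add,
      ← besselFun_spec, ← besselFun_spec, ← besselFun_spec, map_add, map_add]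
  map_smul' c f := lp_ext <| by
    rw [RingHom.id_apply, ← Lp.toTemperedDistributionCLM_apply,
      ← Lp.toTemperedDistributionCLM_apply, map_smul, ← besselFun_spec, ← besselFun_spec,
      map_smul, map_smul]

theorem bessel_spec (f : Sobolev s) :
    besselPotential Plane ℂ s (dist f) = (bessel f : 𝓢'(Plane, ℂ)) :=
  besselFun_spec f

theorem bessel_injective : Function.Injective (bessel (s := s)) := by
  intro f g h
  apply dist_injective
  have h1 : besselPotential Plane ℂ s (dist f) = besselPotential Plane ℂ s (dist g) := by
    rw [bessel_spec, bessel_spec, h]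
  rw [← (besselPotential_neg_apply_eq_iff s _ _).mpr h1,
    (besselPotential_neg_apply_eq_iff s _ _).mpr rfl]

/-- The norm `‖f‖_{H^s} = ‖(1 + |ξ|²)^(s/2) 𝓕 f‖_{L²}`. -/
instance : NormedAddCommGroup (Sobolev s) :=
  NormedAddCommGroup.induced (Sobolev s) (Lp ℂ 2 (volume : Measure Plane)) bessel bessel_injective

theorem norm_eq (f : Sobolev s) : ‖f‖ = ‖bessel f‖ := rfl

instance : NormedSpace ℂ (Sobolev s) := NormedSpace.induced ℂ (Sobolev s) _ bessel

instance : NormedSpace ℝ (Sobolev s) := NormedSpace.restrictScalars ℝ ℂ (Sobolev s)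

end Sobolev

/-- The real Banach space `H^s(ℝ²; ℝ)` of real-valued elements of `H^s`: those distributions
that take real values on real-valued test functions. -/
def realSobolev (s : ℝ) : Submodule ℝ (Sobolev s) where
  carrier := {f | ∀ φ : 𝓢(Plane, ℂ), (∀ x, (φ x).im = 0) → (Sobolev.dist f φ).im = 0}
  add_mem' {f g} hf hg φ hφ := by
    have h : Sobolev.dist (f + g) φ = Sobolev.dist f φ + Sobolev.dist g φ := by
      rw [map_add]; rfl
    rw [h, Complex.add_im, hf φ hφ, hg φ hφ, add_zero]
  zero_mem' φ _ := by
    have h : Sobolev.dist (0 : Sobolev s) φ = 0 := by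
      rw [map_zero]; rfl
    rw [h, Complex.zero_im]
  smul_mem' c f hf φ hφ := by
    have h : Sobolev.dist (c • f) φ = (c : ℂ) * Sobolev.dist f φ := by
      change Sobolev.dist ((c : ℂ) • f) φ = _
      rw [map_smul]; rfl
    rw [h, Complex.im_ofReal_mul, hf φ hφ, mul_zero]

/-- The phase space `H^s(ℝ²; ℂ) × H^σ(ℝ²; ℝ) × H^(σ-1)(ℝ²; ℝ)` of triples `(u, n, ∂ₜn)`. -/
abbrev Phase (s σ : ℝ) : Type := Sobolev s × realSobolev σ × realSobolev (σ - 1)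

/-! ### The free evolutions

With Mathlib's normalization of the Fourier transform, `-Δ` is the Fourier multiplier with symbol
`|2πξ|²` and `A = 1 - Δ` the one with symbol `1 + |2πξ|²`. -/

/-- The symbol `ω(ξ) = (1 + |2πξ|²)^(1/2)` of `A^(1/2)`. -/
def omega (ξ : Plane) : ℝ := √(1 + (2 * Real.pi * ‖ξ‖) ^ 2)

/-- The Schrödinger group `e^(irΔ)`. -/
def schrodinger (r : ℝ) : 𝓢'(Plane, ℂ) →L[ℂ] 𝓢'(Plane, ℂ) :=
  fourierMultiplierCLM ℂ fun ξ => Complex.exp (((-(r * (2 * Real.pi * ‖ξ‖) ^ 2) : ℝ) : ℂ) * Complex.I)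

/-- The operator `cos (r A^(1/2))`. -/
def cosA (r : ℝ) : 𝓢'(Plane, ℂ) →L[ℂ] 𝓢'(Plane, ℂ) :=
  fourierMultiplierCLM ℂ fun ξ => ((Real.cos (r * omega ξ) : ℝ) : ℂ)

/-- The operator `A^(-1/2) sin (r A^(1/2))`. -/
def sinA (r : ℝ) : 𝓢'(Plane, ℂ) →L[ℂ] 𝓢'(Plane, ℂ) :=
  fourierMultiplierCLM ℂ fun ξ => (((omega ξ)⁻¹ * Real.sin (r * omega ξ) : ℝ) : ℂ)

/-- The operator `d/dr cos (r A^(1/2)) = - A^(1/2) sin (r A^(1/2))`. -/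
def dcosA (r : ℝ) : 𝓢'(Plane, ℂ) →L[ℂ] 𝓢'(Plane, ℂ) :=
  fourierMultiplierCLM ℂ fun ξ => ((-(omega ξ * Real.sin (r * omega ξ)) : ℝ) : ℂ)

/-- The integrable function `f g`, for `f, g ∈ L²`, as a tempered distribution. -/
def prodDist (f g : Lp ℂ 2 (volume : Measure Plane)) : 𝓢'(Plane, ℂ) :=
  ((f • g : Lp ℂ 1 (volume : Measure Plane)) : 𝓢'(Plane, ℂ))

/-! ### Solutions and flow maps -/

/-- `w = (u, n, ∂ₜn) ∈ C([0,T]; H^s × H^σ × H^(σ-1))` is a strong solution on `[0,T]`, with initial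
data `d = (u₀, n₀, n₁)`, of the Klein-Gordon-Schrödinger system
`i ∂ₜu + Δu = n u`, `∂ₜ²n + (1 - Δ) n = |u|²`: it is also a curve in
`C([0,T]; H² × H² × H¹)` and solves the associated system of integral equations
(tested against Schwartz functions). -/
structure IsStrongSolution {s σ T : ℝ} (d : Phase s σ) (w : C(Set.Icc (0 : ℝ) T, Phase s σ)) :
    Prop where
  regular : ∃ v : C(Set.Icc (0 : ℝ) T, Phase 2 2), ∀ t,
    Sobolev.dist (v t).1 = Sobolev.dist (w t).1 ∧
    Sobolev.dist (v t).2.1.1 = Sobolev.dist (w t).2.1.1 ∧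
    Sobolev.dist (v t).2.2.1 = Sobolev.dist (w t).2.2.1
  integral_equations : ∃ u n : ℝ → Lp ℂ 2 (volume : Measure Plane),
    (∀ t : Set.Icc (0 : ℝ) T,
      Sobolev.dist (w t).1 = (u t : 𝓢'(Plane, ℂ)) ∧
      Sobolev.dist (w t).2.1.1 = (n t : 𝓢'(Plane, ℂ))) ∧
    ∀ (t : Set.Icc (0 : ℝ) T) (φ : 𝓢(Plane, ℂ)),
      Sobolev.dist (w t).1 φ =
        schrodinger t (Sobolev.dist d.1) φ
          - Complex.I * ∫ τ in (0 : ℝ)..t, schrodinger (t - τ) (prodDist (n τ) (u τ)) φ ∧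
      Sobolev.dist (w t).2.1.1 φ =
        cosA t (Sobolev.dist d.2.1.1) φ + sinA t (Sobolev.dist d.2.2.1) φ
          + ∫ τ in (0 : ℝ)..t, sinA (t - τ) (prodDist (star (u τ)) (u τ)) φ ∧
      Sobolev.dist (w t).2.2.1 φ =
        dcosA t (Sobolev.dist d.2.1.1) φ + cosA t (Sobolev.dist d.2.2.1) φ
          + ∫ τ in (0 : ℝ)..t, cosA (t - τ) (prodDist (star (u τ)) (u τ)) φ

/-- The initial data `(u₀, n₀, n₁)` are Schwartz functions. -/
def IsSchwartz {s σ : ℝ} (d : Phase s σ) : Prop :=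
  ∃ f g h : 𝓢(Plane, ℂ),
    Sobolev.dist d.1 = (f : 𝓢'(Plane, ℂ)) ∧
    Sobolev.dist d.2.1.1 = (g : 𝓢'(Plane, ℂ)) ∧
    Sobolev.dist d.2.2.1 = (h : 𝓢'(Plane, ℂ))

/-- `Φ` is a data-to-solution flow map on `[0,T]` for data in `U ⊆ H^s × H^σ × H^(σ-1)`: for
Schwartz data in `U` it gives the strong solution. For rough data, for which the nonlinear terms
need not be defined, nothing is required: a continuous flow map is determined on an open `U` by
its values at Schwartz data, by density. -/
def IsFlowMap {s σ T : ℝ} (U : Set (Phase s σ))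
    (Φ : Phase s σ → C(Set.Icc (0 : ℝ) T, Phase s σ)) : Prop :=
  ∀ d ∈ U, IsSchwartz d →
    ∀ w : C(Set.Icc (0 : ℝ) T, Phase s σ), IsStrongSolution d w → Φ d = w

end KGS

end

/-!
Write `u₀ = 𝓕⁻ a`, `n₀ = 𝓕⁻ b`, `n₁ = 0` with Schwartz functions `a`, `b`. For small `ε` the system
with data `ε (u₀, n₀, n₁)` has a strong solution on the whole interval `[0, T]`, which any flow map
has to reproduce. It is constructed on the Fourier side, in a space of continuous functions of
`(t, ξ)` that decay like `(1 + |ξ|²)^(-k)`: this is a convolution algebra, and the inverse function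
theorem solves the quadratic fixed point equation `w = ε w_free + N(w)`
(`exists_fixedPoint`, `isStrongSolution_solutionCurve`). The `ε²` coefficients of `u(t)` and
`∂ₜn(t)` are `N` and its time derivative evaluated at the free evolution; their Fourier transforms
are, up to a factor of modulus one, `quadU` and `quadN`. If the time `t` map is `C²` near `0`,
Taylor's formula bounds these coefficients by a multiple of the square of the norm of the data,
with one constant for all `a` and `b` (`SecondOrderBound`, `exists_bound_of_contDiffOn`).

This bound fails in each of the three regions. Take for `a`, `b` and the test function nonnegative
bumps supported in boxes of size `δ M⁻¹ × δ` around points whose coordinates are at most `M` and `1`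
in absolute value. Here `δ` is small and fixed, while `M → ∞`. On such a box `|ξ|²` and
`ω(ξ) = (1 + |2πξ|²)^(1/2)` are constant up to an error `O(δ)`, so that the kernel of the
second order term, a product of oscillating factors, can be replaced by its value at the centres
(`le_norm_integral_quadN`, `le_norm_integral_quadU`). Only its time integral at the centres remains.
It is bounded below in two situations.

* If `|2πc₁|² - |2πc₂|² = ω(c₁ - c₂)`, with `|c₁|`, `|c₂|`, `|c₁ - c₂|` all of size `M`
  (`exists_resonant`), then the phases cancel. The output of `u ū` at `c₁ - c₂` is unbounded if
  `σ - 2s - 3/2 > 0`, and the output of `n u` at `c₁` is unbounded if `σ < -1/2`.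
* If `|c₁| = |c₂| ~ M` and `c₁ - c₂` is a fixed vector, then the Schrödinger phases cancel and
  `sin (t ω(c₁ - c₂)) / ω(c₁ - c₂)` remains, which is nonzero for a suitable vector. The output of
  `u ū` is unbounded if `s < -1/4`.

The powers of `M` come from the normalization of the bumps in the Sobolev norms and from the area
of the boxes, proportional to `M⁻¹`, which enters twice through the trilinear integral
(`integral_packet_conv_mul`).
-/

noncomputable section

namespace KGS

open Filter Topology FourierTransform
open scoped ComplexConjugate BoundedContinuousFunction ContDiff

/-! ### Sobolev spaces on the Fourier side -/

/-- The symbol `(1 + |ξ|²)^(s/2)` of the Bessel potential of order `s`, as a complex number. -/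
def bracket (s : ℝ) (ξ : Plane) : ℂ := (((1 + ‖ξ‖ ^ 2) ^ (s / 2) : ℝ) : ℂ)

theorem hasTemperateGrowth_bracket (s : ℝ) : (bracket s).HasTemperateGrowth := by
  unfold bracket
  fun_prop

theorem continuous_bracket (s : ℝ) : Continuous (bracket s) :=
  (hasTemperateGrowth_bracket s).1.continuous

theorem norm_bracket_sq (s : ℝ) (ξ : Plane) : ‖bracket s ξ‖ ^ 2 = (1 + ‖ξ‖ ^ 2) ^ s := by
  have h : (0 : ℝ) < 1 + ‖ξ‖ ^ 2 := by positivity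
  rw [bracket, Complex.norm_real, Real.norm_of_nonneg (by positivity), ← Real.rpow_natCast,
    ← Real.rpow_mul h.le]
  congr 1
  push_cast
  ring

theorem norm_sq_toLp {F : Plane → ℂ} (hF : MemLp F 2) : ‖hF.toLp F‖ ^ 2 = ∫ ξ, ‖F ξ‖ ^ 2 := by
  have h := MeasureTheory.L2.inner_def (𝕜 := ℂ) (hF.toLp F) (hF.toLp F)
  rw [inner_self_eq_norm_sq_to_K] at h
  have h2 : (∫ a, inner ℂ ((hF.toLp F : Plane → ℂ) a) ((hF.toLp F : Plane → ℂ) a)) =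
      ∫ a, ((‖F a‖ ^ 2 : ℝ) : ℂ) := by
    apply integral_congr_ae
    filter_upwards [hF.coeFn_toLp] with x hx
    rw [hx, inner_self_eq_norm_sq_to_K]
    simp
  rw [h2, integral_complex_ofReal] at h
  apply Complex.ofReal_injective
  rw [← h]
  simp

/-- The pairing of an `L²` function with a Schwartz function obeys the Cauchy-Schwarz inequality. -/
theorem norm_toTemperedDistribution_apply_le (f : Lp ℂ 2 (volume : Measure Plane))
    (φ : 𝓢(Plane, ℂ)) : ‖(f : 𝓢'(Plane, ℂ)) φ‖ ≤ ‖f‖ * ‖φ.toLp 2‖ := by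
  have h : (f : 𝓢'(Plane, ℂ)) φ = inner ℂ (star f) (φ.toLp 2) := by
    rw [Lp.toTemperedDistribution_apply, MeasureTheory.L2.inner_def]
    apply integral_congr_ae
    filter_upwards [φ.coeFn_toLp 2, Lp.coeFn_star f] with x hx hx'
    rw [hx, hx']
    simp
  rw [h]
  refine (norm_inner_le_norm _ _).trans (le_of_eq ?_)
  congr 1
  rw [Lp.norm_def, Lp.norm_def, eLpNorm_congr_ae (Lp.coeFn_star f), eLpNorm_star]

namespace Sobolev

variable {s : ℝ}

/-- The element of `H^s` whose Fourier transform is the function `F`. Only functions `F ∈ L²` are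
admitted, also for negative `s`; this suffices for the smooth solutions considered here. -/
def ofFourier (s : ℝ) (F : Plane → ℂ) (hF : MemLp F 2)
    (hs : MemLp (fun ξ => bracket s ξ * F ξ) 2) : Sobolev s :=
  ⟨((𝓕⁻ (hF.toLp F) : Lp ℂ 2 (volume : Measure Plane)) : 𝓢'(Plane, ℂ)), by
    refine memSobolev_iff_exists_smulLeftCLM_fourier.mpr ⟨hs.toLp _, ?_⟩
    rw [Lp.fourier_toTemperedDistribution_eq, fourier_fourierInv_eq]
    ext φ
    simp only [smulLeftCLM_apply_apply, Lp.toTemperedDistribution_apply]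
    apply integral_congr_ae
    filter_upwards [hF.coeFn_toLp, hs.coeFn_toLp] with ξ h1 h2
    rw [h1, h2, SchwartzMap.smulLeftCLM_apply_apply (by fun_prop)]
    simp only [bracket, smul_eq_mul]
    ring⟩

variable {F G : Plane → ℂ} (hF : MemLp F 2) (hs : MemLp (fun ξ => bracket s ξ * F ξ) 2)
  (hG : MemLp G 2) (hGs : MemLp (fun ξ => bracket s ξ * G ξ) 2)

theorem dist_ofFourier : dist (ofFourier s F hF hs) =
    ((𝓕⁻ (hF.toLp F) : Lp ℂ 2 (volume : Measure Plane)) : 𝓢'(Plane, ℂ)) := rfl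

theorem fourierInv_toLp_apply {F : Plane → ℂ} (hF : MemLp F 2) (φ : 𝓢(Plane, ℂ)) :
    ((𝓕⁻ (hF.toLp F) : Lp ℂ 2 (volume : Measure Plane)) : 𝓢'(Plane, ℂ)) φ =
      ∫ ξ, F ξ * 𝓕⁻ φ ξ := by
  rw [← Lp.fourierInv_toTemperedDistribution_eq, fourierInv_apply, Lp.toTemperedDistribution_apply]
  apply integral_congr_ae
  filter_upwards [hF.coeFn_toLp] with ξ h1
  rw [h1, smul_eq_mul, mul_comm]

theorem dist_ofFourier_apply (φ : 𝓢(Plane, ℂ)) :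
    dist (ofFourier s F hF hs) φ = ∫ ξ, F ξ * 𝓕⁻ φ ξ :=
  fourierInv_toLp_apply hF φ

/-- The Bessel potential multiplies the Fourier transform by `(1 + |ξ|²)^(s/2)`. -/
theorem bessel_ofFourier : bessel (ofFourier s F hF hs) = 𝓕⁻ (hs.toLp _) := by
  apply lp_ext
  rw [← bessel_spec, besselPotential, fourierMultiplierCLM_apply, dist_ofFourier,
    Lp.fourier_toTemperedDistribution_eq, fourier_fourierInv_eq,
    ← Lp.fourierInv_toTemperedDistribution_eq]
  congr 1
  ext φ
  simp only [smulLeftCLM_apply_apply, Lp.toTemperedDistribution_apply]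
  apply integral_congr_ae
  filter_upwards [hF.coeFn_toLp, hs.coeFn_toLp] with ξ h1 h2
  rw [h1, h2, SchwartzMap.smulLeftCLM_apply_apply (by fun_prop)]
  simp only [bracket, smul_eq_mul]
  ring

theorem norm_fourierInv_toLp {F : Plane → ℂ} (hF : MemLp F 2) :
    ‖(𝓕⁻ (hF.toLp F) : Lp ℂ 2 (volume : Measure Plane))‖ = ‖hF.toLp F‖ := by
  rw [← Lp.norm_fourier_eq, fourier_fourierInv_eq]

theorem norm_ofFourier_sq : ‖ofFourier s F hF hs‖ ^ 2 = ∫ ξ, (1 + ‖ξ‖ ^ 2) ^ s * ‖F ξ‖ ^ 2 := by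
  rw [norm_eq, bessel_ofFourier, norm_fourierInv_toLp, norm_sq_toLp]
  simp_rw [norm_mul, mul_pow, norm_bracket_sq]

theorem norm_ofFourier_sub_sq : ‖ofFourier s F hF hs - ofFourier s G hG hGs‖ ^ 2 =
    ∫ ξ, (1 + ‖ξ‖ ^ 2) ^ s * ‖F ξ - G ξ‖ ^ 2 := by
  have h : ofFourier s F hF hs - ofFourier s G hG hGs =
      ofFourier s (F - G) (hF.sub hG) (by simpa [mul_sub] using! hs.sub hGs) := by
    apply dist_injective
    rw [map_sub, dist_ofFourier, dist_ofFourier, dist_ofFourier,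
      ← Lp.fourierInv_toTemperedDistribution_eq, ← Lp.fourierInv_toTemperedDistribution_eq,
      ← Lp.fourierInv_toTemperedDistribution_eq, MemLp.toLp_sub hF hG]
    simp only [← Lp.toTemperedDistributionCLM_apply, map_sub, ← fourierInvCLM_apply (R := ℂ)]
  rw [h, norm_ofFourier_sq]
  rfl

/-- Duality between `H^s` and `H^(-s)`. The test function is given by its inverse Fourier
transform `ψ`. -/
theorem norm_dist_apply_le (f : Sobolev s) (ψ : 𝓢(Plane, ℂ)) :
    ‖dist f (𝓕 ψ)‖ ≤ ‖f‖ * √(∫ ξ, (1 + ‖ξ‖ ^ 2) ^ (-s) * ‖ψ ξ‖ ^ 2) := by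
  set χ : 𝓢(Plane, ℂ) := SchwartzMap.smulLeftCLM ℂ (bracket (-s)) ψ with hχ
  have h1 : dist f = besselPotential Plane ℂ (-s) (bessel f : 𝓢'(Plane, ℂ)) :=
    ((besselPotential_neg_apply_eq_iff s _ _).mpr (bessel_spec f)).symm
  have h2 : dist f (𝓕 ψ) = (bessel f : 𝓢'(Plane, ℂ)) (𝓕 χ) := by
    rw [h1, besselPotential, fourierMultiplierCLM_apply_apply, fourierInv_fourier_eq]
    rfl
  rw [h2]
  refine (norm_toTemperedDistribution_apply_le _ _).trans (le_of_eq ?_)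
  rw [← norm_eq, ← SchwartzMap.toLp_fourier_eq, Lp.norm_fourier_eq]
  congr 1
  rw [← Real.sqrt_sq (norm_nonneg (χ.toLp 2 volume))]
  congr 1
  rw [show χ.toLp 2 volume = (χ.memLp 2 volume).toLp χ from rfl, norm_sq_toLp]
  congr 1 with ξ
  rw [hχ, SchwartzMap.smulLeftCLM_apply_apply (hasTemperateGrowth_bracket _), norm_smul, mul_pow,
    norm_bracket_sq]

end Sobolev

/-! ### Decaying Fourier transforms -/

/-- Continuous functions that are `O((1 + |ξ|²)^(-k))`. -/
structure Decays (k : ℕ) (F : Plane → ℂ) : Prop where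
  continuous : Continuous F
  bound : ∃ C, ∀ ξ, ‖F ξ‖ ≤ C / (1 + ‖ξ‖ ^ 2) ^ k

theorem integrable_one_add_norm_sq_rpow {r : ℝ} (hr : r < -1) :
    Integrable (fun ξ : Plane => (1 + ‖ξ‖ ^ 2) ^ r) := by
  have h := integrable_rpow_neg_one_add_norm_sq (E := Plane) (μ := volume) (r := -2 * r)
    (by simp; linarith)
  refine h.congr (Filter.Eventually.of_forall fun ξ => ?_)
  simp

theorem integrable_inv_one_add_norm_sq_pow {k : ℕ} (hk : 2 ≤ k) :
    Integrable (fun ξ : Plane => ((1 + ‖ξ‖ ^ 2) ^ k)⁻¹) := by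
  have hk' : (2 : ℝ) ≤ k := by exact_mod_cast hk
  refine (integrable_one_add_norm_sq_rpow (r := -(k : ℝ)) (by linarith)).congr
    (Filter.Eventually.of_forall fun ξ => ?_)
  simp only
  rw [Real.rpow_neg (by positivity), Real.rpow_natCast]

namespace Decays

variable {k : ℕ} {F G : Plane → ℂ} {s : ℝ}

theorem integrable (hF : Decays k F) (hk : 2 ≤ k) : Integrable F := by
  obtain ⟨C, hC⟩ := hF.bound
  refine ((integrable_inv_one_add_norm_sq_pow hk).const_mul C).mono'
    hF.continuous.aestronglyMeasurable (Filter.Eventually.of_forall fun ξ => ?_)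
  rw [← div_eq_mul_inv]
  exact hC ξ

theorem rpow_mul_sq_le {C : ℝ} {ξ : Plane} (h : ‖F ξ‖ ≤ C / (1 + ‖ξ‖ ^ 2) ^ k) :
    (1 + ‖ξ‖ ^ 2) ^ s * ‖F ξ‖ ^ 2 ≤ C ^ 2 * (1 + ‖ξ‖ ^ 2) ^ (s - 2 * k) := by
  have h0 : (0 : ℝ) < 1 + ‖ξ‖ ^ 2 := by positivity
  calc (1 + ‖ξ‖ ^ 2) ^ s * ‖F ξ‖ ^ 2
      ≤ (1 + ‖ξ‖ ^ 2) ^ s * (C / (1 + ‖ξ‖ ^ 2) ^ k) ^ 2 := by gcongr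
    _ = C ^ 2 * (1 + ‖ξ‖ ^ 2) ^ (s - 2 * k) := by
      rw [Real.rpow_sub h0, mul_comm (2 : ℝ), Real.rpow_mul h0.le, Real.rpow_natCast,
        Real.rpow_two]
      field_simp

theorem memLp_bracket (hF : Decays k F) (hk : s + 1 < 2 * k) :
    MemLp (fun ξ => bracket s ξ * F ξ) 2 := by
  have hc : Continuous (fun ξ => bracket s ξ * F ξ) := (continuous_bracket s).mul hF.continuous
  obtain ⟨C, hC⟩ := hF.bound
  rw [memLp_two_iff_integrable_sq_norm hc.aestronglyMeasurable]
  refine ((integrable_one_add_norm_sq_rpow (r := s - 2 * k) (by linarith)).const_mul (C ^ 2)).mono'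
    (hc.norm.pow 2).aestronglyMeasurable (Filter.Eventually.of_forall fun ξ => ?_)
  rw [norm_mul, mul_pow, norm_bracket_sq, Real.norm_of_nonneg (by positivity)]
  exact rpow_mul_sq_le (hC ξ)

theorem memLp_two (hF : Decays k F) (hk : 1 ≤ k) : MemLp F 2 := by
  have hk' : (1 : ℝ) ≤ k := by exact_mod_cast hk
  have h := hF.memLp_bracket (s := 0) (by linarith)
  simpa [bracket] using h

theorem of_schwartz (k : ℕ) (f : 𝓢(Plane, ℂ)) : Decays k f := by
  refine ⟨f.continuous, 2 ^ (2 * k) *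
    ((Finset.Iic (2 * k, 0)).sup fun m => SchwartzMap.seminorm ℂ m.1 m.2) f, fun ξ => ?_⟩
  have h := SchwartzMap.one_add_le_sup_seminorm_apply (𝕜 := ℂ) (m := (2 * k, 0)) le_rfl le_rfl f ξ
  rw [norm_iteratedFDeriv_zero] at h
  rw [le_div_iff₀ (by positivity)]
  refine le_trans ?_ h
  rw [mul_comm, pow_mul]
  gcongr
  nlinarith [norm_nonneg ξ]

/-- The element of `H^s` with a decaying Fourier transform. -/
def toSobolev (hF : Decays k F) (hk : 1 ≤ k) (hs : s + 1 < 2 * k) : Sobolev s :=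
  Sobolev.ofFourier s F (hF.memLp_two hk) (hF.memLp_bracket hs)

/-- The square-integrable function with a decaying Fourier transform. -/
def toLp (hF : Decays k F) (hk : 1 ≤ k) : Lp ℂ 2 (volume : Measure Plane) :=
  𝓕⁻ ((hF.memLp_two hk).toLp F)

end Decays

/-- A function whose Fourier transform is Hermitian is real-valued. -/
theorem toSobolev_mem_realSobolev {k : ℕ} {F : Plane → ℂ} {s : ℝ} (hF : Decays k F) (hk : 1 ≤ k)
    (hs : s + 1 < 2 * k) (hreal : ∀ ξ, F (-ξ) = conj (F ξ)) :
    hF.toSobolev hk hs ∈ realSobolev s := by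
  intro φ hφ
  rw [Decays.toSobolev, Sobolev.dist_ofFourier_apply, ← Complex.conj_eq_iff_im, ← integral_conj,
    ← integral_neg_eq_self]
  congr 1 with ξ
  rw [map_mul, hreal, Complex.conj_conj]
  congr 1
  rw [SchwartzMap.fourierInv_coe, Real.fourierInv_eq', Real.fourierInv_eq', ← integral_conj]
  congr 1 with v
  rw [smul_eq_mul, smul_eq_mul, map_mul, Complex.conj_eq_iff_im.mpr (hφ v), ← Complex.exp_conj]
  simp [map_ofNat]

/-! ### The inverse Fourier integral and products -/

/-- Multiplication formula for the inverse Fourier transform. -/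
theorem integral_fourierInv_mul {F G : Plane → ℂ} (hF : Integrable F) (hG : Integrable G) :
    ∫ x, 𝓕⁻ F x * G x = ∫ ξ, F ξ * 𝓕⁻ G ξ := by
  have h := VectorFourier.integral_fourierIntegral_smul_eq_flip (e := Real.fourierChar)
    (μ := volume) (ν := volume) (L := -innerₗ Plane) Real.continuous_fourierChar
    (by simpa using! continuous_inner.neg) hF hG
  have hL : (-innerₗ Plane).flip = -innerₗ Plane := by
    ext x y
    simp [real_inner_comm]
  rw [hL] at h
  exact h

theorem continuous_fourierInv {F : Plane → ℂ} (hF : Integrable F) : Continuous (𝓕⁻ F) :=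
  VectorFourier.fourierIntegral_continuous (L := -innerₗ Plane) Real.continuous_fourierChar
    (by simpa using! continuous_inner.neg) hF

/-- On `L¹ ∩ L²` the inverse Fourier transform of `L²` is given by the Fourier integral. -/
theorem fourierInv_toLp_ae {F : Plane → ℂ} (h1 : Integrable F) (h2 : MemLp F 2) :
    (𝓕⁻ (h2.toLp F) : Lp ℂ 2 (volume : Measure Plane)) =ᵐ[volume] 𝓕⁻ F := by
  refine ae_eq_of_integral_contDiff_smul_eq ((Lp.memLp _).locallyIntegrable (by norm_num))
    (continuous_fourierInv h1).locallyIntegrable fun g hg hg' => ?_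
  have hg1 : HasCompactSupport (Complex.ofRealCLM ∘ g) := hg'.comp_left rfl
  have hg2 : ContDiff ℝ ∞ (Complex.ofRealCLM ∘ g) := by fun_prop
  set φ : 𝓢(Plane, ℂ) := hg1.toSchwartzMap hg2 with hφ
  have h := Sobolev.fourierInv_toLp_apply h2 φ
  rw [Lp.toTemperedDistribution_apply, SchwartzMap.fourierInv_coe,
    ← integral_fourierInv_mul h1 φ.integrable] at h
  have h3 : ∀ x, φ x = (g x : ℂ) := fun x => rfl
  simp_rw [h3, smul_eq_mul] at h
  simp_rw [Complex.real_smul]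
  rw [h]
  simp_rw [mul_comm]

/-- The convolution `F * G`. -/
def conv (F G : Plane → ℂ) (ξ : Plane) : ℂ := ∫ η, F η * G (ξ - η)

theorem integrable_conv {F G : Plane → ℂ} (hF : Integrable F) (hG : Integrable G) :
    Integrable (conv F G) :=
  hF.integrable_convolution (ContinuousLinearMap.mul ℂ ℂ) hG

theorem fourierInv_conv {F G : Plane → ℂ} (hF : Integrable F) (hG : Integrable G) (x : Plane) :
    𝓕⁻ (conv F G) x = 𝓕⁻ F x * 𝓕⁻ G x := by
  simp_rw [Real.fourierInv_eq_fourier_neg]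
  exact Real.fourier_mul_convolution_eq hF hG (-x)

/-- The Fourier transform of a product is the convolution of the Fourier transforms. -/
theorem prodDist_toLp_apply {k l : ℕ} {F G : Plane → ℂ} (hF : Decays k F) (hG : Decays l G)
    (hk : 2 ≤ k) (hl : 2 ≤ l) (φ : 𝓢(Plane, ℂ)) :
    prodDist (hF.toLp (by omega)) (hG.toLp (by omega)) φ = ∫ ξ, conv F G ξ * 𝓕⁻ φ ξ := by
  have hF1 := hF.integrable hk
  have hG1 := hG.integrable hl
  rw [prodDist, Lp.toTemperedDistribution_apply, SchwartzMap.fourierInv_coe,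
    ← integral_fourierInv_mul (integrable_conv hF1 hG1) φ.integrable]
  apply integral_congr_ae
  filter_upwards [Lp.coeFn_lpSMul (r := 1) (hF.toLp (k := k) (by omega))
    (hG.toLp (k := l) (by omega)), fourierInv_toLp_ae hF1 (hF.memLp_two (by omega)),
    fourierInv_toLp_ae hG1 (hG.memLp_two (by omega))] with x h1 h2 h3
  rw [h1, fourierInv_conv hF1 hG1, ← h2, ← h3, Pi.smul_apply', smul_eq_mul, smul_eq_mul, mul_comm]
  rfl

/-- The Fourier transform of the complex conjugate function. -/
def reflConj (F : Plane → ℂ) (ξ : Plane) : ℂ := conj (F (-ξ))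

theorem Decays.reflConj {k : ℕ} {F : Plane → ℂ} (hF : Decays k F) : Decays k (reflConj F) := by
  obtain ⟨C, hC⟩ := hF.bound
  refine ⟨Complex.continuous_conj.comp (hF.continuous.comp continuous_neg), C, fun ξ => ?_⟩
  simpa [KGS.reflConj] using hC (-ξ)

theorem star_toLp {k : ℕ} {F : Plane → ℂ} (hF : Decays k F) (hk : 2 ≤ k) :
    star (hF.toLp (by omega)) = hF.reflConj.toLp (by omega) := by
  apply Lp.ext
  filter_upwards [Lp.coeFn_star (hF.toLp (k := k) (by omega)),
    fourierInv_toLp_ae (hF.integrable hk) (hF.memLp_two (by omega)),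
    fourierInv_toLp_ae (hF.reflConj.integrable hk) (hF.reflConj.memLp_two (by omega))]
    with x h1 h2 h3
  rw [h1, Pi.star_apply]
  refine (congrArg star h2).trans (Eq.trans ?_ h3.symm)
  rw [Real.fourierInv_eq', Real.fourierInv_eq', ← integral_neg_eq_self]
  change conj _ = _
  rw [← integral_conj]
  congr 1 with v
  rw [smul_eq_mul, smul_eq_mul, map_mul, ← Complex.exp_conj, KGS.reflConj]
  simp [map_ofNat]

/-! ### The symbols of the free evolutions -/

theorem hasTemperateGrowth_exp_mul_I :
    (fun x : ℝ => Complex.exp (x * Complex.I)).HasTemperateGrowth := by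
  have hd : ∀ n : ℕ, iteratedDeriv n (fun x : ℝ => Complex.exp (x * Complex.I)) =
      fun x : ℝ => Complex.I ^ n * Complex.exp (x * Complex.I) := by
    intro n
    induction n with
    | zero => simp
    | succ n ih =>
      rw [iteratedDeriv_succ, ih]
      funext x
      have h : HasDerivAt (fun x : ℝ => (x : ℂ) * Complex.I) (1 * Complex.I) x :=
        (Complex.ofRealCLM.hasDerivAt (x := x)).mul_const _
      rw [((h.cexp).const_mul _).deriv]
      ring
  refine ⟨(Complex.ofRealCLM.contDiff.mul contDiff_const).cexp, fun n => ⟨0, 1, fun x => ?_⟩⟩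
  rw [norm_iteratedFDeriv_eq_norm_iteratedDeriv, hd]
  simp [Complex.norm_exp_ofReal_mul_I]

theorem hasTemperateGrowth_ofReal_cos :
    (fun x : ℝ => ((Real.cos x : ℝ) : ℂ)).HasTemperateGrowth := by
  have h := hasTemperateGrowth_exp_mul_I
  have h' : (fun x : ℝ => Complex.exp (((-x : ℝ) : ℂ) * Complex.I)).HasTemperateGrowth :=
    h.comp (g := fun x : ℝ => Complex.exp (x * Complex.I)) (f := fun x : ℝ => -x) (by fun_prop)
  have e : (fun x : ℝ => ((Real.cos x : ℝ) : ℂ)) = fun x : ℝ => (2⁻¹ : ℂ) *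
      (Complex.exp (x * Complex.I) + Complex.exp (((-x : ℝ) : ℂ) * Complex.I)) := by
    funext x
    rw [Complex.ofReal_cos, Complex.cos]
    push_cast
    ring
  rw [e]
  exact (Function.HasTemperateGrowth.const _).mul (h.add h')

theorem hasTemperateGrowth_ofReal_sin :
    (fun x : ℝ => ((Real.sin x : ℝ) : ℂ)).HasTemperateGrowth := by
  have e : (fun x : ℝ => ((Real.sin x : ℝ) : ℂ)) =
      (fun x : ℝ => ((Real.cos x : ℝ) : ℂ)) ∘ fun x : ℝ => Real.pi / 2 - x := by
    funext x
    simp only [Function.comp_apply, Real.cos_pi_div_two_sub]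
  rw [e]
  exact hasTemperateGrowth_ofReal_cos.comp (by fun_prop)

theorem hasTemperateGrowth_omega_rpow (r : ℝ) :
    (fun ξ : Plane => (1 + (2 * Real.pi * ‖ξ‖) ^ 2) ^ r).HasTemperateGrowth := by
  have h := (Function.hasTemperateGrowth_one_add_norm_sq_rpow Plane r).comp
    (f := ⇑((2 * Real.pi) • ContinuousLinearMap.id ℝ Plane))
    (ContinuousLinearMap.hasTemperateGrowth _)
  have e : (fun ξ : Plane => (1 + (2 * Real.pi * ‖ξ‖) ^ 2) ^ r) = (fun x : Plane =>
      (1 + ‖x‖ ^ 2) ^ r) ∘ ⇑((2 * Real.pi) • ContinuousLinearMap.id ℝ Plane) := by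
    funext ξ
    simp [norm_smul, abs_of_pos Real.pi_pos]
  rw [e]
  exact h

theorem hasTemperateGrowth_omega : omega.HasTemperateGrowth := by
  have h := hasTemperateGrowth_omega_rpow (1 / 2)
  simp_rw [← Real.sqrt_eq_rpow] at h
  exact h

theorem omega_pos (ξ : Plane) : 0 < omega ξ := Real.sqrt_pos.mpr (by positivity)

theorem one_le_omega (ξ : Plane) : 1 ≤ omega ξ :=
  Real.one_le_sqrt.mpr (le_add_of_nonneg_right (by positivity))

theorem hasTemperateGrowth_omega_inv : (fun ξ => (omega ξ)⁻¹).HasTemperateGrowth := by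
  have h := hasTemperateGrowth_omega_rpow (-(1 / 2))
  convert h using 2 with ξ
  rw [Real.rpow_neg (by positivity), ← Real.sqrt_eq_rpow]
  rfl

theorem continuous_omega : Continuous omega := hasTemperateGrowth_omega.1.continuous

@[simp] theorem omega_neg (ξ : Plane) : omega (-ξ) = omega ξ := by simp [omega]

/-- The symbol of `-Δ`. -/
def symb (ξ : Plane) : ℝ := (2 * Real.pi * ‖ξ‖) ^ 2

theorem continuous_symb : Continuous symb := by
  unfold symb
  fun_prop

theorem hasTemperateGrowth_schrodinger (r : ℝ) :
    (fun ξ : Plane => Complex.exp ((-(r * symb ξ) : ℝ) * Complex.I)).HasTemperateGrowth := by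
  refine hasTemperateGrowth_exp_mul_I.comp (f := fun ξ => -(r * symb ξ)) ?_
  have h : symb = fun ξ => (2 * Real.pi) ^ 2 * ‖ξ‖ ^ 2 := by
    funext ξ
    simp [symb, mul_pow]
  rw [h]
  fun_prop

theorem hasTemperateGrowth_cos_omega (r : ℝ) :
    (fun ξ : Plane => ((Real.cos (r * omega ξ) : ℝ) : ℂ)).HasTemperateGrowth := by
  have h := hasTemperateGrowth_omega
  exact hasTemperateGrowth_ofReal_cos.comp (f := fun ξ => r * omega ξ)
    ((Function.HasTemperateGrowth.const r).mul h)

theorem hasTemperateGrowth_sin_omega (r : ℝ) :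
    (fun ξ : Plane => ((Real.sin (r * omega ξ) : ℝ) : ℂ)).HasTemperateGrowth := by
  have h := hasTemperateGrowth_omega
  exact hasTemperateGrowth_ofReal_sin.comp (f := fun ξ => r * omega ξ)
    ((Function.HasTemperateGrowth.const r).mul h)

/-- A distribution `D` is represented by the function `F` if `𝓕 D = F`. -/
def IsRep (D : 𝓢'(Plane, ℂ)) (F : Plane → ℂ) : Prop :=
  ∀ φ : 𝓢(Plane, ℂ), D φ = ∫ ξ, F ξ * 𝓕⁻ φ ξ

namespace IsRep

variable {D : 𝓢'(Plane, ℂ)} {F : Plane → ℂ}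

theorem multiplier (hD : IsRep D F) {g : Plane → ℂ} (hg : g.HasTemperateGrowth) :
    IsRep (fourierMultiplierCLM ℂ g D) (fun ξ => g ξ * F ξ) := by
  intro φ
  rw [fourierMultiplierCLM_apply_apply, hD, fourierInv_fourier_eq]
  congr 1 with ξ
  rw [SchwartzMap.smulLeftCLM_apply_apply hg, smul_eq_mul]
  ring

theorem schrodinger (hD : IsRep D F) (r : ℝ) :
    IsRep (schrodinger r D) (fun ξ => Complex.exp ((-(r * symb ξ) : ℝ) * Complex.I) * F ξ) :=
  hD.multiplier (hasTemperateGrowth_schrodinger r)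

theorem cosA (hD : IsRep D F) (r : ℝ) :
    IsRep (cosA r D) (fun ξ => ((Real.cos (r * omega ξ) : ℝ) : ℂ) * F ξ) :=
  hD.multiplier (hasTemperateGrowth_cos_omega r)

theorem sinA (hD : IsRep D F) (r : ℝ) :
    IsRep (sinA r D) (fun ξ => (((omega ξ)⁻¹ * Real.sin (r * omega ξ) : ℝ) : ℂ) * F ξ) := by
  refine hD.multiplier ?_
  have h := (Complex.ofRealCLM.hasTemperateGrowth.comp hasTemperateGrowth_omega_inv).mul
    (hasTemperateGrowth_sin_omega r)
  refine (congrArg _ (funext fun ξ => ?_)).mp h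
  simp

theorem dcosA (hD : IsRep D F) (r : ℝ) :
    IsRep (dcosA r D) (fun ξ => ((-(omega ξ * Real.sin (r * omega ξ)) : ℝ) : ℂ) * F ξ) := by
  refine hD.multiplier ?_
  have h := ((Complex.ofRealCLM.hasTemperateGrowth.comp hasTemperateGrowth_omega).mul
    (hasTemperateGrowth_sin_omega r)).neg
  refine (congrArg _ (funext fun ξ => ?_)).mp h
  simp

end IsRep

/-! ### Quadratic fixed point equations -/

/-- A homogeneous quadratic map has zero derivative at the origin. -/
theorem hasFDerivAt_zero_of_quadratic {E : Type*} [NormedAddCommGroup E] [NormedSpace ℝ E]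
    {N : E → E} (hN : ContDiff ℝ 1 N) (hq : ∀ (c : ℝ) (w : E), N (c • w) = c ^ 2 • N w) :
    HasFDerivAt N (0 : E →L[ℝ] E) 0 := by
  have h := (hN.differentiable one_ne_zero 0).hasFDerivAt
  suffices h0 : fderiv ℝ N 0 = 0 by rwa [h0] at h
  ext v
  have h1 : HasDerivAt (fun c : ℝ => c • v) ((1 : ℝ) • v) 0 := (hasDerivAt_id 0).smul_const v
  have h2 : HasDerivAt (fun c : ℝ => N (c • v)) (fderiv ℝ N 0 ((1 : ℝ) • v)) 0 :=
    HasFDerivAt.comp_hasDerivAt_of_eq (0 : ℝ) h h1 (by simp)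
  have h3 : HasDerivAt (fun c : ℝ => c ^ 2 • N v) (((2 : ℕ) * (0 : ℝ) ^ (2 - 1) * 1) • N v) 0 :=
    ((hasDerivAt_id (0 : ℝ)).pow 2).smul_const (N v)
  simp_rw [hq] at h2
  simpa using h2.unique h3

/-- A fixed point equation `w = ε y + N(w)` with a smooth homogeneous quadratic nonlinearity `N` is
solvable for small `ε`, by a `w = ε y + o(ε)`. -/
theorem exists_fixedPoint {E : Type*} [NormedAddCommGroup E] [NormedSpace ℝ E] [CompleteSpace E]
    {N : E → E} (hN : ContDiff ℝ 1 N) (hq : ∀ (c : ℝ) (w : E), N (c • w) = c ^ 2 • N w) (y : E) :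
    ∃ w : ℝ → E, (∀ᶠ ε in 𝓝 0, w ε = ε • y + N (w ε)) ∧
      Tendsto (fun ε => ε⁻¹ • w ε) (𝓝[≠] 0) (𝓝 y) := by
  have h0 : N 0 = 0 := by simpa using hq 0 0
  have hs : HasStrictFDerivAt (fun w => w - N w)
      ((ContinuousLinearEquiv.refl ℝ E : E ≃L[ℝ] E) : E →L[ℝ] E) 0 := by
    have h := (hasStrictFDerivAt_id (𝕜 := ℝ) (0 : E)).sub
      (hN.contDiffAt.hasStrictFDerivAt' (hasFDerivAt_zero_of_quadratic hN hq) one_ne_zero)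
    rw [sub_zero] at h
    exact h
  set g := HasStrictFDerivAt.localInverse (fun w => w - N w) _ 0 hs with hg
  have hr := hs.eventually_right_inverse
  have hd := hs.to_localInverse.hasFDerivAt
  have hg0 : g 0 = 0 := by
    have := hs.localInverse_apply_image
    simpa [h0] using this
  simp only [h0, sub_zero] at hr hd
  have hline : Tendsto (fun ε : ℝ => ε • y) (𝓝 0) (𝓝 0) := by
    have : Continuous fun ε : ℝ => ε • y := by fun_prop
    simpa using this.tendsto 0
  refine ⟨fun ε => g (ε • y), ?_, ?_⟩
  · filter_upwards [hline.eventually hr] with ε hε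
    rw [← hg] at hε
    rw [← sub_eq_iff_eq_add]
    exact hε
  · have h1 : HasDerivAt (fun c : ℝ => c • y) ((1 : ℝ) • y) 0 := (hasDerivAt_id 0).smul_const y
    have h2 : HasDerivAt (fun c : ℝ => g (c • y)) ((1 : ℝ) • y) 0 :=
      HasFDerivAt.comp_hasDerivAt_of_eq (0 : ℝ) hd h1 (by simp)
    have h3 := h2.tendsto_slope_zero
    simpa [hg0] using h3

/-! ### Space-time Fourier transforms and their convolution -/

/-- The weight `(1 + |ξ|²)^k`. -/
def wt (k : ℕ) (ξ : Plane) : ℝ := (1 + ‖ξ‖ ^ 2) ^ k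

theorem wt_pos (k : ℕ) (ξ : Plane) : 0 < wt k ξ := by
  unfold wt
  positivity

theorem one_le_wt (k : ℕ) (ξ : Plane) : 1 ≤ wt k ξ :=
  one_le_pow₀ (le_add_of_nonneg_right (by positivity))

theorem wt_ofReal_ne_zero (k : ℕ) (ξ : Plane) : (wt k ξ : ℂ) ≠ 0 :=
  Complex.ofReal_ne_zero.mpr (wt_pos k ξ).ne'

@[simp] theorem wt_neg (k : ℕ) (ξ : Plane) : wt k (-ξ) = wt k ξ := by simp [wt]

theorem continuous_wt (k : ℕ) : Continuous (wt k) := by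
  unfold wt
  fun_prop

theorem continuous_wt_inv (k : ℕ) : Continuous fun ξ => (wt k ξ)⁻¹ :=
  (continuous_wt k).inv₀ fun ξ => (wt_pos k ξ).ne'

theorem integrable_wt_inv {k : ℕ} (hk : 2 ≤ k) : Integrable fun ξ => (wt k ξ)⁻¹ :=
  integrable_inv_one_add_norm_sq_pow hk

/-- Peetre's inequality in additive form. -/
theorem wt_le (k : ℕ) (ξ η : Plane) : wt k ξ ≤ 4 ^ k * (wt k η + wt k (ξ - η)) := by
  have h1 : ‖ξ‖ ≤ ‖η‖ + ‖ξ - η‖ := by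
    simpa using norm_add_le η (ξ - η)
  have h2 : 1 + ‖ξ‖ ^ 2 ≤ 2 * ((1 + ‖η‖ ^ 2) + (1 + ‖ξ - η‖ ^ 2)) := by
    have : ‖ξ‖ ^ 2 ≤ (‖η‖ + ‖ξ - η‖) ^ 2 := by gcongr
    nlinarith [sq_nonneg (‖η‖ - ‖ξ - η‖)]
  calc wt k ξ ≤ (2 * ((1 + ‖η‖ ^ 2) + (1 + ‖ξ - η‖ ^ 2))) ^ k := by
        unfold wt
        gcongr
    _ ≤ 2 ^ k * (2 ^ (k - 1) * (wt k η + wt k (ξ - η))) := by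
        rw [mul_pow]
        gcongr
        exact add_pow_le (by positivity) (by positivity) k
    _ ≤ 2 ^ k * (2 ^ k * (wt k η + wt k (ξ - η))) := by
        have := wt_pos k η
        have := wt_pos k (ξ - η)
        gcongr
        · norm_num
        · omega
    _ = _ := by
        rw [← mul_assoc, ← mul_pow]
        norm_num

/-- The constant of the convolution inequality `w⁻¹ * w⁻¹ ≤ C w⁻¹`. -/
def convConst (k : ℕ) : ℝ := 4 ^ k * (2 * ∫ η : Plane, (wt k η)⁻¹)

theorem convConst_nonneg (k : ℕ) : 0 ≤ convConst k := by
  have : 0 ≤ ∫ η : Plane, (wt k η)⁻¹ := integral_nonneg fun η => (inv_pos.mpr (wt_pos k η)).le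
  unfold convConst
  positivity

theorem integrable_wt_inv_mul {k : ℕ} (hk : 2 ≤ k) (ξ : Plane) :
    Integrable fun η => (wt k η)⁻¹ * (wt k (ξ - η))⁻¹ := by
  refine (integrable_wt_inv hk).mono' ?_ (Eventually.of_forall fun η => ?_)
  · exact ((continuous_wt_inv k).mul
      ((continuous_wt_inv k).comp (continuous_const.sub continuous_id))).aestronglyMeasurable
  · have h1 := wt_pos k η
    have h2 := wt_pos k (ξ - η)
    rw [Real.norm_of_nonneg (by positivity)]
    exact mul_le_of_le_one_right (by positivity) (inv_le_one_of_one_le₀ (one_le_wt _ _))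

theorem wt_mul_integral_le {k : ℕ} (hk : 2 ≤ k) (ξ : Plane) :
    wt k ξ * ∫ η, (wt k η)⁻¹ * (wt k (ξ - η))⁻¹ ≤ convConst k := by
  have hi := integrable_wt_inv hk
  have hi' : Integrable fun η => (wt k (ξ - η))⁻¹ := hi.comp_sub_left ξ
  rw [← integral_const_mul]
  calc ∫ η, wt k ξ * ((wt k η)⁻¹ * (wt k (ξ - η))⁻¹)
      ≤ ∫ η, 4 ^ k * ((wt k η)⁻¹ + (wt k (ξ - η))⁻¹) := by
        refine integral_mono ((integrable_wt_inv_mul hk ξ).const_mul _)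
          ((hi.add hi').const_mul _) fun η => ?_
        have h1 := wt_pos k η
        have h2 := wt_pos k (ξ - η)
        calc wt k ξ * ((wt k η)⁻¹ * (wt k (ξ - η))⁻¹)
            ≤ (4 ^ k * (wt k η + wt k (ξ - η))) * ((wt k η)⁻¹ * (wt k (ξ - η))⁻¹) := by
              gcongr
              exact wt_le k ξ η
          _ = _ := by field_simp; ring
    _ = convConst k := by
        rw [integral_const_mul, integral_add hi hi',
          integral_sub_left_eq_self (fun η => (wt k η)⁻¹), convConst]
        ring

/-- Bounded continuous functions of `(t, ξ)`. Such a `U` stands for the curve of functions whose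
Fourier transform at time `t` is `U(t, ξ) (1 + |ξ|²)^(-k)`. -/
abbrev SpaceTime : Type := (ℝ × Plane) →ᵇ ℂ

/-- The Fourier transform at time `t` of the curve represented by `U`. -/
def hat (k : ℕ) (U : SpaceTime) (t : ℝ) (ξ : Plane) : ℂ := U (t, ξ) / wt k ξ

theorem norm_hat_le (k : ℕ) (U : SpaceTime) (t : ℝ) (ξ : Plane) :
    ‖hat k U t ξ‖ ≤ ‖U‖ * (wt k ξ)⁻¹ := by
  rw [hat, norm_div, Complex.norm_real, Real.norm_of_nonneg (wt_pos k ξ).le, div_eq_mul_inv]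
  gcongr
  · exact inv_nonneg.mpr (wt_pos k ξ).le
  · exact U.norm_coe_le_norm _

theorem continuous_hat (k : ℕ) (U : SpaceTime) : Continuous fun p : ℝ × Plane => hat k U p.1 p.2 :=
  U.continuous.div (Complex.continuous_ofReal.comp ((continuous_wt k).comp continuous_snd))
    fun p => wt_ofReal_ne_zero k p.2

theorem continuous_hat_apply (k : ℕ) (U : SpaceTime) (t : ℝ) : Continuous (hat k U t) :=
  (continuous_hat k U).comp (by fun_prop : Continuous fun ξ : Plane => (t, ξ))

theorem decays_hat (k : ℕ) (U : SpaceTime) (t : ℝ) : Decays k (hat k U t) :=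
  ⟨continuous_hat_apply k U t, ‖U‖, fun ξ => by
    simpa [div_eq_mul_inv, wt] using norm_hat_le k U t ξ⟩

theorem norm_hat_mul_hat_le (k : ℕ) (U V : SpaceTime) (t : ℝ) (ξ η : Plane) :
    ‖hat k U t η * hat k V t (ξ - η)‖ ≤ ‖U‖ * ‖V‖ * ((wt k η)⁻¹ * (wt k (ξ - η))⁻¹) := by
  rw [norm_mul]
  calc _ ≤ (‖U‖ * (wt k η)⁻¹) * (‖V‖ * (wt k (ξ - η))⁻¹) :=
        mul_le_mul (norm_hat_le k U t η) (norm_hat_le k V t _) (norm_nonneg _)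
          (mul_nonneg (norm_nonneg _) (inv_nonneg.mpr (wt_pos k η).le))
    _ = _ := by ring

theorem integrable_hat_mul_hat {k : ℕ} (hk : 2 ≤ k) (U V : SpaceTime) (t : ℝ) (ξ : Plane) :
    Integrable fun η => hat k U t η * hat k V t (ξ - η) :=
  ((integrable_wt_inv_mul hk ξ).const_mul (‖U‖ * ‖V‖)).mono'
    ((continuous_hat_apply k U t).mul ((continuous_hat_apply k V t).comp
      (continuous_const.sub continuous_id))).aestronglyMeasurable
    (Eventually.of_forall fun η => norm_hat_mul_hat_le k U V t ξ η)

theorem continuous_conv_hat {k : ℕ} (hk : 2 ≤ k) (U V : SpaceTime) :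
    Continuous fun p : ℝ × Plane => conv (hat k U p.1) (hat k V p.1) p.2 := by
  refine continuous_of_dominated (bound := fun η => ‖U‖ * ‖V‖ * (wt k η)⁻¹)
    (fun p => (integrable_hat_mul_hat hk U V p.1 p.2).aestronglyMeasurable)
    (fun p => Eventually.of_forall fun η => ?_) ((integrable_wt_inv hk).const_mul _)
    (Eventually.of_forall fun η => ?_)
  · refine (norm_hat_mul_hat_le k U V p.1 p.2 η).trans ?_
    have h1 := wt_pos k η
    gcongr
    exact mul_le_of_le_one_right (by positivity) (inv_le_one_of_one_le₀ (one_le_wt _ _))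
  · exact ((continuous_hat k U).comp (by fun_prop : Continuous fun p : ℝ × Plane => (p.1, η))).mul
      ((continuous_hat k V).comp (by fun_prop : Continuous fun p : ℝ × Plane => (p.1, p.2 - η)))

theorem norm_wt_mul_conv_le {k : ℕ} (hk : 2 ≤ k) (U V : SpaceTime) (t : ℝ) (ξ : Plane) :
    ‖(wt k ξ : ℂ) * conv (hat k U t) (hat k V t) ξ‖ ≤ convConst k * ‖U‖ * ‖V‖ := by
  rw [norm_mul, Complex.norm_real, Real.norm_of_nonneg (wt_pos k ξ).le]
  have h : ‖conv (hat k U t) (hat k V t) ξ‖ ≤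
      ‖U‖ * ‖V‖ * ∫ η, (wt k η)⁻¹ * (wt k (ξ - η))⁻¹ := by
    rw [← integral_const_mul]
    exact norm_integral_le_of_norm_le ((integrable_wt_inv_mul hk ξ).const_mul _)
      (Eventually.of_forall fun η => norm_hat_mul_hat_le k U V t ξ η)
  calc _ ≤ wt k ξ * (‖U‖ * ‖V‖ * ∫ η, (wt k η)⁻¹ * (wt k (ξ - η))⁻¹) := by
        gcongr
        exact (wt_pos k ξ).le
    _ = (wt k ξ * ∫ η, (wt k η)⁻¹ * (wt k (ξ - η))⁻¹) * (‖U‖ * ‖V‖) := by ring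
    _ ≤ convConst k * (‖U‖ * ‖V‖) := by
        gcongr
        exact wt_mul_integral_le hk ξ
    _ = _ := by ring

theorem hat_add (k : ℕ) (U V : SpaceTime) (t : ℝ) (ξ : Plane) :
    hat k (U + V) t ξ = hat k U t ξ + hat k V t ξ := by
  simp [hat, add_div]

theorem hat_smul (k : ℕ) (c : ℝ) (U : SpaceTime) (t : ℝ) (ξ : Plane) :
    hat k (c • U) t ξ = c * hat k U t ξ := by
  simp [hat, mul_div_assoc]

/-- The convolution of Fourier transforms, i.e. the pointwise product, in the weighted space. -/
def convL {k : ℕ} (hk : 2 ≤ k) : SpaceTime →L[ℝ] SpaceTime →L[ℝ] SpaceTime :=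
  LinearMap.mkContinuous₂ (LinearMap.mk₂ ℝ
    (fun U V => BoundedContinuousFunction.ofNormedAddCommGroup
      (fun p => (wt k p.2 : ℂ) * conv (hat k U p.1) (hat k V p.1) p.2)
      ((Complex.continuous_ofReal.comp ((continuous_wt k).comp continuous_snd)).mul
        (continuous_conv_hat hk U V)) _ (fun p => norm_wt_mul_conv_le hk U V p.1 p.2))
    (fun U U' V => by
      ext p
      simp only [BoundedContinuousFunction.coe_ofNormedAddCommGroup,
        BoundedContinuousFunction.coe_add, Pi.add_apply, conv, hat_add, add_mul]
      rw [integral_add (integrable_hat_mul_hat hk U V _ _) (integrable_hat_mul_hat hk U' V _ _),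
        mul_add])
    (fun c U V => by
      ext p
      simp only [BoundedContinuousFunction.coe_ofNormedAddCommGroup,
        BoundedContinuousFunction.coe_smul, conv, hat_smul, mul_assoc]
      rw [integral_const_mul, Complex.real_smul]
      ring)
    (fun U V V' => by
      ext p
      simp only [BoundedContinuousFunction.coe_ofNormedAddCommGroup,
        BoundedContinuousFunction.coe_add, Pi.add_apply, conv, hat_add, mul_add]
      rw [integral_add (integrable_hat_mul_hat hk U V _ _) (integrable_hat_mul_hat hk U V' _ _),
        mul_add])
    (fun c U V => by
      ext p
      simp only [BoundedContinuousFunction.coe_ofNormedAddCommGroup,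
        BoundedContinuousFunction.coe_smul, conv, hat_smul, mul_left_comm _ (c : ℂ)]
      rw [integral_const_mul, Complex.real_smul]
      ring))
    (convConst k) fun U V => by
      have := convConst_nonneg k
      exact (BoundedContinuousFunction.norm_le (by positivity)).mpr
        fun p => norm_wt_mul_conv_le hk U V p.1 p.2

theorem convL_apply {k : ℕ} (hk : 2 ≤ k) (U V : SpaceTime) (p : ℝ × Plane) :
    convL hk U V p = (wt k p.2 : ℂ) * conv (hat k U p.1) (hat k V p.1) p.2 := rfl

theorem hat_convL {k : ℕ} (hk : 2 ≤ k) (U V : SpaceTime) (t : ℝ) (ξ : Plane) :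
    hat k (convL hk U V) t ξ = conv (hat k U t) (hat k V t) ξ := by
  rw [hat, convL_apply, mul_div_cancel_left₀ _ (wt_ofReal_ne_zero k ξ)]

/-- Complex conjugation of functions, on the Fourier side. -/
def conjL : SpaceTime →L[ℝ] SpaceTime :=
  LinearMap.mkContinuous
    { toFun := fun U => BoundedContinuousFunction.ofNormedAddCommGroup
        (fun p => conj (U (p.1, -p.2)))
        (Complex.continuous_conj.comp (U.continuous.comp (by fun_prop))) ‖U‖
        (fun p => by simpa using U.norm_coe_le_norm (p.1, -p.2))
      map_add' := fun U V => by ext p; simp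
      map_smul' := fun c U => by ext p; simp }
    1 fun U => by
      rw [one_mul]
      exact (BoundedContinuousFunction.norm_le (norm_nonneg _)).mpr
        fun p => by simpa using U.norm_coe_le_norm (p.1, -p.2)

theorem hat_conjL (k : ℕ) (U : SpaceTime) (t : ℝ) : hat k (conjL U) t = reflConj (hat k U t) := by
  funext ξ
  have h : conjL U (t, ξ) = conj (U (t, -ξ)) := rfl
  rw [hat, h, reflConj, hat, map_div₀, wt_neg, Complex.conj_ofReal]

/-! ### Duhamel integrals -/

/-- The time `t` projected to `[0, T]`. -/
def clamp (T t : ℝ) : ℝ := max 0 (min t T)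

theorem continuous_clamp (T : ℝ) : Continuous (clamp T) := by
  unfold clamp
  fun_prop

theorem clamp_nonneg (T t : ℝ) : 0 ≤ clamp T t := le_max_left _ _

theorem clamp_le {T : ℝ} (hT : 0 ≤ T) (t : ℝ) : clamp T t ≤ T := max_le hT (min_le_right _ _)

theorem clamp_of_mem {T t : ℝ} (ht : t ∈ Set.Icc 0 T) : clamp T t = t := by
  rw [clamp, min_eq_left ht.2, max_eq_right ht.1]

/-- The symbols of a family of evolution operators: continuous in `(r, ξ)` and bounded by `1`. -/
structure Propagator where
  /-- The symbol at time `r` and frequency `ξ`. -/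
  symbol : ℝ → Plane → ℂ
  continuous : Continuous fun p : ℝ × Plane => symbol p.1 p.2
  bound : ∀ r ξ, ‖symbol r ξ‖ ≤ 1

theorem Propagator.continuous_integrand (κ : Propagator) (T : ℝ) (H : SpaceTime) :
    Continuous (Function.uncurry fun (p : ℝ × Plane) (τ : ℝ) =>
      κ.symbol (clamp T p.1 - τ) p.2 * H (τ, p.2)) := by
  have hc := continuous_clamp T
  exact (κ.continuous.comp (by fun_prop : Continuous fun q : (ℝ × Plane) × ℝ =>
    (clamp T q.1.1 - q.2, q.1.2))).mul (H.continuous.comp (by fun_prop))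

theorem Propagator.intervalIntegrable (κ : Propagator) (T : ℝ) (H : SpaceTime) (p : ℝ × Plane)
    (a b : ℝ) : IntervalIntegrable (fun τ => κ.symbol (clamp T p.1 - τ) p.2 * H (τ, p.2))
      volume a b :=
  ((κ.continuous_integrand T H).comp
    (by fun_prop : Continuous fun τ : ℝ => (p, τ))).intervalIntegrable a b

theorem Propagator.norm_integral_le (κ : Propagator) {T : ℝ} (hT : 0 ≤ T) (H : SpaceTime)
    (p : ℝ × Plane) :
    ‖∫ τ in (0 : ℝ)..clamp T p.1, κ.symbol (clamp T p.1 - τ) p.2 * H (τ, p.2)‖ ≤ T * ‖H‖ := by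
  refine (intervalIntegral.norm_integral_le_of_norm_le_const (C := ‖H‖) fun τ _ => ?_).trans ?_
  · rw [norm_mul]
    exact mul_le_of_le_one_left (norm_nonneg _) (κ.bound _ _) |>.trans (H.norm_coe_le_norm _)
  · rw [sub_zero, abs_of_nonneg (clamp_nonneg _ _), mul_comm]
    gcongr
    exact clamp_le hT _

/-- The Duhamel integral `∫₀ᵗ κ(t - τ) H(τ) dτ` for `t ∈ [0, T]`, extended by constants. -/
def duhamelL (κ : Propagator) {T : ℝ} (hT : 0 ≤ T) : SpaceTime →L[ℝ] SpaceTime :=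
  LinearMap.mkContinuous
    { toFun := fun H => BoundedContinuousFunction.ofNormedAddCommGroup
        (fun p => ∫ τ in (0 : ℝ)..clamp T p.1, κ.symbol (clamp T p.1 - τ) p.2 * H (τ, p.2))
        (intervalIntegral.continuous_parametric_intervalIntegral_of_continuous
          (κ.continuous_integrand T H) ((continuous_clamp T).comp continuous_fst)) (T * ‖H‖)
        (κ.norm_integral_le hT H)
      map_add' := fun H H' => by
        ext p
        simp only [BoundedContinuousFunction.coe_ofNormedAddCommGroup,
          BoundedContinuousFunction.coe_add, Pi.add_apply, mul_add]
        exact intervalIntegral.integral_add (κ.intervalIntegrable T H p _ _)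
          (κ.intervalIntegrable T H' p _ _)
      map_smul' := fun c H => by
        ext p
        simp only [BoundedContinuousFunction.coe_ofNormedAddCommGroup,
          BoundedContinuousFunction.coe_smul, RingHom.id_apply, mul_smul_comm]
        exact intervalIntegral.integral_smul _ _ }
    T fun H => (BoundedContinuousFunction.norm_le (by positivity)).mpr (κ.norm_integral_le hT H)

theorem hat_duhamelL (k : ℕ) (κ : Propagator) {T : ℝ} (hT : 0 ≤ T) (H : SpaceTime) {t : ℝ}
    (ht : t ∈ Set.Icc 0 T) (ξ : Plane) :
    hat k (duhamelL κ hT H) t ξ = ∫ τ in (0 : ℝ)..t, κ.symbol (t - τ) ξ * hat k H τ ξ := by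
  have h : duhamelL κ hT H (t, ξ) =
      ∫ τ in (0 : ℝ)..clamp T t, κ.symbol (clamp T t - τ) ξ * H (τ, ξ) := rfl
  rw [hat, h, clamp_of_mem ht, ← intervalIntegral.integral_div]
  simp only [hat, mul_div_assoc]

/-- The propagator `e^(irΔ)`. -/
def schrodingerProp : Propagator where
  symbol r ξ := Complex.exp ((-(r * symb ξ) : ℝ) * Complex.I)
  continuous := by
    have := continuous_symb
    fun_prop
  bound r ξ := (Complex.norm_exp_ofReal_mul_I _).le

/-- The propagator `A^(-1/2) sin (r A^(1/2))`. -/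
def sinProp : Propagator where
  symbol r ξ := (((omega ξ)⁻¹ * Real.sin (r * omega ξ) : ℝ) : ℂ)
  continuous := by
    have h := continuous_omega
    have h' : Continuous fun ξ => (omega ξ)⁻¹ := h.inv₀ fun ξ => (omega_pos ξ).ne'
    exact Complex.continuous_ofReal.comp
      ((h'.comp continuous_snd).mul (by fun_prop))
  bound r ξ := by
    rw [Complex.norm_real, norm_mul, norm_inv, Real.norm_of_nonneg (omega_pos ξ).le]
    exact mul_le_one₀ (inv_le_one_of_one_le₀ (one_le_omega ξ)) (norm_nonneg _)
      (Real.abs_sin_le_one _)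

/-- The propagator `cos (r A^(1/2))`. -/
def cosProp : Propagator where
  symbol r ξ := ((Real.cos (r * omega ξ) : ℝ) : ℂ)
  continuous := by
    have h := continuous_omega
    fun_prop
  bound r ξ := by
    rw [Complex.norm_real]
    exact Real.abs_cos_le_one _

/-! ### Curves in the phase space -/

theorem continuous_toSobolev_hat {k : ℕ} (hk : 1 ≤ k) {s : ℝ} (hs : s + 1 < 2 * k) (U : SpaceTime) :
    Continuous fun t : ℝ => (decays_hat k U t).toSobolev hk hs := by
  rw [continuous_iff_continuousAt]
  intro t₀
  rw [ContinuousAt, tendsto_iff_norm_sub_tendsto_zero]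
  have h : Tendsto (fun t => ‖(decays_hat k U t).toSobolev hk hs -
      (decays_hat k U t₀).toSobolev hk hs‖ ^ 2) (𝓝 t₀) (𝓝 0) := by
    simp only [Decays.toSobolev, Sobolev.norm_ofFourier_sub_sq]
    have hlim : Continuous fun t : ℝ =>
        ∫ ξ, (1 + ‖ξ‖ ^ 2) ^ s * ‖hat k U t ξ - hat k U t₀ ξ‖ ^ 2 := by
      refine continuous_of_dominated
        (bound := fun ξ => (2 * ‖U‖) ^ 2 * (1 + ‖ξ‖ ^ 2) ^ (s - 2 * k)) (fun t => ?_)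
        (fun t => Eventually.of_forall fun ξ => ?_)
        ((integrable_one_add_norm_sq_rpow (by linarith)).const_mul _)
        (Eventually.of_forall fun ξ => ?_)
      · have h1 : Continuous fun ξ : Plane => (1 + ‖ξ‖ ^ 2) ^ s :=
          (Function.hasTemperateGrowth_one_add_norm_sq_rpow Plane s).1.continuous
        exact (h1.mul (((continuous_hat_apply k U t).sub
          (continuous_hat_apply k U t₀)).norm.pow 2)).aestronglyMeasurable
      · rw [Real.norm_of_nonneg (by positivity)]
        refine Decays.rpow_mul_sq_le (F := fun ξ => hat k U t ξ - hat k U t₀ ξ) (k := k) ?_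
        refine (norm_sub_le _ _).trans ?_
        have h1 := norm_hat_le k U t ξ
        have h2 := norm_hat_le k U t₀ ξ
        rw [two_mul, add_div, div_eq_mul_inv]
        exact add_le_add h1 h2
      · exact continuous_const.mul ((((continuous_hat k U).comp
          (by fun_prop : Continuous fun t : ℝ => (t, ξ))).sub continuous_const).norm.pow 2)
    simpa using hlim.tendsto t₀
  have h2 := h.sqrt
  simpa [Real.sqrt_sq] using h2

/-- The curve `t ↦ (u(t), n(t), m(t))` in the phase space, given by the Fourier transforms `U`, `V`,
`W` of its components. -/
def phaseCurve {k : ℕ} (hk : 1 ≤ k) {s σ : ℝ} (hs : s + 1 < 2 * k) (hσ : σ + 1 < 2 * k) (T : ℝ)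
    (U V W : SpaceTime) (hV : ∀ t ∈ Set.Icc 0 T, ∀ ξ, hat k V t (-ξ) = conj (hat k V t ξ))
    (hW : ∀ t ∈ Set.Icc 0 T, ∀ ξ, hat k W t (-ξ) = conj (hat k W t ξ)) :
    C(Set.Icc (0 : ℝ) T, Phase s σ) where
  toFun t := ((decays_hat k U t).toSobolev hk hs,
    ⟨(decays_hat k V t).toSobolev hk hσ, toSobolev_mem_realSobolev _ _ _ (hV t t.2)⟩,
    ⟨(decays_hat k W t).toSobolev hk (by linarith), toSobolev_mem_realSobolev _ _ _ (hW t t.2)⟩)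
  continuous_toFun :=
    ((continuous_toSobolev_hat hk hs U).comp continuous_subtype_val).prodMk
      ((((continuous_toSobolev_hat hk hσ V).comp continuous_subtype_val).subtype_mk _).prodMk
        (((continuous_toSobolev_hat hk (by linarith) W).comp continuous_subtype_val).subtype_mk _))

/-! ### The system on the Fourier side -/

/-- `|u|²` is real-valued. -/
theorem conv_reflConj_neg (F : Plane → ℂ) (ξ : Plane) :
    conv (reflConj F) F (-ξ) = conj (conv (reflConj F) F ξ) := by
  rw [conv, conv, ← integral_conj, ← integral_add_left_eq_self (fun η => conj _) ξ]
  congr 1 with η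
  simp only [reflConj, map_mul, Complex.conj_conj]
  rw [show -(ξ + η) = -ξ - η by abel, show ξ - (ξ + η) = -η by abel, mul_comm]

/-- The curve with Fourier transform `κ(t, ξ) F(ξ)`. -/
def freeCurve (κ : Propagator) {k : ℕ} {F : Plane → ℂ} (hF : Decays k F) : SpaceTime :=
  BoundedContinuousFunction.ofNormedAddCommGroup
    (fun p => (wt k p.2 : ℂ) * (κ.symbol p.1 p.2 * F p.2))
    ((Complex.continuous_ofReal.comp ((continuous_wt k).comp continuous_snd)).mul
      (κ.continuous.mul (hF.continuous.comp continuous_snd))) hF.bound.choose fun p => by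
    have h := hF.bound.choose_spec p.2
    have h1 := κ.bound p.1 p.2
    have h2 := wt_pos k p.2
    rw [norm_mul, norm_mul, Complex.norm_real, Real.norm_of_nonneg h2.le]
    rw [le_div_iff₀ (by positivity)] at h
    calc _ ≤ wt k p.2 * (1 * ‖F p.2‖) := by gcongr
      _ ≤ _ := by rw [one_mul, mul_comm]; exact h

theorem hat_freeCurve (κ : Propagator) {k : ℕ} {F : Plane → ℂ} (hF : Decays k F) (t : ℝ)
    (ξ : Plane) : hat k (freeCurve κ hF) t ξ = κ.symbol t ξ * F ξ := by
  have h : freeCurve κ hF (t, ξ) = (wt k ξ : ℂ) * (κ.symbol t ξ * F ξ) := rfl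
  rw [hat, h, mul_div_cancel_left₀ _ (wt_ofReal_ne_zero k ξ)]

/-- The nonlinear terms of the integral equations for `(u, n)`. -/
def nonlin {k : ℕ} (hk : 2 ≤ k) {T : ℝ} (hT : 0 ≤ T) (w : SpaceTime × SpaceTime) :
    SpaceTime × SpaceTime :=
  ((-Complex.I) • duhamelL schrodingerProp hT (convL hk w.2 w.1),
    duhamelL sinProp hT (convL hk (conjL w.1) w.1))

/-- The nonlinear term of the integral equation for `∂ₜn`. -/
def nonlinDeriv {k : ℕ} (hk : 2 ≤ k) {T : ℝ} (hT : 0 ≤ T) (U : SpaceTime) : SpaceTime :=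
  duhamelL cosProp hT (convL hk (conjL U) U)

theorem contDiff_nonlin {k : ℕ} (hk : 2 ≤ k) {T : ℝ} (hT : 0 ≤ T) :
    ContDiff ℝ 1 (nonlin hk hT) := by
  unfold nonlin
  fun_prop

theorem continuous_nonlinDeriv {k : ℕ} (hk : 2 ≤ k) {T : ℝ} (hT : 0 ≤ T) :
    Continuous (nonlinDeriv hk hT) := by
  unfold nonlinDeriv
  fun_prop

theorem nonlin_smul {k : ℕ} (hk : 2 ≤ k) {T : ℝ} (hT : 0 ≤ T) (c : ℝ) (w : SpaceTime × SpaceTime) :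
    nonlin hk hT (c • w) = c ^ 2 • nonlin hk hT w := by
  simp only [nonlin, Prod.smul_fst, Prod.smul_snd, map_smul, smul_apply, Prod.smul_mk, pow_two,
    mul_smul]
  rw [smul_comm (-Complex.I) c, smul_comm (-Complex.I) c]

theorem nonlinDeriv_smul {k : ℕ} (hk : 2 ≤ k) {T : ℝ} (hT : 0 ≤ T) (c : ℝ) (U : SpaceTime) :
    nonlinDeriv hk hT (c • U) = c ^ 2 • nonlinDeriv hk hT U := by
  simp only [nonlinDeriv, map_smul, smul_apply, smul_smul, pow_two]

/-! ### Testing Duhamel integrals -/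

/-- Fubini's theorem exchanges a Duhamel integral and the pairing with a test function. -/
theorem integral_duhamel_mul (k : ℕ) (κ : Propagator) (H : SpaceTime) (t : ℝ) {g : Plane → ℂ}
    (hg : Integrable g) :
    ∫ ξ, (∫ τ in (0 : ℝ)..t, κ.symbol (t - τ) ξ * hat k H τ ξ) * g ξ =
      ∫ τ in (0 : ℝ)..t, ∫ ξ, (κ.symbol (t - τ) ξ * hat k H τ ξ) * g ξ := by
  have : IsFiniteMeasure (volume.restrict (Set.uIoc 0 t)) :=
    inferInstanceAs (IsFiniteMeasure (volume.restrict (Set.Ioc (min 0 t) (max 0 t))))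
  have hi : Integrable (Function.uncurry fun (ξ : Plane) (τ : ℝ) =>
      (κ.symbol (t - τ) ξ * hat k H τ ξ) * g ξ)
      (volume.prod (volume.restrict (Set.uIoc 0 t))) := by
    have hc : Continuous fun p : Plane × ℝ => κ.symbol (t - p.2) p.1 * hat k H p.2 p.1 :=
      (κ.continuous.comp (by fun_prop : Continuous fun p : Plane × ℝ => (t - p.2, p.1))).mul
        ((continuous_hat k H).comp (by fun_prop : Continuous fun p : Plane × ℝ => (p.2, p.1)))
    have h1 : Integrable (fun p : Plane × ℝ => g p.1 * (1 : ℂ))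
        (volume.prod (volume.restrict (Set.uIoc 0 t))) :=
      hg.mul_prod (integrable_const (1 : ℂ))
    refine (h1.norm.const_mul ‖H‖).mono' (hc.aestronglyMeasurable.mul ?_)
      (Eventually.of_forall fun p => ?_)
    · simpa using h1.aestronglyMeasurable
    · simp only [Function.uncurry, norm_mul, mul_one]
      gcongr
      calc _ ≤ 1 * (‖H‖ * (wt k p.1)⁻¹) :=
            mul_le_mul (κ.bound _ _) (norm_hat_le _ _ _ _) (norm_nonneg _) zero_le_one
        _ ≤ ‖H‖ := by
            rw [one_mul]
            exact mul_le_of_le_one_right (norm_nonneg _) (inv_le_one_of_one_le₀ (one_le_wt _ _))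
  simp_rw [← intervalIntegral.integral_mul_const]
  simp only [intervalIntegral.intervalIntegral_eq_integral_uIoc, integral_smul]
  rw [integral_integral_swap hi]

theorem hat_complex_smul (k : ℕ) (c : ℂ) (U : SpaceTime) (t : ℝ) (ξ : Plane) :
    hat k (c • U) t ξ = c * hat k U t ξ := by
  simp [hat, mul_div_assoc]

theorem norm_hat_le_norm (k : ℕ) (U : SpaceTime) (t : ℝ) (ξ : Plane) : ‖hat k U t ξ‖ ≤ ‖U‖ :=
  (norm_hat_le k U t ξ).trans
    (mul_le_of_le_one_right (norm_nonneg _) (inv_le_one_of_one_le₀ (one_le_wt _ _)))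

theorem integrable_hat_mul (k : ℕ) (U : SpaceTime) (t : ℝ) (g : 𝓢(Plane, ℂ)) :
    Integrable fun ξ => hat k U t ξ * g ξ :=
  g.integrable.bdd_mul (continuous_hat_apply k U t).aestronglyMeasurable
    (Eventually.of_forall (norm_hat_le_norm k U t))

theorem isRep_toSobolev {k : ℕ} {s : ℝ} {F : Plane → ℂ} (hF : Decays k F) (hk : 1 ≤ k)
    (hs : s + 1 < 2 * k) : IsRep (Sobolev.dist (hF.toSobolev hk hs)) F :=
  fun φ => Sobolev.dist_ofFourier_apply _ _ φ

theorem dist_smul_apply {s : ℝ} (ε : ℝ) (f : Sobolev s) (φ : 𝓢(Plane, ℂ)) :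
    Sobolev.dist (ε • f) φ = ε * Sobolev.dist f φ := by
  change Sobolev.dist ((ε : ℂ) • f) φ = _
  rw [map_smul]
  rfl

theorem isRep_smul {s : ℝ} {f : Sobolev s} {F : Plane → ℂ} (h : IsRep (Sobolev.dist f) F) (ε : ℝ) :
    IsRep (Sobolev.dist (ε • f)) (fun ξ => ε * F ξ) := by
  intro φ
  rw [dist_smul_apply, h, ← integral_const_mul]
  simp_rw [mul_assoc]

/-- Testing the sum of a free evolution and a Duhamel integral. -/
theorem integral_hat_free_add_duhamel {k : ℕ} (κ₀ κ : Propagator) {F : Plane → ℂ}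
    (hF : Decays k F) {T : ℝ} (hT : 0 ≤ T) (H : SpaceTime) (ε : ℝ) (c : ℂ) {t : ℝ}
    (ht : t ∈ Set.Icc 0 T) (g : 𝓢(Plane, ℂ)) :
    ∫ ξ, hat k (ε • freeCurve κ₀ hF + c • duhamelL κ hT H) t ξ * g ξ =
      (∫ ξ, (κ₀.symbol t ξ * (ε * F ξ)) * g ξ) +
        c * ∫ τ in (0 : ℝ)..t, ∫ ξ, (κ.symbol (t - τ) ξ * hat k H τ ξ) * g ξ := by
  simp_rw [hat_add, add_mul]
  rw [integral_add (integrable_hat_mul k _ t g) (integrable_hat_mul k _ t g),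
    ← integral_duhamel_mul k κ H t g.integrable, ← integral_const_mul]
  simp_rw [hat_smul, hat_complex_smul, hat_freeCurve, hat_duhamelL k κ hT H ht]
  congr 2
  · ext ξ
    ring
  · ext ξ
    ring

/-! ### The strong solution with small Schwartz data -/

section solution

variable {k : ℕ} (hk : 2 ≤ k) {T : ℝ} (hT : 0 ≤ T) (a b : 𝓢(Plane, ℂ))

/-- The free evolution of the data `(u₀, n₀, n₁) = (𝓕⁻ a, 𝓕⁻ b, 0)`. -/
def freePair (k : ℕ) (a b : 𝓢(Plane, ℂ)) : SpaceTime × SpaceTime :=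
  (freeCurve schrodingerProp (Decays.of_schwartz k a), freeCurve cosProp (Decays.of_schwartz k b))

theorem hasTemperateGrowth_neg_omega_sq :
    (fun ξ => -((omega ξ : ℂ) ^ 2)).HasTemperateGrowth := by
  have h := Complex.ofRealCLM.hasTemperateGrowth.comp hasTemperateGrowth_omega
  have h' : (fun ξ => (omega ξ : ℂ)).HasTemperateGrowth := h
  exact (h'.pow 2).neg

/-- The Fourier transform `-ω² b` of `(Δ - 1) n₀`. -/
def negOmegaSqMul (b : 𝓢(Plane, ℂ)) : 𝓢(Plane, ℂ) :=
  SchwartzMap.smulLeftCLM ℂ (fun ξ => -((omega ξ : ℂ) ^ 2)) b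

theorem negOmegaSqMul_apply (ξ : Plane) : negOmegaSqMul b ξ = -((omega ξ : ℂ) ^ 2) * b ξ := by
  rw [negOmegaSqMul, SchwartzMap.smulLeftCLM_apply_apply hasTemperateGrowth_neg_omega_sq,
    smul_eq_mul]

/-- The free evolution of `∂ₜn`, for data with `n₁ = 0`; here
`-A^(1/2) sin (t A^(1/2)) = A^(-1/2) sin (t A^(1/2)) (-A)`. -/
def freeDeriv (k : ℕ) (b : 𝓢(Plane, ℂ)) : SpaceTime :=
  freeCurve sinProp (Decays.of_schwartz k (negOmegaSqMul b))

/-- The initial data `(𝓕⁻ a, 𝓕⁻ b, 0)`. -/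
def initialData {s σ : ℝ} (hs : s + 1 < 2 * k) (hσ : σ + 1 < 2 * k)
    (hb : ∀ ξ, b (-ξ) = conj (b ξ)) : Phase s σ :=
  ((Decays.of_schwartz k a).toSobolev (by omega) hs,
    ⟨(Decays.of_schwartz k b).toSobolev (by omega) hσ, toSobolev_mem_realSobolev _ _ _ hb⟩, 0)

theorem exists_schwartz_of_isRep {D : 𝓢'(Plane, ℂ)} {a : 𝓢(Plane, ℂ)} (h : IsRep D a) :
    ∃ f : 𝓢(Plane, ℂ), D = (f : 𝓢'(Plane, ℂ)) := by
  refine ⟨𝓕⁻ a, ?_⟩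
  ext φ
  refine Eq.trans ?_ (SchwartzMap.toTemperedDistributionCLM_apply_apply volume (𝓕⁻ a) φ).symm
  rw [h, SchwartzMap.fourierInv_coe,
    ← integral_fourierInv_mul a.integrable φ.integrable, SchwartzMap.fourierInv_coe]
  simp_rw [smul_eq_mul, mul_comm]

theorem isSchwartz_smul_initialData {s σ : ℝ} (hs : s + 1 < 2 * k) (hσ : σ + 1 < 2 * k)
    (hb : ∀ ξ, b (-ξ) = conj (b ξ)) (ε : ℝ) :
    IsSchwartz (ε • initialData hk a b hs hσ hb) := by
  have h1 := isRep_smul (isRep_toSobolev (Decays.of_schwartz k a) (by omega : 1 ≤ k) hs) ε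
  have h2 := isRep_smul (isRep_toSobolev (Decays.of_schwartz k b) (by omega : 1 ≤ k) hσ) ε
  obtain ⟨f, hf⟩ := exists_schwartz_of_isRep (a := (ε : ℂ) • a) h1
  obtain ⟨g, hg⟩ := exists_schwartz_of_isRep (a := (ε : ℂ) • b) h2
  refine ⟨f, g, 0, hf, hg, ?_⟩
  change Sobolev.dist (ε • (0 : Sobolev (σ - 1))) = _
  rw [smul_zero, map_zero, map_zero]

variable {hk hT a b}

theorem hat_nonlin_snd (w : SpaceTime × SpaceTime) {t : ℝ} (ht : t ∈ Set.Icc 0 T) (ξ : Plane) :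
    hat k (nonlin hk hT w).2 t ξ = ∫ τ in (0 : ℝ)..t, sinProp.symbol (t - τ) ξ *
      conv (reflConj (hat k w.1 τ)) (hat k w.1 τ) ξ := by
  rw [nonlin, hat_duhamelL k _ hT _ ht]
  simp_rw [hat_convL, hat_conjL]

theorem hat_nonlin_fst (w : SpaceTime × SpaceTime) {t : ℝ} (ht : t ∈ Set.Icc 0 T) (ξ : Plane) :
    hat k (nonlin hk hT w).1 t ξ = -Complex.I * ∫ τ in (0 : ℝ)..t,
      schrodingerProp.symbol (t - τ) ξ * conv (hat k w.2 τ) (hat k w.1 τ) ξ := by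
  rw [nonlin, hat_complex_smul, hat_duhamelL k _ hT _ ht]
  simp_rw [hat_convL]

theorem hat_nonlinDeriv (U : SpaceTime) {t : ℝ} (ht : t ∈ Set.Icc 0 T) (ξ : Plane) :
    hat k (nonlinDeriv hk hT U) t ξ = ∫ τ in (0 : ℝ)..t, cosProp.symbol (t - τ) ξ *
      conv (reflConj (hat k U τ)) (hat k U τ) ξ := by
  rw [nonlinDeriv, hat_duhamelL k _ hT _ ht]
  simp_rw [hat_convL, hat_conjL]

/-- A wave with real-valued data and a real-valued source is real-valued. -/
theorem integral_real_symbol_neg {κ : Propagator}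
    (hκ : ∀ r ξ, κ.symbol r (-ξ) = conj (κ.symbol r ξ))
    (F : ℝ → Plane → ℂ) (t : ℝ) (ξ : Plane) :
    ∫ τ in (0 : ℝ)..t, κ.symbol (t - τ) (-ξ) * conv (reflConj (F τ)) (F τ) (-ξ) =
      conj (∫ τ in (0 : ℝ)..t, κ.symbol (t - τ) ξ * conv (reflConj (F τ)) (F τ) ξ) := by
  rw [← intervalIntegral.intervalIntegral_conj]
  simp_rw [map_mul, hκ, conv_reflConj_neg]

theorem cosProp_symbol_neg (r : ℝ) (ξ : Plane) :
    cosProp.symbol r (-ξ) = conj (cosProp.symbol r ξ) := by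
  simp only [cosProp, omega_neg, Complex.conj_ofReal]

theorem sinProp_symbol_neg (r : ℝ) (ξ : Plane) :
    sinProp.symbol r (-ξ) = conj (sinProp.symbol r ξ) := by
  simp only [sinProp, omega_neg, Complex.conj_ofReal]

/-- The component `n` of the solution is real-valued. -/
theorem hat_neg_of_fixedPoint (hb : ∀ ξ, b (-ξ) = conj (b ξ)) {ε : ℝ} {w : SpaceTime × SpaceTime}
    (hw : w = ε • freePair k a b + nonlin hk hT w) (t : ℝ) (ht : t ∈ Set.Icc 0 T) (ξ : Plane) :
    hat k w.2 t (-ξ) = conj (hat k w.2 t ξ) := by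
  have h : w.2 = ε • freeCurve cosProp (Decays.of_schwartz k b) + (nonlin hk hT w).2 :=
    congrArg Prod.snd hw
  rw [h]
  simp only [hat_add, hat_smul, hat_freeCurve, hat_nonlin_snd w ht, map_add, map_mul, hb,
    cosProp_symbol_neg, Complex.conj_ofReal]
  rw [integral_real_symbol_neg sinProp_symbol_neg]

/-- The component `∂ₜn` of the solution is real-valued. -/
theorem hat_neg_deriv (hb : ∀ ξ, b (-ξ) = conj (b ξ)) (ε : ℝ) (U : SpaceTime) (t : ℝ)
    (ht : t ∈ Set.Icc 0 T) (ξ : Plane) :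
    hat k (ε • freeDeriv k b + nonlinDeriv hk hT U) t (-ξ) =
      conj (hat k (ε • freeDeriv k b + nonlinDeriv hk hT U) t ξ) := by
  simp only [freeDeriv, hat_add, hat_smul, hat_freeCurve, hat_nonlinDeriv U ht, map_add, map_mul,
    hb, sinProp_symbol_neg, Complex.conj_ofReal, negOmegaSqMul_apply, omega_neg, map_neg, map_pow]
  rw [integral_real_symbol_neg cosProp_symbol_neg]

variable (hk hT a b)

/-- The curve `(u, n, ∂ₜn)` in the phase space which belongs to a solution `w` of the fixed point
equation for `(u, n)`. -/
def solutionCurve {s σ : ℝ} (hs : s + 1 < 2 * k) (hσ : σ + 1 < 2 * k)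
    (hb : ∀ ξ, b (-ξ) = conj (b ξ)) (ε : ℝ) (w : SpaceTime × SpaceTime)
    (hw : w = ε • freePair k a b + nonlin hk hT w) : C(Set.Icc (0 : ℝ) T, Phase s σ) :=
  phaseCurve (by omega : 1 ≤ k) hs hσ T w.1 w.2 (ε • freeDeriv k b + nonlinDeriv hk hT w.1)
    (hat_neg_of_fixedPoint hb hw) (hat_neg_deriv hb ε w.1)

theorem dist_toSobolev {F : Plane → ℂ} (hF : Decays k F) (hk : 1 ≤ k) {s : ℝ}
    (hs : s + 1 < 2 * k) :
    Sobolev.dist (hF.toSobolev hk hs) = ((hF.toLp hk : Lp ℂ 2 (volume : Measure Plane)) :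
      𝓢'(Plane, ℂ)) := rfl

theorem solutionCurve_fst {s σ : ℝ} (hs : s + 1 < 2 * k) (hσ : σ + 1 < 2 * k)
    (hb : ∀ ξ, b (-ξ) = conj (b ξ)) (ε : ℝ) (w : SpaceTime × SpaceTime)
    (hw : w = ε • freePair k a b + nonlin hk hT w) (t : Set.Icc (0 : ℝ) T) :
    (solutionCurve hk hT a b hs hσ hb ε w hw t).1 =
      (decays_hat k w.1 t).toSobolev (by omega) hs := rfl

theorem solutionCurve_snd_fst {s σ : ℝ} (hs : s + 1 < 2 * k) (hσ : σ + 1 < 2 * k)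
    (hb : ∀ ξ, b (-ξ) = conj (b ξ)) (ε : ℝ) (w : SpaceTime × SpaceTime)
    (hw : w = ε • freePair k a b + nonlin hk hT w) (t : Set.Icc (0 : ℝ) T) :
    (solutionCurve hk hT a b hs hσ hb ε w hw t).2.1.1 =
      (decays_hat k w.2 t).toSobolev (by omega) hσ := rfl

theorem solutionCurve_snd_snd {s σ : ℝ} (hs : s + 1 < 2 * k) (hσ : σ + 1 < 2 * k)
    (hb : ∀ ξ, b (-ξ) = conj (b ξ)) (ε : ℝ) (w : SpaceTime × SpaceTime)
    (hw : w = ε • freePair k a b + nonlin hk hT w) (t : Set.Icc (0 : ℝ) T) :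
    (solutionCurve hk hT a b hs hσ hb ε w hw t).2.2.1 =
      (decays_hat k (ε • freeDeriv k b + nonlinDeriv hk hT w.1) t).toSobolev (by omega)
        (by linarith) := rfl

theorem isRep_smul_initialData_fst {s σ : ℝ} (hs : s + 1 < 2 * k) (hσ : σ + 1 < 2 * k)
    (hb : ∀ ξ, b (-ξ) = conj (b ξ)) (ε : ℝ) :
    IsRep (Sobolev.dist (ε • initialData hk a b hs hσ hb).1) (fun ξ => ε * a ξ) :=
  isRep_smul (isRep_toSobolev (Decays.of_schwartz k a) (by omega : 1 ≤ k) hs) ε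

theorem isRep_smul_initialData_snd_fst {s σ : ℝ} (hs : s + 1 < 2 * k) (hσ : σ + 1 < 2 * k)
    (hb : ∀ ξ, b (-ξ) = conj (b ξ)) (ε : ℝ) :
    IsRep (Sobolev.dist (ε • initialData hk a b hs hσ hb).2.1.1) (fun ξ => ε * b ξ) :=
  isRep_smul (isRep_toSobolev (Decays.of_schwartz k b) (by omega : 1 ≤ k) hσ) ε

theorem dist_smul_initialData_snd_snd {s σ : ℝ} (hs : s + 1 < 2 * k) (hσ : σ + 1 < 2 * k)
    (hb : ∀ ξ, b (-ξ) = conj (b ξ)) (ε : ℝ) :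
    Sobolev.dist (ε • initialData hk a b hs hσ hb).2.2.1 = 0 := by
  change Sobolev.dist (ε • (0 : Sobolev (σ - 1))) = 0
  rw [smul_zero, map_zero]

theorem isRep_prodDist (U V : SpaceTime) (τ : ℝ) :
    IsRep (prodDist ((decays_hat k V τ).toLp (by omega)) ((decays_hat k U τ).toLp (by omega)))
      (hat k (convL hk V U) τ) := fun φ => by
  rw [prodDist_toLp_apply _ _ hk hk]
  simp_rw [hat_convL]

theorem isRep_prodDist_star (U : SpaceTime) (τ : ℝ) :
    IsRep (prodDist (star ((decays_hat k U τ).toLp (by omega)))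
      ((decays_hat k U τ).toLp (by omega))) (hat k (convL hk (conjL U) U) τ) := fun φ => by
  rw [star_toLp (decays_hat k U τ) hk, prodDist_toLp_apply _ _ hk hk]
  simp_rw [hat_convL, hat_conjL]

/-- The integral equation for `u`. -/
theorem schrodinger_equation (D : 𝓢'(Plane, ℂ)) (ε : ℝ) (hD : IsRep D fun ξ => ε * a ξ)
    (w : SpaceTime × SpaceTime) (hw : w = ε • freePair k a b + nonlin hk hT w) {t : ℝ}
    (ht : t ∈ Set.Icc 0 T) (φ : 𝓢(Plane, ℂ)) :
    ∫ ξ, hat k w.1 t ξ * 𝓕⁻ φ ξ = schrodinger t D φ - Complex.I * ∫ τ in (0 : ℝ)..t,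
      schrodinger (t - τ) (prodDist ((decays_hat k w.2 τ).toLp (by omega))
        ((decays_hat k w.1 τ).toLp (by omega))) φ := by
  have e1 : w.1 = ε • freeCurve schrodingerProp (Decays.of_schwartz k a) +
      (-Complex.I) • duhamelL schrodingerProp hT (convL hk w.2 w.1) := congrArg Prod.fst hw
  have e : ∀ τ, schrodinger (t - τ) (prodDist ((decays_hat k w.2 τ).toLp (by omega))
      ((decays_hat k w.1 τ).toLp (by omega))) φ =
      ∫ ξ, (schrodingerProp.symbol (t - τ) ξ * hat k (convL hk w.2 w.1) τ ξ) * 𝓕⁻ φ ξ := fun τ =>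
    ((isRep_prodDist hk w.1 w.2 τ).schrodinger (t - τ)) φ
  simp_rw [e]
  rw [(hD.schrodinger t) φ]
  refine (congrArg (fun f : SpaceTime => ∫ ξ, hat k f t ξ * 𝓕⁻ φ ξ) e1).trans ?_
  rw [integral_hat_free_add_duhamel _ _ _ hT _ _ _ ht, neg_mul, ← sub_eq_add_neg]
  rfl

/-- The integral equation for `n`. -/
theorem kleinGordon_equation (D : 𝓢'(Plane, ℂ)) (ε : ℝ) (hD : IsRep D fun ξ => ε * b ξ)
    (w : SpaceTime × SpaceTime) (hw : w = ε • freePair k a b + nonlin hk hT w) {t : ℝ}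
    (ht : t ∈ Set.Icc 0 T) (φ : 𝓢(Plane, ℂ)) :
    ∫ ξ, hat k w.2 t ξ * 𝓕⁻ φ ξ = cosA t D φ + sinA t 0 φ + ∫ τ in (0 : ℝ)..t,
      sinA (t - τ) (prodDist (star ((decays_hat k w.1 τ).toLp (by omega)))
        ((decays_hat k w.1 τ).toLp (by omega))) φ := by
  have e2 : w.2 = ε • freeCurve cosProp (Decays.of_schwartz k b) +
      (1 : ℂ) • duhamelL sinProp hT (convL hk (conjL w.1) w.1) := by
    rw [one_smul]
    exact congrArg Prod.snd hw
  have e : ∀ τ, sinA (t - τ) (prodDist (star ((decays_hat k w.1 τ).toLp (by omega)))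
      ((decays_hat k w.1 τ).toLp (by omega))) φ =
      ∫ ξ, (sinProp.symbol (t - τ) ξ * hat k (convL hk (conjL w.1) w.1) τ ξ) * 𝓕⁻ φ ξ := fun τ =>
    ((isRep_prodDist_star hk w.1 τ).sinA (t - τ)) φ
  have e0 : sinA t 0 φ = 0 := by
    rw [map_zero]
    rfl
  simp_rw [e]
  rw [(hD.cosA t) φ, e0, add_zero]
  refine (congrArg (fun f : SpaceTime => ∫ ξ, hat k f t ξ * 𝓕⁻ φ ξ) e2).trans ?_
  rw [integral_hat_free_add_duhamel _ _ _ hT _ _ _ ht, one_mul]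
  rfl

/-- The integral equation for `∂ₜn`. -/
theorem kleinGordon_deriv_equation (D : 𝓢'(Plane, ℂ)) (ε : ℝ) (hD : IsRep D fun ξ => ε * b ξ)
    (U : SpaceTime) {t : ℝ} (ht : t ∈ Set.Icc 0 T) (φ : 𝓢(Plane, ℂ)) :
    ∫ ξ, hat k (ε • freeDeriv k b + nonlinDeriv hk hT U) t ξ * 𝓕⁻ φ ξ =
      dcosA t D φ + cosA t 0 φ + ∫ τ in (0 : ℝ)..t,
      cosA (t - τ) (prodDist (star ((decays_hat k U τ).toLp (by omega)))
        ((decays_hat k U τ).toLp (by omega))) φ := by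
  have e3 : ε • freeDeriv k b + nonlinDeriv hk hT U = ε • freeDeriv k b +
      (1 : ℂ) • nonlinDeriv hk hT U := by rw [one_smul]
  have e : ∀ τ, cosA (t - τ) (prodDist (star ((decays_hat k U τ).toLp (by omega)))
      ((decays_hat k U τ).toLp (by omega))) φ =
      ∫ ξ, (cosProp.symbol (t - τ) ξ * hat k (convL hk (conjL U) U) τ ξ) * 𝓕⁻ φ ξ := fun τ =>
    ((isRep_prodDist_star hk U τ).cosA (t - τ)) φ
  have e0 : cosA t 0 φ = 0 := by
    rw [map_zero]
    rfl
  have e1 : ∀ ξ, sinProp.symbol t ξ * (ε * negOmegaSqMul b ξ) =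
      ((-(omega ξ * Real.sin (t * omega ξ)) : ℝ) : ℂ) * (ε * b ξ) := fun ξ => by
    have h0 : (omega ξ : ℂ) ≠ 0 := Complex.ofReal_ne_zero.mpr (omega_pos ξ).ne'
    rw [negOmegaSqMul_apply]
    simp only [sinProp]
    push_cast
    field_simp
  simp_rw [e]
  rw [(hD.dcosA t) φ, e0, add_zero, e3, freeDeriv, nonlinDeriv,
    integral_hat_free_add_duhamel _ _ _ hT _ _ _ ht, one_mul]
  simp_rw [e1]

/-- The decay exponent `k ≥ 2` makes the solution a curve in `H² × H² × H¹`, and `2k` above `s + 1`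
and `σ + 1` makes it one in the given phase space. -/
theorem isStrongSolution_solutionCurve {s σ : ℝ} (hs : s + 1 < 2 * k) (hσ : σ + 1 < 2 * k)
    (hb : ∀ ξ, b (-ξ) = conj (b ξ)) (ε : ℝ) (w : SpaceTime × SpaceTime)
    (hw : w = ε • freePair k a b + nonlin hk hT w) :
    IsStrongSolution (ε • initialData hk a b hs hσ hb)
      (solutionCurve hk hT a b hs hσ hb ε w hw) := by
  have hk' : (2 : ℝ) ≤ k := by exact_mod_cast hk
  refine ⟨⟨solutionCurve hk hT a b (by linarith) (by linarith) hb ε w hw, fun t => ?_⟩,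
    fun τ => (decays_hat k w.1 τ).toLp (by omega), fun τ => (decays_hat k w.2 τ).toLp (by omega),
    fun t => ?_, fun t φ => ?_⟩
  · rw [solutionCurve_fst, solutionCurve_snd_fst, solutionCurve_snd_snd, solutionCurve_fst,
      solutionCurve_snd_fst, solutionCurve_snd_snd]
    simp only [dist_toSobolev, and_self]
  · rw [solutionCurve_fst, solutionCurve_snd_fst]
    simp only [dist_toSobolev, and_self]
  · rw [solutionCurve_fst, solutionCurve_snd_fst, solutionCurve_snd_snd,
      dist_smul_initialData_snd_snd, isRep_toSobolev (decays_hat k w.1 t),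
      isRep_toSobolev (decays_hat k w.2 t), isRep_toSobolev (decays_hat k _ t)]
    exact ⟨schrodinger_equation hk hT a b _ ε (isRep_smul_initialData_fst hk a b hs hσ hb ε)
        w hw t.2 φ,
      kleinGordon_equation hk hT a b _ ε (isRep_smul_initialData_snd_fst hk a b hs hσ hb ε)
        w hw t.2 φ,
      kleinGordon_deriv_equation hk hT b _ ε (isRep_smul_initialData_snd_fst hk a b hs hσ hb ε)
        w.1 t.2 φ⟩

end solution

/-! ### Second order expansions of `C²` maps -/

/-- Along every line through the origin a `C²` map agrees with its linearization up to
`C ε² ‖h‖²`, where `C` does not depend on the direction `h`. -/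
theorem exists_taylor_bound {E F : Type*} [NormedAddCommGroup E] [NormedSpace ℝ E]
    [NormedAddCommGroup F] [NormedSpace ℝ F] {f : E → F} (hf : ContDiffAt ℝ 2 f 0) :
    ∃ C : ℝ, 0 ≤ C ∧ ∀ h : E, ∀ᶠ ε : ℝ in 𝓝 0,
      ‖f (ε • h) - f 0 - ε • fderiv ℝ f 0 h‖ ≤ C * ε ^ 2 * ‖h‖ ^ 2 := by
  have h1 : ContDiffAt ℝ 1 (fderiv ℝ f) 0 := hf.fderiv_right (by norm_num)
  obtain ⟨K, s, hs, hK⟩ := h1.exists_lipschitzOnWith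
  have h2 : ∀ᶠ x in 𝓝 (0 : E), DifferentiableAt ℝ f x := by
    filter_upwards [hf.eventually (by simp)] with x hx using hx.differentiableAt (by norm_num)
  obtain ⟨r, hr, hball⟩ := Metric.mem_nhds_iff.mp (inter_mem hs h2)
  refine ⟨K, K.2, fun h => ?_⟩
  have hline : Tendsto (fun ε : ℝ => ε • h) (𝓝 0) (𝓝 0) := by
    have : Continuous fun ε : ℝ => ε • h := by fun_prop
    simpa using this.tendsto 0
  filter_upwards [hline.eventually (Metric.ball_mem_nhds 0 hr)] with ε hε
  rw [dist_zero_right] at hε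
  have hsub : Metric.closedBall (0 : E) ‖ε • h‖ ⊆ Metric.ball 0 r :=
    Metric.closedBall_subset_ball hε
  have h3 := (convex_closedBall (0 : E) ‖ε • h‖).norm_image_sub_le_of_norm_hasFDerivWithin_le'
    (f := f) (f' := fderiv ℝ f) (φ := fderiv ℝ f 0) (C := K * ‖ε • h‖) (x := 0) (y := ε • h)
    (fun x hx => (hball (hsub hx)).2.hasFDerivAt.hasFDerivWithinAt) (fun x hx => ?_) (by simp)
    (by simp)
  · rw [sub_zero, map_smul] at h3
    refine h3.trans (le_of_eq ?_)
    rw [norm_smul, Real.norm_eq_abs, ← sq_abs ε]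
    ring
  · have h4 := hK.norm_sub_le (hball (hsub hx)).1 (hball (Metric.mem_ball_self hr)).1
    rw [sub_zero] at h4
    refine h4.trans ?_
    gcongr
    simpa using hx

/-- If `g(ε) = ε A + ε² q + o(ε²)` is within `D ε²` of the affine map `B₀ + ε B₁`, then this map is
`ε A` and `‖q‖ ≤ D`. -/
theorem norm_le_of_expansion {g : ℝ → ℂ} {A q B₀ B₁ : ℂ} {D : ℝ}
    (hq : Tendsto (fun ε : ℝ => ((ε : ℂ) ^ 2)⁻¹ * (g ε - ε * A)) (𝓝[≠] 0) (𝓝 q))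
    (hg : ∀ᶠ ε : ℝ in 𝓝 0, ‖g ε - B₀ - ε * B₁‖ ≤ D * ε ^ 2) : ‖q‖ ≤ D := by
  have hε : Tendsto (fun ε : ℝ => (ε : ℂ)) (𝓝[≠] 0) (𝓝 0) := by
    have := Complex.continuous_ofReal.tendsto 0
    rw [Complex.ofReal_zero] at this
    exact this.mono_left nhdsWithin_le_nhds
  have hε' : Tendsto (fun ε : ℝ => ε) (𝓝[≠] 0) (𝓝 0) := tendsto_id.mono_left nhdsWithin_le_nhds
  have hg' := hg.filter_mono (nhdsWithin_le_nhds (s := {0}ᶜ))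
  have hne : ∀ᶠ ε : ℝ in 𝓝[≠] 0, ε ≠ 0 := self_mem_nhdsWithin
  have hR : Tendsto (fun ε : ℝ => (ε : ℂ)⁻¹ * (g ε - B₀ - ε * B₁)) (𝓝[≠] 0) (𝓝 0) := by
    refine squeeze_zero_norm' (a := fun ε => D * |ε|) ?_ ?_
    · filter_upwards [hg', hne] with ε h1 h2
      rw [norm_mul, norm_inv, Complex.norm_real, Real.norm_eq_abs, inv_mul_le_iff₀ (abs_pos.mpr h2)]
      refine h1.trans (le_of_eq ?_)
      rw [← sq_abs]
      ring
    · simpa using (hε'.abs.const_mul D)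
  have h0 : B₀ = 0 := by
    have h1 : Tendsto (fun ε : ℝ => (ε : ℂ) ^ 2 * (((ε : ℂ) ^ 2)⁻¹ * (g ε - ε * A)) -
        ε * ((ε : ℂ)⁻¹ * (g ε - B₀ - ε * B₁)) + ε * (A - B₁)) (𝓝[≠] 0)
        (𝓝 (0 ^ 2 * q - 0 * 0 + 0 * (A - B₁))) :=
      (((hε.pow 2).mul hq).sub (hε.mul hR)).add (hε.mul_const _)
    have h2 : Tendsto (fun _ : ℝ => B₀) (𝓝[≠] 0) (𝓝 (0 ^ 2 * q - 0 * 0 + 0 * (A - B₁))) := by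
      refine h1.congr' ?_
      filter_upwards [hne] with ε h
      have : (ε : ℂ) ≠ 0 := Complex.ofReal_ne_zero.mpr h
      field_simp
      ring
    simpa using tendsto_nhds_unique tendsto_const_nhds h2
  subst h0
  have hA : B₁ - A = 0 := by
    have h1 : Tendsto (fun ε : ℝ => (ε : ℂ) * (((ε : ℂ) ^ 2)⁻¹ * (g ε - ε * A)) -
        (ε : ℂ)⁻¹ * (g ε - 0 - ε * B₁)) (𝓝[≠] 0) (𝓝 (0 * q - 0)) := (hε.mul hq).sub hR
    have h2 : Tendsto (fun _ : ℝ => B₁ - A) (𝓝[≠] 0) (𝓝 (0 * q - 0)) := by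
      refine h1.congr' ?_
      filter_upwards [hne] with ε h
      have : (ε : ℂ) ≠ 0 := Complex.ofReal_ne_zero.mpr h
      field_simp
      ring
    simpa using tendsto_nhds_unique tendsto_const_nhds h2
  rw [sub_eq_zero] at hA
  subst hA
  refine le_of_tendsto hq.norm ?_
  filter_upwards [hg', hne] with ε h1 h2
  have h3 : 0 < ε ^ 2 := by positivity
  rw [norm_mul, norm_inv, norm_pow, Complex.norm_real, Real.norm_eq_abs, sq_abs,
    inv_mul_le_iff₀ h3]
  simpa [mul_comm] using h1

/-- If `ε ↦ f(ε h)`, tested with the functional `ℓ`, has the second order coefficient `q` at `0`,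
then `q` is controlled by `‖h‖²`. -/
theorem exists_quadratic_bound {E F : Type*} [NormedAddCommGroup E] [NormedSpace ℝ E]
    [NormedAddCommGroup F] [NormedSpace ℝ F] {f : E → F} (hf : ContDiffAt ℝ 2 f 0) :
    ∃ C : ℝ, 0 ≤ C ∧ ∀ (h : E) (ℓ : F →ₗ[ℝ] ℂ) (L : ℝ) (A q : ℂ), 0 ≤ L → (∀ x, ‖ℓ x‖ ≤ L * ‖x‖) →
      Tendsto (fun ε : ℝ => ((ε : ℂ) ^ 2)⁻¹ * (ℓ (f (ε • h)) - ε * A)) (𝓝[≠] 0) (𝓝 q) →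
      ‖q‖ ≤ C * ‖h‖ ^ 2 * L := by
  obtain ⟨C, hC, hf⟩ := exists_taylor_bound hf
  refine ⟨C, hC, fun h ℓ L A q hL0 hL hq => ?_⟩
  refine norm_le_of_expansion (B₀ := ℓ (f 0)) (B₁ := ℓ (fderiv ℝ f 0 h)) hq ?_
  filter_upwards [hf h] with ε hε
  have h1 : ℓ (f (ε • h)) - ℓ (f 0) - ε * ℓ (fderiv ℝ f 0 h) =
      ℓ (f (ε • h) - f 0 - ε • fderiv ℝ f 0 h) := by
    rw [map_sub, map_sub, map_smul, Complex.real_smul]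
  rw [h1]
  refine (hL _).trans ?_
  calc L * _ ≤ L * (C * ε ^ 2 * ‖h‖ ^ 2) := by gcongr
    _ = _ := by ring

/-! ### The second order term of the flow -/

/-- The Fourier transform of the second order term of `u(t)`, up to the factor `-i`. -/
def quadU (t : ℝ) (a b : Plane → ℂ) (ξ : Plane) : ℂ :=
  ∫ τ in (0 : ℝ)..t, schrodingerProp.symbol (t - τ) ξ *
    conv (fun η => cosProp.symbol τ η * b η) (fun η => schrodingerProp.symbol τ η * a η) ξ

/-- The Fourier transform of the second order term of `∂ₜn(t)`. -/
def quadN (t : ℝ) (a : Plane → ℂ) (ξ : Plane) : ℂ :=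
  ∫ τ in (0 : ℝ)..t, cosProp.symbol (t - τ) ξ *
    conv (reflConj fun η => schrodingerProp.symbol τ η * a η)
      (fun η => schrodingerProp.symbol τ η * a η) ξ

/-- Pairing of the Fourier transform at time `t` with a Schwartz function. -/
def pairL (k : ℕ) (t : ℝ) (ψ : 𝓢(Plane, ℂ)) : SpaceTime →L[ℝ] ℂ :=
  LinearMap.mkContinuous
    { toFun := fun U => ∫ ξ, hat k U t ξ * ψ ξ
      map_add' := fun U V => by
        simp_rw [hat_add, add_mul]
        exact integral_add (integrable_hat_mul k U t ψ) (integrable_hat_mul k V t ψ)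
      map_smul' := fun c U => by
        simp_rw [hat_smul, mul_assoc]
        rw [integral_const_mul, RingHom.id_apply, Complex.real_smul] }
    (∫ ξ, ‖ψ ξ‖) fun U => by
      rw [← integral_mul_const]
      refine norm_integral_le_of_norm_le (ψ.integrable.norm.mul_const _)
        (Eventually.of_forall fun ξ => ?_)
      rw [norm_mul, mul_comm]
      gcongr
      exact norm_hat_le_norm k U t ξ

theorem pairL_apply (k : ℕ) (t : ℝ) (ψ : 𝓢(Plane, ℂ)) (U : SpaceTime) :
    pairL k t ψ U = ∫ ξ, hat k U t ξ * ψ ξ := rfl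

/-- If `w(ε) = ε y + o(ε)` and `N` is quadratic, the `ε²` coefficient of `ε y' + N(w(ε))` is
`N(y)`. -/
theorem tendsto_quadratic {E : Type*} [NormedAddCommGroup E] [NormedSpace ℝ E]
    {w : ℝ → E} {y : E} (hw : Tendsto (fun ε => ε⁻¹ • w ε) (𝓝[≠] 0) (𝓝 y)) {N : E → SpaceTime}
    (hN : Continuous N) (hq : ∀ (c : ℝ) (w : E), N (c • w) = c ^ 2 • N w)
    (ℓ : SpaceTime →L[ℝ] ℂ) (y' : SpaceTime) (g : ℝ → ℂ)
    (hg : ∀ᶠ ε in 𝓝 0, g ε = ℓ (ε • y' + N (w ε))) :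
    Tendsto (fun ε : ℝ => ((ε : ℂ) ^ 2)⁻¹ * (g ε - ε * ℓ y')) (𝓝[≠] 0) (𝓝 (ℓ (N y))) := by
  have h1 : Tendsto (fun ε : ℝ => ℓ (N (ε⁻¹ • w ε))) (𝓝[≠] 0) (𝓝 (ℓ (N y))) :=
    ((ℓ.continuous.comp hN).tendsto y).comp hw
  refine h1.congr' ?_
  filter_upwards [hg.filter_mono (nhdsWithin_le_nhds (s := {0}ᶜ))] with ε hε
  rw [hε, hq, map_smul, map_add, map_smul, Complex.real_smul, Complex.real_smul]
  push_cast
  rw [inv_pow]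
  ring

theorem norm_toSobolev {k : ℕ} {F : Plane → ℂ} (hF : Decays k F) (hk : 1 ≤ k) {s : ℝ}
    (hs : s + 1 < 2 * k) :
    ‖hF.toSobolev hk hs‖ = √(∫ ξ, (1 + ‖ξ‖ ^ 2) ^ s * ‖F ξ‖ ^ 2) := by
  rw [← Real.sqrt_sq (norm_nonneg (hF.toSobolev hk hs)), Decays.toSobolev,
    Sobolev.norm_ofFourier_sq]

theorem norm_initialData_le {k : ℕ} (hk : 2 ≤ k) (a b : 𝓢(Plane, ℂ)) {s σ : ℝ}
    (hs : s + 1 < 2 * k) (hσ : σ + 1 < 2 * k) (hb : ∀ ξ, b (-ξ) = conj (b ξ)) :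
    ‖initialData hk a b hs hσ hb‖ ≤ √(∫ ξ, (1 + ‖ξ‖ ^ 2) ^ s * ‖a ξ‖ ^ 2) +
      √(∫ ξ, (1 + ‖ξ‖ ^ 2) ^ σ * ‖b ξ‖ ^ 2) := by
  have e1 := norm_toSobolev (Decays.of_schwartz k a) (by omega) hs
  have e2 := norm_toSobolev (Decays.of_schwartz k b) (by omega) hσ
  rw [initialData, norm_prod_le_iff, norm_prod_le_iff, ← e1, ← e2]
  refine ⟨le_add_of_nonneg_right (norm_nonneg _), le_add_of_nonneg_left (norm_nonneg _), ?_⟩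
  have e0 : ‖(0 : realSobolev (σ - 1))‖ = 0 := norm_zero
  exact e0.le.trans (add_nonneg (norm_nonneg _) (norm_nonneg _))

/-- The estimate which a flow of class `C²` at time `t` imposes on the second order terms of the
solution with data `(𝓕⁻ a, 𝓕⁻ b, 0)`. The norms in `H^s` of `u(t)` and in `H^(σ-1)` of `∂ₜn(t)` are
expressed by duality, with test functions `ψ`. -/
def SecondOrderBound (s σ t C : ℝ) : Prop :=
  ∀ a b ψ : 𝓢(Plane, ℂ), (∀ ξ, b (-ξ) = conj (b ξ)) →
    ‖∫ ξ, quadU t a b ξ * ψ ξ‖ ≤ C * (√(∫ ξ, (1 + ‖ξ‖ ^ 2) ^ s * ‖a ξ‖ ^ 2) +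
      √(∫ ξ, (1 + ‖ξ‖ ^ 2) ^ σ * ‖b ξ‖ ^ 2)) ^ 2 * √(∫ ξ, (1 + ‖ξ‖ ^ 2) ^ (-s) * ‖ψ ξ‖ ^ 2) ∧
    ‖∫ ξ, quadN t a ξ * ψ ξ‖ ≤ C * (√(∫ ξ, (1 + ‖ξ‖ ^ 2) ^ s * ‖a ξ‖ ^ 2) +
      √(∫ ξ, (1 + ‖ξ‖ ^ 2) ^ σ * ‖b ξ‖ ^ 2)) ^ 2 *
        √(∫ ξ, (1 + ‖ξ‖ ^ 2) ^ (1 - σ) * ‖ψ ξ‖ ^ 2)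

/-- If the time `t` map of the flow is `C²`, its second order term is bounded on Schwartz data. -/
theorem exists_bound_of_contDiffOn {s σ T : ℝ} (hT : 0 < T) {U : Set (Phase s σ)} (hU : IsOpen U)
    (h0 : (0 : Phase s σ) ∈ U) {Φ : Phase s σ → C(Set.Icc (0 : ℝ) T, Phase s σ)}
    (hΦ : IsFlowMap U Φ) (t : Set.Icc (0 : ℝ) T) (hC : ContDiffOn ℝ 2 (fun d => Φ d t) U) :
    ∃ C : ℝ, 0 ≤ C ∧ SecondOrderBound s σ t C := by
  obtain ⟨C, hC0, hC⟩ := exists_quadratic_bound (hC.contDiffAt (hU.mem_nhds h0))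
  refine ⟨C, hC0, fun a b ψ hb => ?_⟩
  -- The solution is constructed with a decay of its Fourier transform that suits `s`, `σ` and `H²`.
  obtain ⟨k, hk⟩ := exists_nat_gt (max 2 (max (s + 1) (σ + 1)))
  have hk2' : (2 : ℝ) < k := (le_max_left _ _).trans_lt hk
  have hk2 : 2 ≤ k := by exact_mod_cast hk2'.le
  have hs : s + 1 < 2 * k := by
    have := (le_max_left (s + 1) (σ + 1)).trans (le_max_right 2 _)
    linarith
  have hσ : σ + 1 < 2 * k := by
    have := (le_max_right (s + 1) (σ + 1)).trans (le_max_right 2 _)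
    linarith
  obtain ⟨w, hw, hw'⟩ := exists_fixedPoint (contDiff_nonlin hk2 hT.le)
    (nonlin_smul hk2 hT.le) (freePair k a b)
  set d : Phase s σ := initialData hk2 a b hs hσ hb with hd
  have hdn : ‖d‖ ≤ √(∫ ξ, (1 + ‖ξ‖ ^ 2) ^ s * ‖a ξ‖ ^ 2) +
      √(∫ ξ, (1 + ‖ξ‖ ^ 2) ^ σ * ‖b ξ‖ ^ 2) :=
    norm_initialData_le hk2 a b hs hσ hb
  have hmem : ∀ᶠ ε : ℝ in 𝓝 0, ε • d ∈ U := by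
    have hc : Continuous fun ε : ℝ => ε • d := by fun_prop
    exact hc.tendsto 0 (hU.mem_nhds (by simpa using h0))
  have hsol : ∀ᶠ ε : ℝ in 𝓝 0, ∃ hwε : w ε = ε • freePair k a b + nonlin hk2 hT.le (w ε),
      Φ (ε • d) = solutionCurve hk2 hT.le a b hs hσ hb ε (w ε) hwε := by
    filter_upwards [hw, hmem] with ε h1 h2
    exact ⟨h1, hΦ _ h2 (isSchwartz_smul_initialData hk2 a b hs hσ hb ε) _
      (isStrongSolution_solutionCurve hk2 hT.le a b hs hσ hb ε (w ε) h1)⟩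
  have hf1 : ∀ τ, hat k (freePair k a b).1 τ = fun η => schrodingerProp.symbol τ η * a η :=
    fun τ => funext fun η => hat_freeCurve _ (Decays.of_schwartz k _) _ _
  have hf2 : ∀ τ, hat k (freePair k a b).2 τ = fun η => cosProp.symbol τ η * b η :=
    fun τ => funext fun η => hat_freeCurve _ (Decays.of_schwartz k _) _ _
  constructor
  · let ℓ : Phase s σ →ₗ[ℝ] ℂ :=
      { toFun := fun x => Sobolev.dist x.1 (𝓕 ψ)
        map_add' := fun x y => by
          rw [Prod.fst_add, map_add]
          rfl
        map_smul' := fun c x => by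
          rw [Prod.smul_fst, dist_smul_apply, RingHom.id_apply, Complex.real_smul] }
    have hℓ : ∀ x, ‖ℓ x‖ ≤ √(∫ ξ, (1 + ‖ξ‖ ^ 2) ^ (-s) * ‖ψ ξ‖ ^ 2) * ‖x‖ := fun x => by
      refine (Sobolev.norm_dist_apply_le x.1 ψ).trans ?_
      rw [mul_comm]
      gcongr
      exact norm_fst_le x
    have key := hC d ℓ _ _ _ (Real.sqrt_nonneg _) hℓ (tendsto_quadratic hw'
      (N := fun w => (nonlin hk2 hT.le w).1)
      (continuous_fst.comp (contDiff_nonlin hk2 hT.le).continuous)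
      (fun c w => by rw [nonlin_smul, Prod.smul_fst]) (pairL k t ψ) (freePair k a b).1
      (fun ε => ℓ (Φ (ε • d) t)) (by
        filter_upwards [hsol] with ε ⟨h1, h2⟩
        have h3 : ε • (freePair k a b).1 + (nonlin hk2 hT.le (w ε)).1 = (w ε).1 :=
          (congrArg Prod.fst h1).symm
        rw [h3, pairL_apply]
        change Sobolev.dist (Φ (ε • d) t).1 (𝓕 ψ) = _
        rw [h2, solutionCurve_fst, isRep_toSobolev, fourierInv_fourier_eq]))
    have e : pairL k t ψ (nonlin hk2 hT.le (freePair k a b)).1 =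
        -Complex.I * ∫ ξ, quadU t a b ξ * ψ ξ := by
      rw [pairL_apply, ← integral_const_mul]
      congr 1 with ξ
      rw [hat_nonlin_fst _ t.2]
      simp_rw [hf1, hf2, quadU, mul_assoc]
    rw [e, norm_mul, norm_neg, Complex.norm_I, one_mul] at key
    refine key.trans ?_
    gcongr
  · let ℓ : Phase s σ →ₗ[ℝ] ℂ :=
      { toFun := fun x => Sobolev.dist x.2.2.1 (𝓕 ψ)
        map_add' := fun x y => by
          rw [Prod.snd_add, Prod.snd_add, Submodule.coe_add, map_add]
          rfl
        map_smul' := fun c x => by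
          rw [Prod.smul_snd, Prod.smul_snd, Submodule.coe_smul, dist_smul_apply, RingHom.id_apply,
            Complex.real_smul] }
    have hℓ : ∀ x, ‖ℓ x‖ ≤ √(∫ ξ, (1 + ‖ξ‖ ^ 2) ^ (1 - σ) * ‖ψ ξ‖ ^ 2) * ‖x‖ := fun x => by
      refine (Sobolev.norm_dist_apply_le x.2.2.1 ψ).trans ?_
      rw [mul_comm, neg_sub]
      gcongr
      exact (norm_snd_le x.2).trans (norm_snd_le x)
    have key := hC d ℓ _ _ _ (Real.sqrt_nonneg _) hℓ (tendsto_quadratic hw'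
      (N := fun w => nonlinDeriv hk2 hT.le w.1)
      ((continuous_nonlinDeriv hk2 hT.le).comp continuous_fst)
      (fun c w => by rw [Prod.smul_fst, nonlinDeriv_smul]) (pairL k t ψ) (freeDeriv k b)
      (fun ε => ℓ (Φ (ε • d) t)) (by
        filter_upwards [hsol] with ε ⟨h1, h2⟩
        rw [pairL_apply]
        change Sobolev.dist (Φ (ε • d) t).2.2.1 (𝓕 ψ) = _
        rw [h2, solutionCurve_snd_snd, isRep_toSobolev, fourierInv_fourier_eq]))
    have e : pairL k t ψ (nonlinDeriv hk2 hT.le (freePair k a b).1) =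
        ∫ ξ, quadN t a ξ * ψ ξ := by
      rw [pairL_apply]
      congr 1 with ξ
      rw [hat_nonlinDeriv _ t.2]
      simp_rw [hf1, quadN]
    rw [e] at key
    refine key.trans ?_
    gcongr

/-! ### Second order terms with an almost constant phase -/

theorem quadN_eq_hat {t : ℝ} (ht : 0 ≤ t) (a : 𝓢(Plane, ℂ)) (ξ : Plane) :
    quadN t a ξ = hat 2 (nonlinDeriv le_rfl ht (freePair 2 a 0).1) t ξ := by
  rw [hat_nonlinDeriv _ ⟨ht, le_rfl⟩, quadN]
  have h : ∀ τ, hat 2 (freePair 2 a 0).1 τ = fun η => schrodingerProp.symbol τ η * a η :=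
    fun τ => funext fun η => hat_freeCurve _ (Decays.of_schwartz 2 a) _ _
  simp_rw [h]

theorem quadU_eq_hat {t : ℝ} (ht : 0 ≤ t) (a b : 𝓢(Plane, ℂ)) (ξ : Plane) :
    quadU t a b ξ = Complex.I * hat 2 (nonlin le_rfl ht (freePair 2 a b)).1 t ξ := by
  rw [hat_nonlin_fst _ ⟨ht, le_rfl⟩, quadU]
  have h : ∀ τ, hat 2 (freePair 2 a b).1 τ = fun η => schrodingerProp.symbol τ η * a η :=
    fun τ => funext fun η => hat_freeCurve _ (Decays.of_schwartz 2 a) _ _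
  have h' : ∀ τ, hat 2 (freePair 2 a b).2 τ = fun η => cosProp.symbol τ η * b η :=
    fun τ => funext fun η => hat_freeCurve _ (Decays.of_schwartz 2 b) _ _
  simp_rw [h, h', ← mul_assoc, mul_neg, Complex.I_mul_I, neg_neg, one_mul]

theorem integrable_quadN_mul {t : ℝ} (ht : 0 ≤ t) (a ψ : 𝓢(Plane, ℂ)) :
    Integrable fun ξ => quadN t a ξ * ψ ξ := by
  simp_rw [quadN_eq_hat ht]
  exact integrable_hat_mul 2 _ t ψ

theorem integrable_quadU_mul {t : ℝ} (ht : 0 ≤ t) (a b ψ : 𝓢(Plane, ℂ)) :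
    Integrable fun ξ => quadU t a b ξ * ψ ξ := by
  simp_rw [quadU_eq_hat ht, mul_assoc]
  exact (integrable_hat_mul 2 _ t ψ).const_mul _

theorem continuous_conv_propagated {κ κ' : Propagator} (a b : 𝓢(Plane, ℂ)) (ξ : Plane) :
    Continuous fun τ => conv (fun η => κ.symbol τ η * b η) (fun η => κ'.symbol τ η * a η) ξ := by
  have h := (continuous_conv_hat le_rfl (freeCurve κ (Decays.of_schwartz 2 b))
    (freeCurve κ' (Decays.of_schwartz 2 a))).comp (by fun_prop : Continuous fun τ : ℝ => (τ, ξ))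
  refine h.congr fun τ => ?_
  have e1 := fun τ => funext fun η => hat_freeCurve κ (Decays.of_schwartz 2 b) τ η
  have e2 := fun τ => funext fun η => hat_freeCurve κ' (Decays.of_schwartz 2 a) τ η
  simp only [Function.comp_apply, e1, e2]

theorem continuous_conv_reflConj_propagated {κ : Propagator} (a : 𝓢(Plane, ℂ)) (ξ : Plane) :
    Continuous fun τ => conv (reflConj fun η => κ.symbol τ η * a η)
      (fun η => κ.symbol τ η * a η) ξ := by
  have h := (continuous_conv_hat le_rfl (conjL (freeCurve κ (Decays.of_schwartz 2 a)))
    (freeCurve κ (Decays.of_schwartz 2 a))).comp (by fun_prop : Continuous fun τ : ℝ => (τ, ξ))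
  refine h.congr fun τ => ?_
  have e1 := fun τ => funext fun η => hat_freeCurve κ (Decays.of_schwartz 2 a) τ η
  simp only [Function.comp_apply, hat_conjL, e1]

/-- An integral with respect to `(ξ, τ, η)` of a nonnegative amplitude times an oscillating kernel
`κ` which is close to a function `g` of `τ` alone wherever the amplitude does not vanish. -/
theorem norm_oscillatory_sub_le {t D : ℝ} (ht : 0 ≤ t) {A : Plane → Plane → ℝ} {ψ : Plane → ℝ}
    (hA : ∀ ξ η, 0 ≤ A ξ η) (hψ : ∀ ξ, 0 ≤ ψ ξ) (hAi : ∀ ξ, Integrable (A ξ))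
    (hAψ : Integrable fun ξ => (∫ η, A ξ η) * ψ ξ) {κ : ℝ → Plane → Plane → ℂ} {g : ℝ → ℂ}
    (hg : Continuous g) (h1 : ∀ τ ξ, Integrable fun η => (A ξ η : ℂ) * κ τ ξ η)
    (h2 : ∀ ξ, Continuous fun τ => ∫ η, (A ξ η : ℂ) * κ τ ξ η)
    (h3 : Integrable fun ξ => (∫ τ in (0 : ℝ)..t, ∫ η, (A ξ η : ℂ) * κ τ ξ η) * (ψ ξ : ℂ))
    (hκ : ∀ τ ∈ Set.Icc 0 t, ∀ ξ η, ψ ξ ≠ 0 → A ξ η ≠ 0 → ‖κ τ ξ η - g τ‖ ≤ D) :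
    ‖(∫ ξ, (∫ τ in (0 : ℝ)..t, ∫ η, (A ξ η : ℂ) * κ τ ξ η) * (ψ ξ : ℂ)) -
      (∫ τ in (0 : ℝ)..t, g τ) * ((∫ ξ, (∫ η, A ξ η) * ψ ξ : ℝ) : ℂ)‖ ≤
      t * D * ∫ ξ, (∫ η, A ξ η) * ψ ξ := by
  have hη : ∀ τ ∈ Set.Icc 0 t, ∀ ξ, ψ ξ ≠ 0 →
      ‖(∫ η, (A ξ η : ℂ) * κ τ ξ η) - g τ * ((∫ η, A ξ η : ℝ) : ℂ)‖ ≤ D * ∫ η, A ξ η := by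
    intro τ hτ ξ hξ
    have hAc : Integrable fun η => (A ξ η : ℂ) := (hAi ξ).ofReal
    rw [← integral_complex_ofReal, ← integral_const_mul, ← integral_const_mul,
      ← integral_sub (h1 τ ξ) (hAc.const_mul _)]
    refine norm_integral_le_of_norm_le ((hAi ξ).const_mul D) (Eventually.of_forall fun η => ?_)
    by_cases h0 : A ξ η = 0
    · simp [h0]
    · have e : (A ξ η : ℂ) * κ τ ξ η - g τ * (A ξ η : ℂ) = (κ τ ξ η - g τ) * (A ξ η : ℂ) := by ring
      rw [e, norm_mul, Complex.norm_real, Real.norm_of_nonneg (hA ξ η)]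
      exact mul_le_mul_of_nonneg_right (hκ τ hτ ξ η hξ h0) (hA ξ η)
  have hτ : ∀ ξ, ψ ξ ≠ 0 → ‖(∫ τ in (0 : ℝ)..t, ∫ η, (A ξ η : ℂ) * κ τ ξ η) -
      (∫ τ in (0 : ℝ)..t, g τ) * ((∫ η, A ξ η : ℝ) : ℂ)‖ ≤ t * D * ∫ η, A ξ η := by
    intro ξ hξ
    have hgc : Continuous fun τ => g τ * ((∫ η, A ξ η : ℝ) : ℂ) := hg.mul continuous_const
    rw [← intervalIntegral.integral_mul_const, ← intervalIntegral.integral_sub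
      ((h2 ξ).intervalIntegrable _ _) (hgc.intervalIntegrable _ _)]
    refine (intervalIntegral.norm_integral_le_of_norm_le_const fun τ hτ =>
      hη τ ?_ ξ hξ).trans (le_of_eq ?_)
    · rw [Set.uIoc_of_le ht] at hτ
      exact ⟨hτ.1.le, hτ.2⟩
    · rw [sub_zero, abs_of_nonneg ht]
      ring
  have hAc : Integrable fun ξ => (((∫ η, A ξ η) * ψ ξ : ℝ) : ℂ) := hAψ.ofReal
  rw [← integral_complex_ofReal, ← integral_const_mul, ← integral_const_mul,
    ← integral_sub h3 (hAc.const_mul _)]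
  refine norm_integral_le_of_norm_le (hAψ.const_mul _) (Eventually.of_forall fun ξ => ?_)
  by_cases h0 : ψ ξ = 0
  · simp [h0]
  · have e : (∫ τ in (0 : ℝ)..t, ∫ η, (A ξ η : ℂ) * κ τ ξ η) * (ψ ξ : ℂ) -
        (∫ τ in (0 : ℝ)..t, g τ) * (((∫ η, A ξ η) * ψ ξ : ℝ) : ℂ) =
        ((∫ τ in (0 : ℝ)..t, ∫ η, (A ξ η : ℂ) * κ τ ξ η) -
          (∫ τ in (0 : ℝ)..t, g τ) * ((∫ η, A ξ η : ℝ) : ℂ)) * (ψ ξ : ℂ) := by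
      push_cast
      ring
    rw [e, norm_mul, Complex.norm_real, Real.norm_of_nonneg (hψ ξ), ← mul_assoc]
    exact mul_le_mul_of_nonneg_right (hτ ξ h0) (hψ ξ)

/-- The kernel of the second order term of `∂ₜn`, at input frequencies `η`, `ξ - η`. -/
def kernelN (t τ : ℝ) (ξ η : Plane) : ℂ :=
  cosProp.symbol (t - τ) ξ * (conj (schrodingerProp.symbol τ η) * schrodingerProp.symbol τ (ξ - η))

/-- The kernel of the second order term of `u`, at input frequencies `η`, `ξ - η`. -/
def kernelU (t τ : ℝ) (ξ η : Plane) : ℂ :=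
  schrodingerProp.symbol (t - τ) ξ * (cosProp.symbol τ η * schrodingerProp.symbol τ (ξ - η))

theorem continuous_symbol_apply (κ : Propagator) (ξ : Plane) : Continuous fun r => κ.symbol r ξ :=
  κ.continuous.comp (by fun_prop : Continuous fun r : ℝ => (r, ξ))

theorem continuous_kernelN (t : ℝ) (ξ η : Plane) : Continuous fun τ => kernelN t τ ξ η :=
  ((continuous_symbol_apply cosProp ξ).comp (by fun_prop)).mul
    ((Complex.continuous_conj.comp (continuous_symbol_apply schrodingerProp η)).mul
      (continuous_symbol_apply schrodingerProp (ξ - η)))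

theorem continuous_kernelU (t : ℝ) (ξ η : Plane) : Continuous fun τ => kernelU t τ ξ η :=
  ((continuous_symbol_apply schrodingerProp ξ).comp (by fun_prop)).mul
    ((continuous_symbol_apply cosProp η).mul (continuous_symbol_apply schrodingerProp (ξ - η)))

theorem schrodinger_symbol_neg (r : ℝ) (ξ : Plane) :
    schrodingerProp.symbol r (-ξ) = schrodingerProp.symbol r ξ := by
  simp [schrodingerProp, symb]

theorem integrable_ofReal_conv_mul {f g : Plane → ℝ} (hf : Integrable f) (hg : Integrable g)
    (ψ : 𝓢(Plane, ℂ)) {h : Plane → ℝ} (hψ : ∀ ξ, ψ ξ = h ξ) :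
    Integrable fun ξ => (∫ η, f η * g (ξ - η)) * h ξ := by
  have h1 : Integrable fun ξ => ∫ η, f η * g (ξ - η) :=
    hf.integrable_convolution (ContinuousLinearMap.mul ℝ ℝ) hg
  have hh : h = fun ξ => (ψ ξ).re := funext fun ξ => by rw [hψ, Complex.ofReal_re]
  refine h1.mul_bdd (c := ‖ψ.toBoundedContinuousFunction‖) ?_ (Eventually.of_forall fun ξ => ?_)
  · rw [hh]
    exact (Complex.continuous_re.comp ψ.continuous).aestronglyMeasurable
  · rw [hh]
    exact (Complex.abs_re_le_norm _).trans (ψ.toBoundedContinuousFunction.norm_coe_le_norm ξ)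

theorem integrable_mul_comp_sub {f g : Plane → ℝ} (hf : Integrable f) (a : 𝓢(Plane, ℂ))
    (ha : ∀ ξ, a ξ = g ξ) (ξ : Plane) : Integrable fun η => f η * g (ξ - η) := by
  obtain rfl : g = fun ξ => (a ξ).re := funext fun ξ => by rw [ha, Complex.ofReal_re]
  refine hf.mul_bdd (c := ‖a.toBoundedContinuousFunction‖) ?_ (Eventually.of_forall fun η => ?_)
  · exact ((Complex.continuous_re.comp a.continuous).comp (by fun_prop :
      Continuous fun η : Plane => ξ - η)).aestronglyMeasurable
  · exact (Complex.abs_re_le_norm _).trans (a.toBoundedContinuousFunction.norm_coe_le_norm _)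

theorem integrable_of_ofReal_eq {f : Plane → ℝ} (a : 𝓢(Plane, ℂ)) (ha : ∀ ξ, a ξ = f ξ) :
    Integrable f := by
  obtain rfl : f = fun ξ => (a ξ).re := funext fun ξ => by rw [ha, Complex.ofReal_re]
  exact a.integrable.re

/-- On nonnegative data `f`, tested with a nonnegative `h`, the second order term of `∂ₜn` is close
to a multiple of the trilinear integral of `f`, `f`, `h` if its kernel is close to a function of
time alone on the support of the integrand. -/
theorem norm_integral_quadN_sub_le {t D : ℝ} (ht : 0 ≤ t) {a ψ : 𝓢(Plane, ℂ)} {f h : Plane → ℝ}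
    (ha : ∀ ξ, a ξ = f ξ) (hψ : ∀ ξ, ψ ξ = h ξ) (hf : ∀ ξ, 0 ≤ f ξ) (hh : ∀ ξ, 0 ≤ h ξ)
    {g : ℝ → ℂ} (hg : Continuous g)
    (hκ : ∀ τ ∈ Set.Icc 0 t, ∀ ξ η, h ξ ≠ 0 → f (-η) * f (ξ - η) ≠ 0 →
      ‖kernelN t τ ξ η - g τ‖ ≤ D) :
    ‖(∫ ξ, quadN t a ξ * ψ ξ) -
      (∫ τ in (0 : ℝ)..t, g τ) * ((∫ ξ, (∫ η, f (-η) * f (ξ - η)) * h ξ : ℝ) : ℂ)‖ ≤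
      t * D * ∫ ξ, (∫ η, f (-η) * f (ξ - η)) * h ξ := by
  have hfi : Integrable f := integrable_of_ofReal_eq a ha
  have hfm : Integrable fun η => f (-η) := hfi.comp_neg
  have e : ∀ τ ξ, cosProp.symbol (t - τ) ξ *
      conv (reflConj fun η => schrodingerProp.symbol τ η * a η)
        (fun η => schrodingerProp.symbol τ η * a η) ξ =
      ∫ η, ((f (-η) * f (ξ - η) : ℝ) : ℂ) * kernelN t τ ξ η := by
    intro τ ξ
    rw [conv, ← integral_const_mul]
    congr 1 with η
    simp only [reflConj, ha, map_mul, Complex.conj_ofReal, schrodinger_symbol_neg, kernelN]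
    push_cast
    ring
  have hAi : ∀ ξ, Integrable fun η => f (-η) * f (ξ - η) := integrable_mul_comp_sub hfm a ha
  have key := norm_oscillatory_sub_le (D := D) ht (A := fun ξ η => f (-η) * f (ξ - η)) (ψ := h)
    (κ := kernelN t) (fun ξ η => mul_nonneg (hf _) (hf _)) hh hAi
    (integrable_ofReal_conv_mul hfm hfi ψ hψ) hg (fun τ ξ => ?_) (fun ξ => ?_) ?_ hκ
  · simp_rw [← e, ← hψ] at key
    exact key
  · refine (hAi ξ).ofReal.mul_bdd (c := 1) ?_ (Eventually.of_forall fun η => ?_)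
    · refine Continuous.aestronglyMeasurable ?_
      exact continuous_const.mul ((Complex.continuous_conj.comp (schrodingerProp.continuous.comp
        (by fun_prop : Continuous fun η : Plane => (τ, η)))).mul (schrodingerProp.continuous.comp
        (by fun_prop : Continuous fun η : Plane => (τ, ξ - η))))
    · rw [kernelN, norm_mul, norm_mul, RCLike.norm_conj]
      exact mul_le_one₀ (cosProp.bound _ _) (by positivity)
        (mul_le_one₀ (schrodingerProp.bound _ _) (norm_nonneg _) (schrodingerProp.bound _ _))
  · simp_rw [← e]
    exact ((continuous_symbol_apply cosProp ξ).comp (by fun_prop)).mul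
      (continuous_conv_reflConj_propagated a ξ)
  · simp_rw [← e, ← hψ]
    exact integrable_quadN_mul ht a ψ

/-- The analogue of `norm_integral_quadN_sub_le` for the second order term of `u`. -/
theorem norm_integral_quadU_sub_le {t D : ℝ} (ht : 0 ≤ t) {a b ψ : 𝓢(Plane, ℂ)}
    {f f' h : Plane → ℝ} (ha : ∀ ξ, a ξ = f ξ) (hb : ∀ ξ, b ξ = f' ξ) (hψ : ∀ ξ, ψ ξ = h ξ)
    (hf : ∀ ξ, 0 ≤ f ξ) (hf' : ∀ ξ, 0 ≤ f' ξ) (hh : ∀ ξ, 0 ≤ h ξ)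
    {g : ℝ → ℂ} (hg : Continuous g)
    (hκ : ∀ τ ∈ Set.Icc 0 t, ∀ ξ η, h ξ ≠ 0 → f' η * f (ξ - η) ≠ 0 →
      ‖kernelU t τ ξ η - g τ‖ ≤ D) :
    ‖(∫ ξ, quadU t a b ξ * ψ ξ) -
      (∫ τ in (0 : ℝ)..t, g τ) * ((∫ ξ, (∫ η, f' η * f (ξ - η)) * h ξ : ℝ) : ℂ)‖ ≤
      t * D * ∫ ξ, (∫ η, f' η * f (ξ - η)) * h ξ := by
  have hfi : Integrable f := integrable_of_ofReal_eq a ha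
  have hfi' : Integrable f' := integrable_of_ofReal_eq b hb
  have e : ∀ τ ξ, schrodingerProp.symbol (t - τ) ξ * conv (fun η => cosProp.symbol τ η * b η)
      (fun η => schrodingerProp.symbol τ η * a η) ξ =
      ∫ η, ((f' η * f (ξ - η) : ℝ) : ℂ) * kernelU t τ ξ η := by
    intro τ ξ
    rw [conv, ← integral_const_mul]
    congr 1 with η
    simp only [ha, hb, kernelU]
    push_cast
    ring
  have hAi : ∀ ξ, Integrable fun η => f' η * f (ξ - η) := integrable_mul_comp_sub hfi' a ha
  have key := norm_oscillatory_sub_le (D := D) ht (A := fun ξ η => f' η * f (ξ - η)) (ψ := h)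
    (κ := kernelU t) (fun ξ η => mul_nonneg (hf' _) (hf _)) hh hAi
    (integrable_ofReal_conv_mul hfi' hfi ψ hψ) hg (fun τ ξ => ?_) (fun ξ => ?_) ?_ hκ
  · simp_rw [← e, ← hψ] at key
    exact key
  · refine (hAi ξ).ofReal.mul_bdd (c := 1) ?_ (Eventually.of_forall fun η => ?_)
    · refine Continuous.aestronglyMeasurable ?_
      exact continuous_const.mul ((cosProp.continuous.comp
        (by fun_prop : Continuous fun η : Plane => (τ, η))).mul (schrodingerProp.continuous.comp
        (by fun_prop : Continuous fun η : Plane => (τ, ξ - η))))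
    · rw [kernelU, norm_mul, norm_mul]
      exact mul_le_one₀ (schrodingerProp.bound _ _) (by positivity)
        (mul_le_one₀ (cosProp.bound _ _) (norm_nonneg _) (schrodingerProp.bound _ _))
  · simp_rw [← e]
    exact ((continuous_symbol_apply schrodingerProp ξ).comp (by fun_prop)).mul
      (continuous_conv_propagated a b ξ)
  · simp_rw [← e, ← hψ]
    exact integrable_quadU_mul ht a b ψ

/-! ### Anisotropic wave packets -/

/-- The linear map `z ↦ (M z₀, z₁)`. -/
def stretch (M : ℝ) : Plane →L[ℝ] Plane := Matrix.toEuclideanCLM (𝕜 := ℝ) (Matrix.diagonal ![M, 1])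

@[simp] theorem stretch_apply_zero (M : ℝ) (z : Plane) : stretch M z 0 = M * z 0 := by
  simp [stretch, Matrix.ofLp_toEuclideanCLM, Matrix.mulVec_diagonal]

@[simp] theorem stretch_apply_one (M : ℝ) (z : Plane) : stretch M z 1 = z 1 := by
  simp [stretch, Matrix.ofLp_toEuclideanCLM, Matrix.mulVec_diagonal]

theorem det_stretch (M : ℝ) : LinearMap.det (stretch M : Plane →ₗ[ℝ] Plane) = M := by
  rw [stretch, Matrix.coe_toEuclideanCLM_eq_toEuclideanLin,
    Matrix.toEuclideanLin_eq_toLin_orthonormal, LinearMap.det_toLin]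
  simp [Matrix.det_diagonal]

theorem norm_sq_plane (z : Plane) : ‖z‖ ^ 2 = z 0 ^ 2 + z 1 ^ 2 := by
  simp [EuclideanSpace.norm_sq_eq, Fin.sum_univ_two]

theorem abs_apply_le_norm (z : Plane) (i : Fin 2) : |z i| ≤ ‖z‖ := PiLp.norm_apply_le z i

theorem norm_le_norm_stretch {M : ℝ} (hM : 1 ≤ M) (z : Plane) : ‖z‖ ≤ ‖stretch M z‖ := by
  refine le_of_sq_le_sq ?_ (norm_nonneg _)
  rw [norm_sq_plane, norm_sq_plane, stretch_apply_zero, stretch_apply_one, mul_pow]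
  nlinarith [mul_nonneg (sq_nonneg (z 0)) (by nlinarith : 0 ≤ M ^ 2 - 1)]

theorem integral_comp_stretch {M : ℝ} (hM : 0 < M) (f : Plane → ℝ) :
    ∫ z, f (stretch M z) = M⁻¹ * ∫ z, f z := by
  have hinj : Function.Injective (stretch M) := by
    intro x y h
    have h0 := congrArg (fun z : Plane => z 0) h
    have h1 := congrArg (fun z : Plane => z 1) h
    simp only [stretch_apply_zero, stretch_apply_one] at h0 h1
    ext i
    fin_cases i
    · exact mul_left_cancel₀ hM.ne' h0
    · exact h1
  have hme : MeasurableEmbedding (stretch M) := (stretch M).continuous.measurableEmbedding hinj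
  have hmap := Measure.map_linearMap_addHaar_eq_smul_addHaar (volume : Measure Plane)
    (f := (stretch M : Plane →ₗ[ℝ] Plane)) (by rw [det_stretch]; exact hM.ne')
  rw [det_stretch, abs_of_pos (inv_pos.mpr hM)] at hmap
  have h := hme.integral_map (μ := (volume : Measure Plane)) f
  rw [← h, show Measure.map (stretch M) (volume : Measure Plane) =
    ENNReal.ofReal M⁻¹ • volume from hmap, integral_smul_measure,
    ENNReal.toReal_ofReal (inv_pos.mpr hM).le, smul_eq_mul]

/-- The wave packet `ξ ↦ λ β(M (ξ₀ - c₀), ξ₁ - c₁)`. -/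
def packet (β : ContDiffBump (0 : Plane)) (M l : ℝ) (c ξ : Plane) : ℝ := l * β (stretch M (ξ - c))

section Packet

variable {β : ContDiffBump (0 : Plane)} {M l r : ℝ} {c : Plane}

theorem packet_nonneg (hl : 0 ≤ l) (ξ : Plane) : 0 ≤ packet β M l c ξ := mul_nonneg hl β.nonneg

theorem packet_neg (ξ : Plane) : packet β M l c (-ξ) = packet β M l (-c) ξ := by
  rw [packet, packet, ← β.neg, ← map_neg]
  congr 3
  abel

theorem norm_stretch_lt_of_packet_ne_zero {ξ : Plane} (h : packet β M l c ξ ≠ 0) :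
    ‖stretch M (ξ - c)‖ < β.rOut := by
  by_contra! h'
  exact h (by rw [packet, β.zero_of_le_dist (by rwa [dist_zero_right]), mul_zero])

theorem norm_sub_lt_of_packet_ne_zero (hM : 1 ≤ M) {ξ : Plane} (h : packet β M l c ξ ≠ 0) :
    ‖ξ - c‖ < β.rOut :=
  (norm_le_norm_stretch hM _).trans_lt (norm_stretch_lt_of_packet_ne_zero h)

theorem contDiff_packet : ContDiff ℝ ∞ (packet β M l c) :=
  contDiff_const.mul (β.contDiff.comp ((stretch M).contDiff.comp (contDiff_id.sub contDiff_const)))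

theorem hasCompactSupport_packet (hM : 1 ≤ M) : HasCompactSupport (packet β M l c) := by
  refine HasCompactSupport.intro (isCompact_closedBall c β.rOut) fun ξ hξ => ?_
  by_contra h
  exact hξ (mem_closedBall_iff_norm.mpr (norm_sub_lt_of_packet_ne_zero hM h).le)

/-- A wave packet as a Schwartz function. -/
def packetS (β : ContDiffBump (0 : Plane)) (hM : 1 ≤ M) (l : ℝ) (c : Plane) : 𝓢(Plane, ℂ) :=
  HasCompactSupport.toSchwartzMap (f := fun ξ => (packet β M l c ξ : ℂ))
    ((hasCompactSupport_packet hM).comp_left Complex.ofReal_zero)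
    (Complex.ofRealCLM.contDiff.comp contDiff_packet)

theorem packetS_apply (hM : 1 ≤ M) (ξ : Plane) : packetS β hM l c ξ = (packet β M l c ξ : ℂ) := rfl

theorem integrable_packet (hM : 1 ≤ M) : Integrable (packet β M l c) :=
  contDiff_packet.continuous.integrable_of_hasCompactSupport (hasCompactSupport_packet hM)

/-- On the unit ball around a point `c` with `1 + |c|² ~ B` the weight `(1 + |ξ|²)^r` is at most a
multiple of `B^r`. -/
theorem rpow_weight_le {B : ℝ} (hB : 0 < B) (h1 : B ≤ 16 * (1 + ‖c‖ ^ 2))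
    (h2 : 1 + ‖c‖ ^ 2 ≤ 16 * B) {ξ : Plane} (hξ : ‖ξ - c‖ ≤ 1) :
    (1 + ‖ξ‖ ^ 2) ^ r ≤ 48 ^ |r| * B ^ r := by
  have e1 : ‖ξ‖ ≤ ‖c‖ + 1 := by
    have := norm_add_le c (ξ - c)
    rw [add_sub_cancel] at this
    linarith
  have e2 : ‖c‖ ≤ ‖ξ‖ + 1 := by
    have := norm_sub_le ξ (ξ - c)
    rw [sub_sub_cancel] at this
    linarith
  -- The constant is `48 = 3 · 16`, because `1 + |ξ|² ≤ 3 (1 + |c|²)` and conversely.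
  have e3 : 1 + ‖ξ‖ ^ 2 ≤ 48 * B := by nlinarith [norm_nonneg ξ, norm_nonneg c, sq_nonneg (‖c‖ - 1)]
  have e4 : B / 48 ≤ 1 + ‖ξ‖ ^ 2 := by nlinarith [norm_nonneg ξ, norm_nonneg c, sq_nonneg (‖ξ‖ - 1)]
  rcases le_total 0 r with hr | hr
  · rw [abs_of_nonneg hr, ← Real.mul_rpow (by norm_num) hB.le]
    exact Real.rpow_le_rpow (by positivity) e3 hr
  · rw [abs_of_nonpos hr, Real.rpow_neg (by norm_num), mul_comm, ← div_eq_mul_inv,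
      ← Real.div_rpow hB.le (by norm_num)]
    exact Real.rpow_le_rpow_of_nonpos (by positivity) e4 hr

theorem integrable_weight_packet (hM : 1 ≤ M) :
    Integrable fun ξ => (1 + ‖ξ‖ ^ 2) ^ r * packet β M l c ξ ^ 2 := by
  refine Continuous.integrable_of_hasCompactSupport ?_ ?_
  · exact (Continuous.rpow_const (by fun_prop) fun ξ => Or.inl (by positivity)).mul
      (contDiff_packet.continuous.pow 2)
  · exact ((hasCompactSupport_packet hM).comp_left (g := fun x => x ^ 2) (by simp)).mul_left

theorem integral_packet_sq (hM : 0 < M) :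
    ∫ ξ, packet β M l c ξ ^ 2 = l ^ 2 * (M⁻¹ * ∫ z, β z ^ 2) := by
  simp only [packet, mul_pow]
  rw [integral_const_mul, integral_sub_right_eq_self (fun ξ => β (stretch M ξ) ^ 2) c,
    integral_comp_stretch hM (fun z => β z ^ 2)]

theorem integrable_packet_sq (hM : 1 ≤ M) : Integrable fun ξ => packet β M l c ξ ^ 2 := by
  simpa using integrable_weight_packet (r := 0) hM

/-- The wave packets of height `M^(1/2) B^(-r/2)` at frequency `c`, `1 + |c|² ~ B`, are bounded
in `L²((1 + |ξ|²)^r)`. -/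
theorem integral_weight_packet_le_of_sq_eq (hβ : β.rOut ≤ 1) (hM : 1 ≤ M) {B : ℝ} (hB : 0 < B)
    (h1 : B ≤ 16 * (1 + ‖c‖ ^ 2)) (h2 : 1 + ‖c‖ ^ 2 ≤ 16 * B) (hl : l ^ 2 = M * B ^ (-r)) :
    ∫ ξ, (1 + ‖ξ‖ ^ 2) ^ r * packet β M l c ξ ^ 2 ≤ 48 ^ |r| * ∫ z, β z ^ 2 := by
  have hM0 : 0 < M := by linarith
  have hle : ∫ ξ, (1 + ‖ξ‖ ^ 2) ^ r * packet β M l c ξ ^ 2 ≤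
      ∫ ξ, 48 ^ |r| * B ^ r * packet β M l c ξ ^ 2 := by
    refine integral_mono (integrable_weight_packet hM) ((integrable_packet_sq hM).const_mul _)
      fun ξ => ?_
    by_cases h : packet β M l c ξ = 0
    · simp [h]
    · exact mul_le_mul_of_nonneg_right (rpow_weight_le hB h1 h2
        ((norm_sub_lt_of_packet_ne_zero hM h).le.trans hβ)) (sq_nonneg _)
  refine hle.trans (le_of_eq ?_)
  have hBr := (Real.rpow_pos_of_pos hB r).ne'
  rw [integral_const_mul, integral_packet_sq hM0, hl, Real.rpow_neg hB.le]
  field_simp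

theorem sq_amplitude (hM : 0 < M) {B : ℝ} (hB : 0 < B) :
    (M ^ (1 / 2 : ℝ) * B ^ (-(r / 2))) ^ 2 = M * B ^ (-r) := by
  rw [mul_pow, ← Real.rpow_natCast, ← Real.rpow_natCast, ← Real.rpow_mul hM.le,
    ← Real.rpow_mul hB.le]
  norm_num

end Packet

/-- The trilinear integral `∫∫ β(y) β(x - y) β(x) dy dx`. -/
def overlap (β : ContDiffBump (0 : Plane)) : ℝ := ∫ x, (∫ y, β y * β (x - y)) * β x

theorem overlap_pos (β : ContDiffBump (0 : Plane)) : 0 < overlap β := by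
  have hβi : Integrable β := β.continuous.integrable_of_hasCompactSupport β.hasCompactSupport
  have hc : Continuous fun x => ∫ y, β y * β (x - y) := by
    have := β.hasCompactSupport.continuous_convolution_left
      (ContinuousLinearMap.mul ℝ ℝ) (μ := volume) β.continuous (hβi.locallyIntegrable)
    exact this
  refine (hc.mul β.continuous).integral_pos_of_hasCompactSupport_nonneg_nonzero (x := 0)
    β.hasCompactSupport.mul_left (fun x => mul_nonneg (integral_nonneg fun y =>
      mul_nonneg β.nonneg β.nonneg) β.nonneg) ?_
  have h0 : β (0 : Plane) = 1 := β.one_of_mem_closedBall (Metric.mem_closedBall_self β.rIn_pos.le)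
  have : 0 < ∫ y, β y * β (0 - y) := by
    refine (β.continuous.mul
      (β.continuous.comp (by fun_prop))).integral_pos_of_hasCompactSupport_nonneg_nonzero
      (x := 0) β.hasCompactSupport.mul_right (fun y => mul_nonneg β.nonneg β.nonneg) ?_
    simp [h0]
  rw [h0, mul_one]
  exact this.ne'

/-- The trilinear integral of packets whose centres add up. Each of the two integrations contributes
a factor `M⁻¹`. -/
theorem integral_packet_conv_mul (β : ContDiffBump (0 : Plane)) {M : ℝ} (hM : 1 ≤ M) (l l' m : ℝ)
    (e e' : Plane) :
    ∫ ξ, (∫ η, packet β M l e η * packet β M l' e' (ξ - η)) * packet β M m (e + e') ξ =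
      l * l' * m * (M⁻¹ * (M⁻¹ * overlap β)) := by
  have hM0 : 0 < M := by linarith
  have h : ∀ ξ, ∫ η, packet β M l e η * packet β M l' e' (ξ - η) =
      l * l' * (M⁻¹ * ∫ y, β y * β (stretch M (ξ - (e + e')) - y)) := by
    intro ξ
    rw [← integral_comp_stretch hM0 fun y => β y * β (stretch M (ξ - (e + e')) - y),
      ← integral_const_mul, ← integral_add_right_eq_self _ e]
    congr 1 with η
    simp only [packet, ← map_sub]
    rw [add_sub_cancel_right, show ξ - (η + e) - e' = ξ - (e + e') - η by abel]
    ring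
  simp_rw [h, packet]
  rw [overlap, ← integral_comp_stretch hM0 fun x => (∫ y, β y * β (x - y)) * β x,
    ← integral_add_right_eq_self _ (e + e'), ← integral_const_mul, ← integral_const_mul]
  congr 1 with ξ
  rw [add_sub_cancel_right]
  ring

/-! ### Variation of the kernels on the support of wave packets -/

theorem norm_exp_ofReal_mul_I_sub_le (x y : ℝ) :
    ‖Complex.exp (x * Complex.I) - Complex.exp (y * Complex.I)‖ ≤ |x - y| := by
  have e : Complex.exp (x * Complex.I) - Complex.exp (y * Complex.I) =
      Complex.exp (y * Complex.I) * (Complex.exp (Complex.I * ((x - y : ℝ) : ℂ)) - 1) := by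
    rw [mul_sub, ← Complex.exp_add, mul_one]
    congr 2
    push_cast
    ring
  rw [e, norm_mul, Complex.norm_exp_ofReal_mul_I, one_mul]
  exact Real.norm_exp_I_mul_ofReal_sub_one_le

theorem norm_schrodinger_symbol_sub_le (r : ℝ) (ξ ζ : Plane) :
    ‖schrodingerProp.symbol r ξ - schrodingerProp.symbol r ζ‖ ≤ |r| * |symb ξ - symb ζ| := by
  refine (norm_exp_ofReal_mul_I_sub_le _ _).trans (le_of_eq ?_)
  rw [← abs_mul, ← abs_neg]
  congr 1
  ring

theorem abs_omega_sub_le (ξ ζ : Plane) : |omega ξ - omega ζ| ≤ 2 * Real.pi * ‖ξ - ζ‖ := by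
  have hsq : ∀ z : Plane, omega z ^ 2 = 1 + (2 * Real.pi * ‖z‖) ^ 2 := fun z =>
    Real.sq_sqrt (by positivity)
  have hle : ∀ z : Plane, 2 * Real.pi * ‖z‖ ≤ omega z := fun z => by
    refine Real.le_sqrt_of_sq_le ?_
    linarith
  have hπ := Real.pi_pos
  have h1 := hsq ξ
  have h2 := hsq ζ
  have h3 : |omega ξ - omega ζ| * (omega ξ + omega ζ) =
      |2 * Real.pi * ‖ξ‖ - 2 * Real.pi * ‖ζ‖| * (2 * Real.pi * ‖ξ‖ + 2 * Real.pi * ‖ζ‖) := by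
    have p1 := omega_pos ξ
    have p2 := omega_pos ζ
    rw [← abs_of_pos (add_pos p1 p2), ← abs_mul,
      ← abs_of_nonneg (by positivity : 0 ≤ 2 * Real.pi * ‖ξ‖ + 2 * Real.pi * ‖ζ‖), ← abs_mul]
    congr 1
    linear_combination h1 - h2
  have h4 : |omega ξ - omega ζ| ≤ |2 * Real.pi * ‖ξ‖ - 2 * Real.pi * ‖ζ‖| := by
    refine le_of_mul_le_mul_right ?_ (add_pos (omega_pos ξ) (omega_pos ζ))
    rw [h3]
    exact mul_le_mul_of_nonneg_left (add_le_add (hle _) (hle _)) (abs_nonneg _)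
  refine h4.trans ?_
  rw [← mul_sub, abs_mul, abs_of_pos (by positivity : 0 < 2 * Real.pi)]
  exact mul_le_mul_of_nonneg_left (abs_norm_sub_norm_le _ _) (by positivity)

theorem norm_cos_symbol_sub_le (r : ℝ) (ξ ζ : Plane) :
    ‖cosProp.symbol r ξ - cosProp.symbol r ζ‖ ≤ |r| * (2 * Real.pi * ‖ξ - ζ‖) := by
  have e : cosProp.symbol r ξ - cosProp.symbol r ζ =
      ((Real.cos (r * omega ξ) - Real.cos (r * omega ζ) : ℝ) : ℂ) := by
    rw [Complex.ofReal_sub]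
    rfl
  rw [e, Complex.norm_real]
  refine (Real.abs_cos_sub_cos_le _ _).trans ?_
  rw [← mul_sub, abs_mul]
  exact mul_le_mul_of_nonneg_left (abs_omega_sub_le _ _) (abs_nonneg _)

theorem norm_mul_mul_sub_le {a b c a' b' c' : ℂ} (hb : ‖b‖ ≤ 1) (hc : ‖c‖ ≤ 1)
    (ha' : ‖a'‖ ≤ 1) (hb' : ‖b'‖ ≤ 1) :
    ‖a * (b * c) - a' * (b' * c')‖ ≤ ‖a - a'‖ + ‖b - b'‖ + ‖c - c'‖ := by
  have e : a * (b * c) - a' * (b' * c') =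
      (a - a') * (b * c) + a' * ((b - b') * c) + a' * (b' * (c - c')) := by ring
  rw [e]
  refine norm_add₃_le.trans (add_le_add (add_le_add ?_ ?_) ?_)
  · rw [norm_mul, norm_mul]
    exact mul_le_of_le_one_right (norm_nonneg _) (mul_le_one₀ hb (norm_nonneg _) hc)
  · rw [norm_mul, norm_mul]
    exact (mul_le_of_le_one_left (by positivity) ha').trans
      (mul_le_of_le_one_right (norm_nonneg _) hc)
  · rw [norm_mul, norm_mul]
    exact (mul_le_of_le_one_left (by positivity) ha').trans
      (mul_le_of_le_one_left (norm_nonneg _) hb')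

theorem norm_kernelN_sub_le {t τ : ℝ} (hτ : τ ∈ Set.Icc 0 t) (ξ η ξ' η' : Plane) :
    ‖kernelN t τ ξ η - kernelN t τ ξ' η'‖ ≤ t * (2 * Real.pi * ‖ξ - ξ'‖ +
      |symb η - symb η'| + |symb (ξ - η) - symb (ξ' - η')|) := by
  have h1 : |t - τ| ≤ t := by rw [abs_of_nonneg (by linarith [hτ.2])]; linarith [hτ.1]
  have h2 : |τ| ≤ t := by rw [abs_of_nonneg hτ.1]; exact hτ.2
  have hπ := Real.pi_pos
  have hS := schrodingerProp.bound
  refine (norm_mul_mul_sub_le (by rw [RCLike.norm_conj]; exact hS _ _) (hS _ _)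
    (cosProp.bound _ _) (by rw [RCLike.norm_conj]; exact hS _ _)).trans ?_
  rw [mul_add, mul_add, ← map_sub, RCLike.norm_conj]
  exact add_le_add (add_le_add ((norm_cos_symbol_sub_le _ _ _).trans (by gcongr))
    ((norm_schrodinger_symbol_sub_le _ _ _).trans (by gcongr)))
    ((norm_schrodinger_symbol_sub_le _ _ _).trans (by gcongr))

theorem norm_kernelU_sub_le {t τ : ℝ} (hτ : τ ∈ Set.Icc 0 t) (ξ η ξ' η' : Plane) :
    ‖kernelU t τ ξ η - kernelU t τ ξ' η'‖ ≤ t * (|symb ξ - symb ξ'| +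
      2 * Real.pi * ‖η - η'‖ + |symb (ξ - η) - symb (ξ' - η')|) := by
  have h1 : |t - τ| ≤ t := by rw [abs_of_nonneg (by linarith [hτ.2])]; linarith [hτ.1]
  have h2 : |τ| ≤ t := by rw [abs_of_nonneg hτ.1]; exact hτ.2
  have hπ := Real.pi_pos
  have hS := schrodingerProp.bound
  refine (norm_mul_mul_sub_le (cosProp.bound _ _) (hS _ _) (hS _ _) (cosProp.bound _ _)).trans ?_
  rw [mul_add, mul_add]
  exact add_le_add (add_le_add ((norm_schrodinger_symbol_sub_le _ _ _).trans (by gcongr))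
    ((norm_cos_symbol_sub_le _ _ _).trans (by gcongr)))
    ((norm_schrodinger_symbol_sub_le _ _ _).trans (by gcongr))

/-- The frequencies `c` for which `|ξ|²` is almost constant on small boxes of size `δ M⁻¹ × δ`
around `c`. -/
def Admissible (M : ℝ) (c : Plane) : Prop := |c 0| ≤ M ∧ |c 1| ≤ 1

theorem symb_neg (ξ : Plane) : symb (-ξ) = symb ξ := by simp [symb]

theorem symb_eq (ξ : Plane) : symb ξ = 4 * Real.pi ^ 2 * (ξ 0 ^ 2 + ξ 1 ^ 2) := by
  rw [symb, mul_pow, norm_sq_plane]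
  ring

/-- The symbol of `-Δ` varies by `O(δ)` on the support of a packet built from a bump of radius
`δ`. -/
theorem abs_symb_sub_le {β : ContDiffBump (0 : Plane)} (hβ : β.rOut ≤ 1) {M l : ℝ} (hM : 1 ≤ M)
    {c ξ : Plane} (hc : Admissible M c) (h : packet β M l c ξ ≠ 0) :
    |symb ξ - symb c| ≤ 24 * Real.pi ^ 2 * β.rOut := by
  have h1 := norm_stretch_lt_of_packet_ne_zero h
  have h2 : M * |ξ 0 - c 0| ≤ β.rOut := by
    have := (abs_apply_le_norm (stretch M (ξ - c)) 0).trans h1.le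
    rwa [stretch_apply_zero, abs_mul, abs_of_nonneg (by linarith : 0 ≤ M)] at this
  have h3 : |ξ 1 - c 1| ≤ β.rOut := by
    have := (abs_apply_le_norm (stretch M (ξ - c)) 1).trans h1.le
    rwa [stretch_apply_one] at this
  have hδ := β.rOut_pos
  have h4 : |ξ 0 ^ 2 - c 0 ^ 2| ≤ 3 * β.rOut := by
    have a1 : |ξ 0 - c 0| ≤ 1 := by nlinarith [abs_nonneg (ξ 0 - c 0)]
    have a2 : |ξ 0 + c 0| ≤ 3 * M := by
      have : ξ 0 + c 0 = (ξ 0 - c 0) + (c 0 + c 0) := by ring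
      rw [this]
      linarith [abs_add_le (ξ 0 - c 0) (c 0 + c 0), abs_add_le (c 0) (c 0), hc.1]
    have : ξ 0 ^ 2 - c 0 ^ 2 = (ξ 0 - c 0) * (ξ 0 + c 0) := by ring
    rw [this, abs_mul]
    nlinarith [mul_le_mul_of_nonneg_left a2 (abs_nonneg (ξ 0 - c 0))]
  have h5 : |ξ 1 ^ 2 - c 1 ^ 2| ≤ 3 * β.rOut := by
    have a2 : |ξ 1 + c 1| ≤ 3 := by
      have : ξ 1 + c 1 = (ξ 1 - c 1) + (c 1 + c 1) := by ring
      rw [this]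
      linarith [abs_add_le (ξ 1 - c 1) (c 1 + c 1), abs_add_le (c 1) (c 1), hc.2]
    have : ξ 1 ^ 2 - c 1 ^ 2 = (ξ 1 - c 1) * (ξ 1 + c 1) := by ring
    rw [this, abs_mul]
    nlinarith [mul_le_mul_of_nonneg_left a2 (abs_nonneg (ξ 1 - c 1))]
  have e : symb ξ - symb c =
      4 * Real.pi ^ 2 * ((ξ 0 ^ 2 - c 0 ^ 2) + (ξ 1 ^ 2 - c 1 ^ 2)) := by
    rw [symb_eq, symb_eq]
    ring
  rw [e, abs_mul, abs_of_nonneg (by positivity)]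
  have h6 := (abs_add_le (ξ 0 ^ 2 - c 0 ^ 2) (ξ 1 ^ 2 - c 1 ^ 2)).trans (add_le_add h4 h5)
  nlinarith [mul_le_mul_of_nonneg_left h6 (by positivity : 0 ≤ 4 * Real.pi ^ 2)]

/-- The total error of three factors of a kernel, with `2π + 48π² ≤ 500`. -/
theorem kernel_error_le {t δ : ℝ} (ht : 0 ≤ t) (hδ : 0 ≤ δ) {x y z : ℝ} (hx : x ≤ δ)
    (hy : y ≤ 24 * Real.pi ^ 2 * δ) (hz : z ≤ 24 * Real.pi ^ 2 * δ) :
    t * (2 * Real.pi * x + y + z) ≤ 500 * t * δ := by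
  have h1 := Real.pi_lt_d2
  have h2 := Real.pi_pos
  have h3 : Real.pi ^ 2 ≤ 9.95 := by nlinarith
  have h4 : 2 * Real.pi * x + y + z ≤ 500 * δ := by nlinarith [mul_le_mul_of_nonneg_left hx h2.le]
  calc t * (2 * Real.pi * x + y + z) ≤ t * (500 * δ) := mul_le_mul_of_nonneg_left h4 ht
    _ = 500 * t * δ := by ring

/-! ### Lower bounds for the second order terms -/

theorem half_mul_le_norm_of_norm_sub_le {z w : ℂ} {m J D : ℝ} (hJ : 0 ≤ J) (hw : m ≤ ‖w‖)
    (hD : D ≤ m / 2) (h : ‖z - w * (J : ℂ)‖ ≤ D * J) : m / 2 * J ≤ ‖z‖ := by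
  have h1 : ‖w * (J : ℂ)‖ = ‖w‖ * J := by rw [norm_mul, Complex.norm_real, Real.norm_of_nonneg hJ]
  have h2 : ‖w * (J : ℂ)‖ ≤ ‖z‖ + ‖z - w * (J : ℂ)‖ := by
    have := norm_sub_le z (z - w * (J : ℂ))
    rwa [sub_sub_cancel] at this
  nlinarith [mul_le_mul_of_nonneg_right hw hJ, mul_le_mul_of_nonneg_right hD hJ]

theorem integral_conv_mul_mono {f g f₁ g₁ h : Plane → ℝ} (hf₁ : ∀ ξ, 0 ≤ f₁ ξ)
    (hg₁ : ∀ ξ, 0 ≤ g₁ ξ) (hh : ∀ ξ, 0 ≤ h ξ) (hf : ∀ ξ, f₁ ξ ≤ f ξ) (hg : ∀ ξ, g₁ ξ ≤ g ξ)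
    (hi : ∀ ξ, Integrable fun η => f η * g (ξ - η))
    (hi' : Integrable fun ξ => (∫ η, f η * g (ξ - η)) * h ξ) :
    ∫ ξ, (∫ η, f₁ η * g₁ (ξ - η)) * h ξ ≤ ∫ ξ, (∫ η, f η * g (ξ - η)) * h ξ := by
  refine integral_mono_of_nonneg (Eventually.of_forall fun ξ => mul_nonneg
    (integral_nonneg fun η => mul_nonneg (hf₁ _) (hg₁ _)) (hh _)) hi'
    (Eventually.of_forall fun ξ => mul_le_mul_of_nonneg_right ?_ (hh ξ))
  exact integral_mono_of_nonneg (Eventually.of_forall fun η => mul_nonneg (hf₁ _) (hg₁ _)) (hi ξ)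
    (Eventually.of_forall fun η => mul_le_mul (hf _) (hg _) (hg₁ _) ((hf₁ _).trans (hf _)))

section LowerBound

variable {β : ContDiffBump (0 : Plane)} {t M l m k : ℝ} {c₁ c₂ d : Plane}

/-- Two packets at frequencies `c₁` and `c₂` produce, in `∂ₜn`, an output at frequency
`c₁ - c₂` whose size is governed by the time integral of the kernel at the centres. The remaining
interactions have outputs away from `c₁ - c₂`. -/
theorem le_norm_integral_quadN (ht : 0 ≤ t) (hβ : β.rOut ≤ 1) (hM : 1 ≤ M)
    (h₁ : Admissible M c₁) (h₂ : Admissible M c₂) (hsep : 3 * β.rOut ≤ ‖c₁ - c₂‖)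
    (hl : 0 ≤ l) (hm : 0 ≤ m)
    (hk : k ≤ ‖∫ τ in (0 : ℝ)..t, kernelN t τ (c₁ - c₂) (-c₂)‖)
    (hδ : 500 * t ^ 2 * β.rOut ≤ k / 2) :
    k / 2 * (l * l * m * (M⁻¹ * (M⁻¹ * overlap β))) ≤
      ‖∫ ξ, quadN t (packetS β hM l c₁ + packetS β hM l c₂ : 𝓢(Plane, ℂ)) ξ *
        packetS β hM m (c₁ - c₂) ξ‖ := by
  set f : Plane → ℝ := fun ξ => packet β M l c₁ ξ + packet β M l c₂ ξ with hf_def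
  set h : Plane → ℝ := packet β M m (c₁ - c₂) with hh_def
  have ha : ∀ ξ, (packetS β hM l c₁ + packetS β hM l c₂ : 𝓢(Plane, ℂ)) ξ = f ξ := fun ξ => by
    rw [add_apply, packetS_apply, packetS_apply, hf_def, Complex.ofReal_add]
  have hf : ∀ ξ, 0 ≤ f ξ := fun ξ => add_nonneg (packet_nonneg hl ξ) (packet_nonneg hl ξ)
  have hh : ∀ ξ, 0 ≤ h ξ := packet_nonneg hm
  have hfi : Integrable f := integrable_of_ofReal_eq _ ha
  have hfm : Integrable fun η => f (-η) := hfi.comp_neg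
  have hδ0 := β.rOut_pos.le
  have key := norm_integral_quadN_sub_le (D := 500 * t * β.rOut) ht ha (packetS_apply hM) hf hh
    (continuous_kernelN t (c₁ - c₂) (-c₂)) (fun τ hτ ξ η hξ hη => ?_)
  -- By positivity it is enough to keep one of the four interactions.
  · have hJ : l * l * m * (M⁻¹ * (M⁻¹ * overlap β)) ≤
        ∫ ξ, (∫ η, f (-η) * f (ξ - η)) * h ξ := by
      have e := integral_packet_conv_mul β hM l l m (-c₂) c₁
      rw [neg_add_eq_sub] at e
      rw [← e]
      refine integral_conv_mul_mono (packet_nonneg hl) (packet_nonneg hl) hh (fun ξ => ?_)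
        (fun ξ => ?_) (integrable_mul_comp_sub hfm _ ha)
        (integrable_ofReal_conv_mul hfm hfi _ (packetS_apply hM))
      · rw [← packet_neg]
        exact le_add_of_nonneg_left (packet_nonneg hl _)
      · exact le_add_of_nonneg_right (packet_nonneg hl _)
    have hk0 : 0 ≤ k / 2 := le_trans (by positivity) hδ
    have hJ0 : 0 ≤ l * l * m * (M⁻¹ * (M⁻¹ * overlap β)) := by
      have := (overlap_pos β).le
      positivity
    refine (mul_le_mul_of_nonneg_left hJ hk0).trans
      (half_mul_le_norm_of_norm_sub_le (D := t * (500 * t * β.rOut)) (hJ0.trans hJ) hk ?_ key)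
    linarith
  · have hξ' := norm_sub_lt_of_packet_ne_zero hM hξ
    have s1 : ∀ c c', packet β M l c (-η) ≠ 0 → packet β M l c' (ξ - η) ≠ 0 →
        ‖c' - c - (c₁ - c₂)‖ < 3 * β.rOut := fun c c' hc hc' => by
      have e : c' - c - (c₁ - c₂) = (ξ - (c₁ - c₂)) - (ξ - η - c') + (-η - c) := by abel
      rw [e]
      linarith [norm_add_le ((ξ - (c₁ - c₂)) - (ξ - η - c')) (-η - c),
        norm_sub_le (ξ - (c₁ - c₂)) (ξ - η - c'), norm_sub_lt_of_packet_ne_zero hM hc,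
        norm_sub_lt_of_packet_ne_zero hM hc']
    have hηl : packet β M l c₁ (-η) ≠ 0 ∨ packet β M l c₂ (-η) ≠ 0 := by
      by_contra! hc
      exact left_ne_zero_of_mul hη (by rw [hf_def]; simp [hc])
    have hηr : packet β M l c₁ (ξ - η) ≠ 0 ∨ packet β M l c₂ (ξ - η) ≠ 0 := by
      by_contra! hc
      exact right_ne_zero_of_mul hη (by rw [hf_def]; simp [hc])
    -- The output frequency lies near `0` or near `-(c₁ - c₂)`, except for the third pair.
    rcases hηl with hηl | hηl <;> rcases hηr with hηr | hηr
    · have := s1 _ _ hηl hηr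
      rw [sub_self, zero_sub, norm_neg] at this
      linarith
    · have := s1 _ _ hηl hηr
      have e : c₂ - c₁ - (c₁ - c₂) = -((2 : ℝ) • (c₁ - c₂)) := by rw [two_smul]; abel
      rw [e, norm_neg, norm_smul, Real.norm_of_nonneg (by norm_num)] at this
      linarith [norm_nonneg (c₁ - c₂)]
    · refine (norm_kernelN_sub_le hτ _ _ _ _).trans
        (kernel_error_le ht hδ0 hξ'.le ?_ ?_)
      · rw [symb_neg, ← symb_neg η]
        exact abs_symb_sub_le hβ hM h₂ hηl
      · rw [sub_neg_eq_add, sub_add_cancel]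
        exact abs_symb_sub_le hβ hM h₁ hηr
    · have := s1 _ _ hηl hηr
      rw [sub_self, zero_sub, norm_neg] at this
      linarith

/-- A packet of `u` at frequency `c₂` and a pair of packets of `n` at frequencies `±d` produce, in
`u`, an output at frequency `d + c₂` whose size is governed by the time integral of the kernel at
the centres. -/
theorem le_norm_integral_quadU (ht : 0 ≤ t) (hβ : β.rOut ≤ 1) (hM : 1 ≤ M)
    (h₁ : Admissible M (d + c₂)) (h₂ : Admissible M c₂) (hsep : 3 * β.rOut ≤ ‖d‖) {l' : ℝ}
    (hl : 0 ≤ l) (hl' : 0 ≤ l') (hm : 0 ≤ m)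
    (hk : k ≤ ‖∫ τ in (0 : ℝ)..t, kernelU t τ (d + c₂) d‖)
    (hδ : 500 * t ^ 2 * β.rOut ≤ k / 2) :
    k / 2 * (l' * l * m * (M⁻¹ * (M⁻¹ * overlap β))) ≤
      ‖∫ ξ, quadU t (packetS β hM l c₂) (packetS β hM l' d + packetS β hM l' (-d) : 𝓢(Plane, ℂ)) ξ *
        packetS β hM m (d + c₂) ξ‖ := by
  set f' : Plane → ℝ := fun ξ => packet β M l' d ξ + packet β M l' (-d) ξ with hf_def
  set f : Plane → ℝ := packet β M l c₂
  set h : Plane → ℝ := packet β M m (d + c₂) with hh_def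
  have hb : ∀ ξ, (packetS β hM l' d + packetS β hM l' (-d) : 𝓢(Plane, ℂ)) ξ = f' ξ := fun ξ => by
    rw [add_apply, packetS_apply, packetS_apply, hf_def, Complex.ofReal_add]
  have hf' : ∀ ξ, 0 ≤ f' ξ := fun ξ => add_nonneg (packet_nonneg hl' ξ) (packet_nonneg hl' ξ)
  have hf : ∀ ξ, 0 ≤ f ξ := packet_nonneg hl
  have hh : ∀ ξ, 0 ≤ h ξ := packet_nonneg hm
  have hfi' : Integrable f' := integrable_of_ofReal_eq _ hb
  have hδ0 := β.rOut_pos.le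
  have key := norm_integral_quadU_sub_le (D := 500 * t * β.rOut) ht (packetS_apply hM) hb
    (packetS_apply hM) hf hf' hh (continuous_kernelU t (d + c₂) d) (fun τ hτ ξ η hξ hη => ?_)
  · have hJ : l' * l * m * (M⁻¹ * (M⁻¹ * overlap β)) ≤
        ∫ ξ, (∫ η, f' η * f (ξ - η)) * h ξ := by
      rw [← integral_packet_conv_mul β hM l' l m d c₂]
      exact integral_conv_mul_mono (packet_nonneg hl') hf hh
        (fun ξ => le_add_of_nonneg_right (packet_nonneg hl' _)) (fun ξ => le_rfl)
        (integrable_mul_comp_sub hfi' _ (packetS_apply hM))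
        (integrable_ofReal_conv_mul hfi' (integrable_packet hM) _ (packetS_apply hM))
    have hk0 : 0 ≤ k / 2 := le_trans (by positivity) hδ
    have hJ0 : 0 ≤ l' * l * m * (M⁻¹ * (M⁻¹ * overlap β)) := by
      have := (overlap_pos β).le
      positivity
    refine (mul_le_mul_of_nonneg_left hJ hk0).trans
      (half_mul_le_norm_of_norm_sub_le (D := t * (500 * t * β.rOut)) (hJ0.trans hJ) hk ?_ key)
    linarith
  · have hξ' := norm_sub_lt_of_packet_ne_zero hM hξ
    have hηr : packet β M l c₂ (ξ - η) ≠ 0 := right_ne_zero_of_mul hη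
    have hηl : packet β M l' d η ≠ 0 ∨ packet β M l' (-d) η ≠ 0 := by
      by_contra! hc
      exact left_ne_zero_of_mul hη (by rw [hf_def]; simp [hc])
    rcases hηl with hηl | hηl
    · refine (norm_kernelU_sub_le hτ _ _ _ _).trans ?_
      rw [add_comm (|symb ξ - _|)]
      refine kernel_error_le ht hδ0 (norm_sub_lt_of_packet_ne_zero hM hηl).le
        (abs_symb_sub_le hβ hM h₁ hξ) ?_
      rw [add_sub_cancel_left]
      exact abs_symb_sub_le hβ hM h₂ hηr
    -- An input near `-d` has its output near `c₂ - d`, away from `c₂ + d`.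
    · exfalso
      have e : (2 : ℝ) • d = (η - -d) + (ξ - η - c₂) - (ξ - (d + c₂)) := by rw [two_smul]; abel
      have h1 : ‖(2 : ℝ) • d‖ < 3 * β.rOut := by
        rw [e]
        linarith [norm_sub_le ((η - -d) + (ξ - η - c₂)) (ξ - (d + c₂)),
          norm_add_le (η - -d) (ξ - η - c₂), norm_sub_lt_of_packet_ne_zero hM hηl,
          norm_sub_lt_of_packet_ne_zero hM hηr]
      rw [norm_smul, Real.norm_of_nonneg (by norm_num)] at h1
      linarith [norm_nonneg d]

end LowerBound

/-! ### Time integrals of the kernels at the centres -/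

/-- The real part of the integrand is `cos²`, whose mean is `1/2`. -/
theorem quarter_le_norm_integral_cos_mul_exp {t w : ℝ} (ht : 0 < t) (hw : 1 / t ≤ w) :
    t / 4 ≤ ‖∫ τ in (0 : ℝ)..t,
      (Real.cos (τ * w) : ℂ) * Complex.exp ((τ * w : ℝ) * Complex.I)‖ := by
  have hw0 : 0 < w := lt_of_lt_of_le (by positivity) hw
  have hc : Continuous fun τ : ℝ =>
      (Real.cos (τ * w) : ℂ) * Complex.exp ((τ * w : ℝ) * Complex.I) := by fun_prop
  have hre : (∫ τ in (0 : ℝ)..t,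
      (Real.cos (τ * w) : ℂ) * Complex.exp ((τ * w : ℝ) * Complex.I)).re =
      ∫ τ in (0 : ℝ)..t, Real.cos (τ * w) ^ 2 := by
    rw [← Complex.reCLM_apply,
      ← Complex.reCLM.intervalIntegral_comp_comm (hc.intervalIntegrable _ _)]
    congr 1 with τ
    rw [Complex.reCLM_apply, Complex.re_ofReal_mul, Complex.exp_ofReal_mul_I_re, sq]
  have hint : ∫ τ in (0 : ℝ)..t, Real.cos (τ * w) ^ 2 =
      t / 2 + Real.sin (2 * (t * w)) / (4 * w) := by
    have hd : ∀ τ ∈ Set.uIcc 0 t, HasDerivAt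
        (fun τ => τ / 2 + Real.sin (2 * (τ * w)) / (4 * w)) (Real.cos (τ * w) ^ 2) τ := by
      intro τ _
      have h1 : HasDerivAt (fun τ : ℝ => 2 * (τ * w)) (2 * (1 * w)) τ :=
        ((hasDerivAt_id τ).mul_const w).const_mul 2
      refine (((hasDerivAt_id τ).div_const 2).add (h1.sin.div_const (4 * w))).congr_deriv ?_
      rw [Real.cos_sq]
      field_simp
      ring
    rw [intervalIntegral.integral_eq_sub_of_hasDerivAt hd
      (Continuous.intervalIntegrable (by fun_prop) _ _)]
    simp
  refine le_trans ?_ ((le_abs_self _).trans (Complex.abs_re_le_norm _))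
  rw [hre, hint]
  have h2 : -1 / (4 * w) ≤ Real.sin (2 * (t * w)) / (4 * w) := by
    gcongr
    exact Real.neg_one_le_sin _
  have h3 : -(t / 4) ≤ -1 / (4 * w) := by
    rw [neg_div, neg_le_neg_iff, div_le_div_iff₀ (by positivity) (by norm_num)]
    rw [div_le_iff₀ ht] at hw
    linarith
  linarith

/-- At a resonance the oscillations of the kernel of `∂ₜn` cancel. -/
theorem quarter_le_norm_integral_kernelN {t : ℝ} (ht : 0 < t) {c₁ c₂ : Plane}
    (hres : symb c₁ - symb c₂ = omega (c₁ - c₂)) (hw : 1 / t ≤ omega (c₁ - c₂)) :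
    t / 4 ≤ ‖∫ τ in (0 : ℝ)..t, kernelN t τ (c₁ - c₂) (-c₂)‖ := by
  set w := omega (c₁ - c₂) with hw_def
  have e : ∀ τ, kernelN t τ (c₁ - c₂) (-c₂) = Complex.exp ((-(t * w) : ℝ) * Complex.I) *
      ((Real.cos ((t - τ) * w) : ℂ) * Complex.exp (((t - τ) * w : ℝ) * Complex.I)) := by
    intro τ
    have e1 : conj (schrodingerProp.symbol τ (-c₂)) * schrodingerProp.symbol τ (c₁ - c₂ - -c₂) =
        Complex.exp ((-(t * w) : ℝ) * Complex.I) * Complex.exp (((t - τ) * w : ℝ) * Complex.I) := by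
      rw [sub_neg_eq_add, sub_add_cancel, schrodinger_symbol_neg]
      simp only [schrodingerProp, ← Complex.exp_conj, map_mul, Complex.conj_ofReal, Complex.conj_I,
        ← Complex.exp_add]
      congr 1
      rw [← hres]
      push_cast
      ring
    rw [kernelN, e1]
    simp only [cosProp, ← hw_def]
    ring
  simp_rw [e]
  rw [intervalIntegral.integral_const_mul, norm_mul, Complex.norm_exp_ofReal_mul_I, one_mul,
    intervalIntegral.integral_comp_sub_left
      (fun τ => (Real.cos (τ * w) : ℂ) * Complex.exp ((τ * w : ℝ) * Complex.I)), sub_self, sub_zero]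
  exact quarter_le_norm_integral_cos_mul_exp ht hw

/-- At a resonance the oscillations of the kernel of `u` cancel. -/
theorem quarter_le_norm_integral_kernelU {t : ℝ} (ht : 0 < t) {c₂ d : Plane}
    (hres : symb (d + c₂) - symb c₂ = omega d) (hw : 1 / t ≤ omega d) :
    t / 4 ≤ ‖∫ τ in (0 : ℝ)..t, kernelU t τ (d + c₂) d‖ := by
  set w := omega d with hw_def
  have e : ∀ τ, kernelU t τ (d + c₂) d = Complex.exp ((-(t * symb (d + c₂)) : ℝ) * Complex.I) *
      ((Real.cos (τ * w) : ℂ) * Complex.exp ((τ * w : ℝ) * Complex.I)) := by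
    intro τ
    have e1 : schrodingerProp.symbol (t - τ) (d + c₂) * schrodingerProp.symbol τ c₂ =
        Complex.exp ((-(t * symb (d + c₂)) : ℝ) * Complex.I) *
          Complex.exp ((τ * w : ℝ) * Complex.I) := by
      simp only [schrodingerProp, ← Complex.exp_add]
      congr 1
      rw [← hres]
      push_cast
      ring
    rw [kernelU, add_sub_cancel_left, mul_left_comm, e1]
    simp only [cosProp, ← hw_def]
    ring
  simp_rw [e]
  rw [intervalIntegral.integral_const_mul, norm_mul, Complex.norm_exp_ofReal_mul_I, one_mul]
  exact quarter_le_norm_integral_cos_mul_exp ht hw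

/-- For inputs of equal length the kernel of `∂ₜn` reduces to that of the wave equation. -/
theorem norm_integral_kernelN_of_symb_eq {t : ℝ} {c₁ c₂ : Plane} (h : symb c₁ = symb c₂) :
    ‖∫ τ in (0 : ℝ)..t, kernelN t τ (c₁ - c₂) (-c₂)‖ =
      |Real.sin (t * omega (c₁ - c₂)) / omega (c₁ - c₂)| := by
  set w := omega (c₁ - c₂) with hw_def
  have hw0 : w ≠ 0 := (omega_pos _).ne'
  have e : ∀ τ, kernelN t τ (c₁ - c₂) (-c₂) = ((Real.cos ((t - τ) * w) : ℝ) : ℂ) := by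
    intro τ
    have e1 : conj (schrodingerProp.symbol τ (-c₂)) * schrodingerProp.symbol τ (c₁ - c₂ - -c₂) =
        1 := by
      rw [sub_neg_eq_add, sub_add_cancel, schrodinger_symbol_neg]
      simp only [schrodingerProp, h]
      rw [mul_comm, Complex.mul_conj, Complex.normSq_eq_norm_sq, Complex.norm_exp_ofReal_mul_I]
      simp
    rw [kernelN, e1, mul_one]
    rfl
  simp_rw [e]
  rw [intervalIntegral.integral_ofReal, Complex.norm_real, Real.norm_eq_abs,
    intervalIntegral.integral_comp_sub_left (fun τ => Real.cos (τ * w)), sub_self, sub_zero,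
    intervalIntegral.integral_comp_mul_right _ hw0, integral_cos]
  simp [div_eq_inv_mul]

/-! ### Weighted norms of the test data -/

/-- `1 + |c|²` is comparable to `B`. -/
def HasSize (B : ℝ) (c : Plane) : Prop := B ≤ 16 * (1 + ‖c‖ ^ 2) ∧ 1 + ‖c‖ ^ 2 ≤ 16 * B

/-- The height of a packet at frequencies of size `|ξ|² ~ B` that normalizes it in `H^r`. -/
def height (M B r : ℝ) : ℝ := M ^ (1 / 2 : ℝ) * B ^ (-(r / 2))

theorem height_nonneg {M B : ℝ} (hM : 1 ≤ M) (hB : 0 < B) (r : ℝ) : 0 ≤ height M B r := by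
  have : 0 ≤ M := by linarith
  rw [height]
  positivity

/-- A bound for the weighted norms of the normalized packets. -/
def packetBound (β : ContDiffBump (0 : Plane)) (r : ℝ) : ℝ := 2 * √(48 ^ |r| * ∫ z, β z ^ 2)

section Norms

variable {β : ContDiffBump (0 : Plane)} {M B r : ℝ} {c c' : Plane}

theorem integral_weight_packetS_le (hβ : β.rOut ≤ 1) (hM : 1 ≤ M) (hB : 0 < B)
    (hc : HasSize B c) :
    ∫ ξ, (1 + ‖ξ‖ ^ 2) ^ r * packet β M (height M B r) c ξ ^ 2 ≤ 48 ^ |r| * ∫ z, β z ^ 2 :=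
  integral_weight_packet_le_of_sq_eq hβ hM hB hc.1 hc.2 (sq_amplitude (by linarith) hB)

theorem sqrt_weight_packetS_le (hβ : β.rOut ≤ 1) (hM : 1 ≤ M) (hB : 0 < B) (hc : HasSize B c) :
    √(∫ ξ, (1 + ‖ξ‖ ^ 2) ^ r * ‖packetS β hM (height M B r) c ξ‖ ^ 2) ≤ packetBound β r := by
  simp only [packetS_apply, Complex.norm_real, Real.norm_eq_abs, sq_abs]
  refine (Real.sqrt_le_sqrt (integral_weight_packetS_le hβ hM hB hc)).trans ?_
  rw [packetBound]
  linarith [Real.sqrt_nonneg (48 ^ |r| * ∫ z, β z ^ 2)]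

theorem sqrt_weight_packetS_add_le (hβ : β.rOut ≤ 1) (hM : 1 ≤ M) (hB : 0 < B)
    (hc : HasSize B c) (hc' : HasSize B c') :
    √(∫ ξ, (1 + ‖ξ‖ ^ 2) ^ r * ‖(packetS β hM (height M B r) c + packetS β hM (height M B r) c' :
      𝓢(Plane, ℂ)) ξ‖ ^ 2) ≤ packetBound β r := by
  have hK : 0 ≤ 48 ^ |r| * ∫ z, β z ^ 2 := by
    have : 0 ≤ ∫ z, β z ^ 2 := integral_nonneg fun z => sq_nonneg _
    positivity
  rw [Real.sqrt_le_left (by rw [packetBound]; positivity), packetBound, mul_pow, Real.sq_sqrt hK]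
  have hle : ∫ ξ, (1 + ‖ξ‖ ^ 2) ^ r * ‖(packetS β hM (height M B r) c +
      packetS β hM (height M B r) c' : 𝓢(Plane, ℂ)) ξ‖ ^ 2 ≤
      ∫ ξ, 2 * ((1 + ‖ξ‖ ^ 2) ^ r * packet β M (height M B r) c ξ ^ 2 +
        (1 + ‖ξ‖ ^ 2) ^ r * packet β M (height M B r) c' ξ ^ 2) := by
    refine integral_mono_of_nonneg (Eventually.of_forall fun ξ => by positivity)
      (((integrable_weight_packet hM).add (integrable_weight_packet hM)).const_mul 2)
      (Eventually.of_forall fun ξ => ?_)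
    have e : ‖(packetS β hM (height M B r) c + packetS β hM (height M B r) c' :
        𝓢(Plane, ℂ)) ξ‖ ^ 2 =
        (packet β M (height M B r) c ξ + packet β M (height M B r) c' ξ) ^ 2 := by
      rw [add_apply, packetS_apply, packetS_apply, ← Complex.ofReal_add, Complex.norm_real,
        Real.norm_eq_abs, sq_abs]
    simp only [e]
    rw [← mul_add, mul_left_comm]
    exact mul_le_mul_of_nonneg_left add_sq_le (by positivity)
  refine hle.trans ?_
  rw [integral_const_mul, integral_add (integrable_weight_packet hM) (integrable_weight_packet hM)]
  linarith [integral_weight_packetS_le (r := r) hβ hM hB hc,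
    integral_weight_packetS_le (r := r) hβ hM hB hc']

end Norms

section Amplitude

variable {β : ContDiffBump (0 : Plane)} {s σ t C M B B' k : ℝ} {c₁ c₂ d : Plane}

/-- The second order bound for `∂ₜn` on normalized packets, whose norms do not depend on `M`. -/
theorem amplitudeN_le (hC : 0 ≤ C) (hbd : SecondOrderBound s σ t C) (ht : 0 ≤ t)
    (hβ : β.rOut ≤ 1) (hM : 1 ≤ M) (hB : 0 < B) (hB' : 0 < B')
    (h₁ : Admissible M c₁) (h₂ : Admissible M c₂) (hs₁ : HasSize B c₁) (hs₂ : HasSize B c₂)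
    (hs : HasSize B' (c₁ - c₂)) (hsep : 3 * β.rOut ≤ ‖c₁ - c₂‖)
    (hk : k ≤ ‖∫ τ in (0 : ℝ)..t, kernelN t τ (c₁ - c₂) (-c₂)‖)
    (hδ : 500 * t ^ 2 * β.rOut ≤ k / 2) :
    k / 2 * (height M B s * height M B s * height M B' (1 - σ) * (M⁻¹ * (M⁻¹ * overlap β))) ≤
      C * packetBound β s ^ 2 * packetBound β (1 - σ) := by
  have e0 := (hbd (packetS β hM (height M B s) c₁ + packetS β hM (height M B s) c₂) 0
    (packetS β hM (height M B' (1 - σ)) (c₁ - c₂)) (by simp)).2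
  have h0 : √(∫ ξ, (1 + ‖ξ‖ ^ 2) ^ σ * ‖(0 : 𝓢(Plane, ℂ)) ξ‖ ^ 2) = 0 := by simp
  rw [h0, add_zero] at e0
  have e1 := sqrt_weight_packetS_add_le (r := s) hβ hM hB hs₁ hs₂
  have e2 := sqrt_weight_packetS_le (r := 1 - σ) hβ hM hB' hs
  refine (le_norm_integral_quadN ht hβ hM h₁ h₂ hsep (height_nonneg hM hB _)
    (height_nonneg hM hB' _) hk hδ).trans (e0.trans ?_)
  exact mul_le_mul (mul_le_mul_of_nonneg_left (pow_le_pow_left₀ (Real.sqrt_nonneg _) e1 2) hC) e2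
    (Real.sqrt_nonneg _) (by positivity)

/-- The second order bound for `u` on normalized packets, whose norms do not depend on `M`. -/
theorem amplitudeU_le (hC : 0 ≤ C) (hbd : SecondOrderBound s σ t C) (ht : 0 ≤ t)
    (hβ : β.rOut ≤ 1) (hM : 1 ≤ M) (hB : 0 < B)
    (h₁ : Admissible M (d + c₂)) (h₂ : Admissible M c₂) (hs₁ : HasSize B (d + c₂))
    (hs₂ : HasSize B c₂) (hs : HasSize B d) (hsep : 3 * β.rOut ≤ ‖d‖)
    (hk : k ≤ ‖∫ τ in (0 : ℝ)..t, kernelU t τ (d + c₂) d‖)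
    (hδ : 500 * t ^ 2 * β.rOut ≤ k / 2) :
    k / 2 * (height M B σ * height M B s * height M B (-s) * (M⁻¹ * (M⁻¹ * overlap β))) ≤
      C * (packetBound β s + packetBound β σ) ^ 2 * packetBound β (-s) := by
  have e0 := (hbd (packetS β hM (height M B s) c₂)
    (packetS β hM (height M B σ) d + packetS β hM (height M B σ) (-d))
    (packetS β hM (height M B (-s)) (d + c₂)) fun ξ => ?_).1
  · have e1 := sqrt_weight_packetS_le (r := s) hβ hM hB hs₂
    have e2 := sqrt_weight_packetS_le (r := -s) hβ hM hB hs₁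
    have hs' : HasSize B (-d) := by simpa [HasSize] using hs
    have e3 := sqrt_weight_packetS_add_le (r := σ) hβ hM hB hs hs'
    refine (le_norm_integral_quadU ht hβ hM h₁ h₂ hsep (height_nonneg hM hB _)
      (height_nonneg hM hB _) (height_nonneg hM hB _) hk hδ).trans (e0.trans ?_)
    exact mul_le_mul (mul_le_mul_of_nonneg_left
      (pow_le_pow_left₀ (add_nonneg (Real.sqrt_nonneg _) (Real.sqrt_nonneg _)) (add_le_add e1 e3) 2)
      hC) e2 (Real.sqrt_nonneg _) (by positivity)
  · simp only [add_apply, packetS_apply, packet_neg, neg_neg, map_add, Complex.conj_ofReal]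
    rw [add_comm]

end Amplitude

/-! ### Choice of frequencies -/

theorem exists_bump {ε : ℝ} (hε : 0 < ε) : ∃ β : ContDiffBump (0 : Plane), β.rOut ≤ ε :=
  ⟨⟨ε / 2, ε, by linarith, by linarith⟩, le_rfl⟩

theorem false_of_rpow_le {p A K M₀ : ℝ} (hp : 0 < p) (hA : 0 < A)
    (h : ∀ M, M₀ ≤ M → A * M ^ p ≤ K) : False := by
  have h1 := (tendsto_rpow_atTop hp).const_mul_atTop hA
  obtain ⟨M, hM, hM'⟩ := ((h1.eventually_gt_atTop K).and (eventually_ge_atTop M₀)).exists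
  exact absurd (h M hM') (not_le.mpr hM)

theorem height_sq {M : ℝ} (hM : 0 < M) (r : ℝ) : height M (M ^ 2) r = M ^ (1 / 2 - r) := by
  rw [height, ← Real.rpow_natCast, ← Real.rpow_mul hM.le, ← Real.rpow_add hM]
  congr 1
  push_cast
  ring

theorem height_one (M r : ℝ) : height M 1 r = M ^ (1 / 2 : ℝ) := by
  rw [height, Real.one_rpow, mul_one]

/-- Frequencies `c₁`, `c₂` of size `M` on the first axis, at distance `M`, such that
`|2πc₁|² - |2πc₂|² = ω(c₁ - c₂)`. -/
theorem exists_resonant {M : ℝ} (hM : 1 ≤ M) : ∃ c₁ c₂ : Plane,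
    Admissible M c₁ ∧ Admissible M c₂ ∧ HasSize (M ^ 2) c₁ ∧ HasSize (M ^ 2) c₂ ∧
    HasSize (M ^ 2) (c₁ - c₂) ∧ M ≤ ‖c₁ - c₂‖ ∧ symb c₁ - symb c₂ = omega (c₁ - c₂) ∧
    M ≤ omega (c₁ - c₂) := by
  have hM0 : 0 < M := by linarith
  have hπ := Real.pi_gt_three
  -- For `c₁ = ((κ + M)/2, 0)` and `c₂ = ((κ - M)/2, 0)` one has `|2πc₁|² - |2πc₂|² = 4π² M κ`.
  set κ : ℝ := omega !₂[M, 0] / (4 * Real.pi ^ 2 * M) with hκ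
  have hdn : ‖(!₂[M, 0] : Plane)‖ = M := by
    rw [← abs_of_nonneg (norm_nonneg _), ← abs_of_pos hM0, ← sq_eq_sq_iff_abs_eq_abs, norm_sq_plane]
    simp
  have hω : omega !₂[M, 0] = √(1 + (2 * Real.pi * M) ^ 2) := by rw [omega, hdn]
  have hω1 : M ≤ omega !₂[M, 0] := by
    rw [hω]
    refine Real.le_sqrt_of_sq_le ?_
    have h1 : M ^ 2 * 1 ≤ M ^ 2 * (2 * Real.pi) ^ 2 :=
      mul_le_mul_of_nonneg_left (by nlinarith) (sq_nonneg M)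
    rw [mul_pow]
    linarith
  have hω2 : omega !₂[M, 0] ≤ 2 * Real.pi ^ 2 * M := by
    rw [hω, Real.sqrt_le_left (by positivity)]
    have h1 : 9 ≤ Real.pi ^ 2 := by nlinarith
    have h2 : 1 ≤ M ^ 2 := by nlinarith
    nlinarith [mul_nonneg (by nlinarith : 0 ≤ Real.pi ^ 2 * (Real.pi ^ 2 - 9))
      (by linarith : 0 ≤ M ^ 2)]
  have hκ0 : 0 ≤ κ := by
    have := (omega_pos !₂[M, 0]).le
    positivity
  have hκ1 : κ ≤ 1 / 2 := by
    rw [hκ, div_le_iff₀ (by positivity)]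
    linarith
  have hd : (!₂[(M + κ) / 2, 0] - !₂[(κ - M) / 2, 0] : Plane) = !₂[M, 0] := by
    ext i
    fin_cases i
    · simp
      ring
    · simp
  refine ⟨!₂[(M + κ) / 2, 0], !₂[(κ - M) / 2, 0], ?_⟩
  rw [hd, hdn]
  refine ⟨⟨?_, by simp⟩, ⟨?_, by simp⟩, ⟨?_, ?_⟩, ⟨?_, ?_⟩, ⟨?_, ?_⟩, le_rfl, ?_, hω1⟩
  · simp only [Matrix.cons_val_zero]
    rw [abs_le]
    constructor <;> linarith
  · simp only [Matrix.cons_val_zero]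
    rw [abs_le]
    constructor <;> linarith
  · rw [norm_sq_plane]
    simp
    nlinarith
  · rw [norm_sq_plane]
    simp
    nlinarith
  · rw [norm_sq_plane]
    simp
    nlinarith
  · rw [norm_sq_plane]
    simp
    nlinarith
  · rw [hdn]
    nlinarith
  · rw [hdn]
    nlinarith
  · rw [symb_eq, symb_eq]
    have : 4 * Real.pi ^ 2 * M * κ = omega !₂[M, 0] := by
      rw [hκ]
      field_simp
    rw [← this]
    simp
    ring

/-- A length `y ≤ 1` for which the phase `t ω` is not a multiple of `π` at frequencies of
length `y`. -/
theorem exists_sin_ne_zero {t : ℝ} (ht : 0 < t) : ∃ y : ℝ, 0 < y ∧ y ≤ 1 ∧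
    Real.sin (t * √(1 + (2 * Real.pi * y) ^ 2)) ≠ 0 := by
  have hπ := Real.pi_gt_three
  set ε : ℝ := min (1 / 2) (1 / t) with hε
  have hε0 : 0 < ε := lt_min (by norm_num) (by positivity)
  have hε1 : ε ≤ 1 / 2 := min_le_left _ _
  have hε2 : t * ε ≤ 1 := by
    have : ε ≤ 1 / t := min_le_right _ _
    rw [le_div_iff₀ ht] at this
    linarith
  have key : ∃ w, 1 < w ∧ w ≤ 2 ∧ Real.sin (t * w) ≠ 0 := by
    -- `1 + ε` and `1 + 2ε` cannot both fail, because their phases differ by `t ε < π`.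
    by_contra! hcon
    have h1 := hcon (1 + ε) (by linarith) (by linarith)
    have h2 := hcon (1 + 2 * ε) (by linarith) (by linarith)
    have h3 : Real.sin (t * ε) = 0 := by
      have e : t * ε = t * (1 + 2 * ε) - t * (1 + ε) := by ring
      rw [e, Real.sin_sub, h1, h2]
      ring
    exact (Real.sin_pos_of_pos_of_lt_pi (by positivity) (by linarith)).ne' h3
  obtain ⟨w, hw1, hw2, hw⟩ := key
  have hsq : 0 < w ^ 2 - 1 := by nlinarith
  refine ⟨√(w ^ 2 - 1) / (2 * Real.pi), by positivity, ?_, ?_⟩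
  · rw [div_le_one (by positivity), Real.sqrt_le_left (by positivity)]
    nlinarith
  · have e : 2 * Real.pi * (√(w ^ 2 - 1) / (2 * Real.pi)) = √(w ^ 2 - 1) := by field_simp
    rw [e, Real.sq_sqrt hsq.le, add_sub_cancel, Real.sqrt_sq (by linarith)]
    exact hw

/-! ### Unboundedness -/

/-- Two packets of `u` at resonant frequencies of size `M`, with an output in `∂ₜn` of size `M`. -/
theorem not_secondOrderBound_of_high_high_high {s σ t C : ℝ} (h : 0 < σ - 2 * s - 3 / 2)
    (hC : 0 ≤ C) (ht : 0 < t) : ¬ SecondOrderBound s σ t C := by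
  intro hbd
  -- The radius `1 / (4000 t)` makes the kernel error `500 t² δ` at most half of `t / 4`.
  obtain ⟨β, hβ⟩ := exists_bump (lt_min (by norm_num : (0 : ℝ) < 1 / 3)
    (by positivity : 0 < 1 / (4000 * t)))
  have hβ1 := hβ.trans (min_le_left _ _)
  have hβ2 := hβ.trans (min_le_right _ _)
  have ho := overlap_pos β
  refine false_of_rpow_le (A := t / 8 * overlap β) (M₀ := max 1 (1 / t))
    (K := C * packetBound β s ^ 2 * packetBound β (1 - σ)) h (by positivity) fun M hM => ?_
  have hM1 : 1 ≤ M := (le_max_left _ _).trans hM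
  have hM0 : 0 < M := by linarith
  obtain ⟨c₁, c₂, h₁, h₂, hs₁, hs₂, hs, hd, hres, hω⟩ := exists_resonant hM1
  refine le_trans (le_of_eq ?_) (amplitudeN_le (k := t / 4) hC hbd ht.le (by linarith) hM1
    (by positivity) (by positivity) h₁ h₂ hs₁ hs₂ hs (by linarith)
    (quarter_le_norm_integral_kernelN ht hres (((le_max_right _ _).trans hM).trans hω)) ?_)
  · have e : M ^ (σ - 2 * s - 3 / 2) =
        M ^ (1 / 2 - s) * M ^ (1 / 2 - s) * M ^ (1 / 2 - (1 - σ)) * M⁻¹ * M⁻¹ := by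
      rw [← Real.rpow_neg_one, ← Real.rpow_add hM0, ← Real.rpow_add hM0, ← Real.rpow_add hM0,
        ← Real.rpow_add hM0]
      congr 1
      ring
    rw [height_sq hM0, height_sq hM0, e]
    ring
  · rw [le_div_iff₀ (by positivity)] at hβ2
    nlinarith

/-- Two packets of `u` at frequencies of size `M`, with an output in `∂ₜn` at a fixed frequency. -/
theorem not_secondOrderBound_of_high_high_low {s σ t C : ℝ} (h : s < -(1 / 4)) (hC : 0 ≤ C)
    (ht : 0 < t) : ¬ SecondOrderBound s σ t C := by
  intro hbd
  obtain ⟨y, hy0, hy1, hy⟩ := exists_sin_ne_zero ht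
  have hdn : ‖(!₂[0, y] : Plane)‖ = y := by
    rw [← abs_of_nonneg (norm_nonneg _), ← abs_of_pos hy0, ← sq_eq_sq_iff_abs_eq_abs, norm_sq_plane]
    simp
  set k : ℝ := |Real.sin (t * omega !₂[0, y]) / omega !₂[0, y]| with hk
  have hk0 : 0 < k := by
    refine abs_pos.mpr (div_ne_zero ?_ (omega_pos _).ne')
    rwa [omega, hdn]
  obtain ⟨β, hβ⟩ := exists_bump (lt_min (by positivity : 0 < y / 3)
    (by positivity : 0 < k / (1000 * t ^ 2)))
  have hβ1 := hβ.trans (min_le_left _ _)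
  have hβ2 := hβ.trans (min_le_right _ _)
  have ho := overlap_pos β
  refine false_of_rpow_le (p := -(2 * s) - 1 / 2) (A := k / 2 * overlap β) (M₀ := 1)
    (K := C * packetBound β s ^ 2 * packetBound β (1 - σ)) (by linarith) (by positivity)
    fun M hM1 => ?_
  have hM0 : 0 < M := by linarith
  have hd : (!₂[M, y / 2] - !₂[M, -(y / 2)] : Plane) = !₂[0, y] := by
    ext i
    fin_cases i <;> simp
  have hadm : ∀ x, |x| ≤ 1 → Admissible M !₂[M, x] := fun x hx => by
    refine ⟨?_, by simpa using hx⟩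
    simp [abs_of_pos hM0]
  have hsize : ∀ x, |x| ≤ 1 → HasSize (M ^ 2) !₂[M, x] := fun x hx => by
    have hx2 : x ^ 2 ≤ 1 := (sq_le_one_iff_abs_le_one x).mpr hx
    constructor
    · rw [norm_sq_plane]
      simp
      nlinarith
    · rw [norm_sq_plane]
      simp
      nlinarith
  have ha : |y / 2| ≤ 1 := by rw [abs_of_pos (by positivity)]; linarith
  have ha' : |-(y / 2)| ≤ 1 := by rwa [abs_neg]
  have hsymb : symb !₂[M, y / 2] = symb !₂[M, -(y / 2)] := by
    rw [symb_eq, symb_eq]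
    simp
  refine le_trans (le_of_eq ?_) (amplitudeN_le (k := k) (B := M ^ 2) (B' := 1) hC hbd ht.le
    (by linarith) hM1 (by positivity) one_pos (hadm _ ha) (hadm _ ha') (hsize _ ha) (hsize _ ha')
    ?_ ?_ ?_ ?_)
  · have e : M ^ (-(2 * s) - 1 / 2) =
        M ^ (1 / 2 - s) * M ^ (1 / 2 - s) * M ^ (1 / 2 : ℝ) * M⁻¹ * M⁻¹ := by
      rw [← Real.rpow_neg_one, ← Real.rpow_add hM0, ← Real.rpow_add hM0, ← Real.rpow_add hM0,
        ← Real.rpow_add hM0]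
      congr 1
      ring
    rw [height_sq hM0, height_one, e]
    ring
  · rw [hd]
    constructor
    · linarith [sq_nonneg ‖(!₂[0, y] : Plane)‖]
    · rw [hdn]
      nlinarith
  · rw [hd, hdn]
    linarith
  · rw [norm_integral_kernelN_of_symb_eq hsymb, hd]
  · rw [le_div_iff₀ (by positivity)] at hβ2
    linarith

/-- A packet of `u` and one of `n` at resonant frequencies of size `M`, with an output in `u`. -/
theorem not_secondOrderBound_of_wave_input {s σ t C : ℝ} (h : σ < -(1 / 2)) (hC : 0 ≤ C)
    (ht : 0 < t) : ¬ SecondOrderBound s σ t C := by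
  intro hbd
  -- The radius `1 / (4000 t)` makes the kernel error `500 t² δ` at most half of `t / 4`.
  obtain ⟨β, hβ⟩ := exists_bump (lt_min (by norm_num : (0 : ℝ) < 1 / 3)
    (by positivity : 0 < 1 / (4000 * t)))
  have hβ1 := hβ.trans (min_le_left _ _)
  have hβ2 := hβ.trans (min_le_right _ _)
  have ho := overlap_pos β
  refine false_of_rpow_le (p := -σ - 1 / 2) (A := t / 8 * overlap β) (M₀ := max 1 (1 / t))
    (K := C * (packetBound β s + packetBound β σ) ^ 2 * packetBound β (-s)) (by linarith)
    (by positivity) fun M hM => ?_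
  have hM1 : 1 ≤ M := (le_max_left _ _).trans hM
  have hM0 : 0 < M := by linarith
  obtain ⟨c₁, c₂, h₁, h₂, hs₁, hs₂, hs, hd, hres, hω⟩ := exists_resonant hM1
  obtain ⟨d, rfl⟩ : ∃ d, c₁ = d + c₂ := ⟨c₁ - c₂, (sub_add_cancel _ _).symm⟩
  rw [add_sub_cancel_right] at hs hd hres hω
  refine le_trans (le_of_eq ?_) (amplitudeU_le (k := t / 4) hC hbd ht.le (by linarith) hM1
    (by positivity) h₁ h₂ hs₁ hs₂ hs (by linarith)
    (quarter_le_norm_integral_kernelU ht hres (((le_max_right _ _).trans hM).trans hω)) ?_)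
  · have e : M ^ (-σ - 1 / 2) =
        M ^ (1 / 2 - σ) * M ^ (1 / 2 - s) * M ^ (1 / 2 - -s) * M⁻¹ * M⁻¹ := by
      rw [← Real.rpow_neg_one, ← Real.rpow_add hM0, ← Real.rpow_add hM0, ← Real.rpow_add hM0,
        ← Real.rpow_add hM0]
      congr 1
      ring
    rw [height_sq hM0, height_sq hM0, height_sq hM0, e]
    ring
  · rw [le_div_iff₀ (by positivity)] at hβ2
    nlinarith

end KGS

end

theorem theorem1p2 (s σ : ℝ)
    (h : 0 < σ - 2 * s - 3 / 2 ∨ s < -(1 / 4) ∨ σ < -(1 / 2))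
    (T : ℝ) (hT : 0 < T)
    (U : Set (KGS.Phase s σ)) (hU : IsOpen U) (h0 : (0 : KGS.Phase s σ) ∈ U)
    (Φ : KGS.Phase s σ → C(Set.Icc (0 : ℝ) T, KGS.Phase s σ)) (hΦ : KGS.IsFlowMap U Φ) :
    ¬ ContDiffOn ℝ 2 Φ U ∧
      ∀ t : Set.Icc (0 : ℝ) T, 0 < (t : ℝ) → ¬ ContDiffOn ℝ 2 (fun d => Φ d t) U := by
  have key : ∀ t : Set.Icc (0 : ℝ) T, 0 < (t : ℝ) → ¬ ContDiffOn ℝ 2 (fun d => Φ d t) U := by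
    intro t ht hC
    obtain ⟨C, hC0, hbd⟩ := KGS.exists_bound_of_contDiffOn hT hU h0 hΦ t hC
    rcases h with h | h | h
    · exact KGS.not_secondOrderBound_of_high_high_high h hC0 ht hbd
    · exact KGS.not_secondOrderBound_of_high_high_low h hC0 ht hbd
    · exact KGS.not_secondOrderBound_of_wave_input h hC0 ht hbd
  refine ⟨fun hC => key ⟨T, hT.le, le_rfl⟩ hT ?_, key⟩
  exact (ContinuousMap.evalCLM ℝ _).contDiff.comp_contDiffOn hC
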